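/- **Setting.** Let $n,m,t\ge 0$, $N=2^n$, and identify $[N]$ with $\{0,1\}^n$. Let $\mathsf A$ be an $n$-qubit and $\mathsf B$ an $m$-qubit register. A $t$-query two-oracle adversary $\mathcal A$ consists of unitaries $A^{(1)},\dots,A^{(t)}$ on $\mathsf{AB}$ and indices $q_1,\dots,q_t\in\{1,2\}$. For oracles $\mathcal O_1,\mathcal O_2$ acting on $\mathsf A$ (and possibly on a further register $\mathsf E$), its view is $$|\mathcal A_t^{\mathcal O_1,\mathcal O_2}\rangle=(\mathcal O_{q_t}A^{(t)})\cdots(\mathcal O_{q_1}A^{(1)})\,|0\rangle_{\mathsf{AB}}$$ (tensored with the initial state of $\mathsf E$). Let $\mathsf{TD}(\rho,\sigma)=\frac12\|\rho-\sigma\|_1$ be the trace distance. An *injective relation* is a finite set $R=\{(x_1,y_1),\dots,(x_k,y_k)\}\subseteq\{0,1\}^n\times\{0,1\}^n$ with $y_1,\dots,y_k$ pairwise distinct; $\mathrm{Im}(R)=\{y_1,\dots,y_k\}$. Its relation state is $|R\rangle=\frac1{\sqrt{k!}}\sum_{\pi\in \mathsf{Sym}_k}|x_{\pi(1)},\dots,x_{\pi(k)}\rangle\otimes|y_{\pi(1)},\dots,y_{\pi(k)}\rangle$,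 in a recording register $\mathsf E_1$ or $\mathsf E_2$ with state space $\bigoplus_{k\le N}(\mathbb C^N\otimes\mathbb C^N)^{\otimes k}$. Both recording registers start in $|\emptyset\rangle$. All maps below are extended by zero to the orthogonal complement of the span of the listed states. * *Independent path-recording oracles*: $\mathsf{PR}_{\mathsf{AE}_j}$ $(j=1,2)$ acts on $\mathsf{AE}_j$ by $|x\rangle|R\rangle\mapsto\frac1{\sqrt{N-|R|}}\sum_{y\notin \mathrm{Im}(R)}|y\rangle|R\cup\{(x,y)\}\rangle$ for $R$ injective with $|R|<N$, and as the identity on the other recording register. * Let $0\le\lambda\le n$ and $\ell\ge1$. A set $S\subseteq\{0,1\}^n$ is *strong $\ell$-fold $\lambda$-prefix collision-free* if for every $i\le\ell$ and all $S_1,S_2\subseteq S$ of size $i$, $\bigoplus_{x\in S_1}x_{[1:\lambda]}=\bigoplus_{y\in S_2}y_{[1:\lambda]}$ if and only if $S_1=S_2$. Let $\mathsf{CF}_{\ell,\lambda}(S)$ be the set of $y\in\{0,1\}^n\setminus S$ such that $S\cup\{y\}$ is strong $\ell$-fold $\lambda$-prefix collision-free. A relation is collision-free if it is injective and its image is a strong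 $\ell$-fold $\lambda$-prefix collision-free set. * *Collision-free path-recording oracles with shared image constraint*: for $R_1,R_2$ disjoint, with $R_1$, $R_2$, $R_1\cup R_2$ collision-free and $|R_1\cup R_2|<2^n$, put $Y=\mathsf{CF}_{\ell,\lambda}(\mathrm{Im}(R_1\cup R_2))$. Then $\mathsf{cfPR}^{(\mathsf E_1)}$ maps $|x\rangle_{\mathsf A}|R_1\rangle_{\mathsf E_1}|R_2\rangle_{\mathsf E_2}\mapsto\frac1{\sqrt{|Y|}}\sum_{y\in Y}|y\rangle|R_1\cup\{(x,y)\}\rangle|R_2\rangle$ (to $0$ if $Y=\emptyset$), and $\mathsf{cfPR}^{(\mathsf E_2)}$ is defined in the same way with $(x,y)$ added to $R_2$. * *Collision-free path-recording oracles* $\mathsf{PR}^{(\mathsf E_1)},\mathsf{PR}^{(\mathsf E_2)}$: the same formulas for $R_1,R_2$ disjoint, with $R_1,R_2,R_1\cup R_2$ injective, $|R_1\cup R_2|<2^n$, $Y=\{0,1\}^n\setminus\mathrm{Im}(R_1\cup R_2)$ and normalization $1/\sqrt{N-|\mathrm{Im}(R_1\cup R_2)|}$. Put $\rho_{\mathsf{cf}}=\mathrm{Tr}_{\mathsf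 E_1\mathsf E_2}|\mathcal A_t^{\mathsf{cfPR}^{(\mathsf E_1)},\mathsf{cfPR}^{(\mathsf E_2)}}\rangle\langle\cdot|$, $\rho_{\mathsf{PR}}=\mathrm{Tr}_{\mathsf E_1\mathsf E_2}|\mathcal A_t^{\mathsf{PR}_{\mathsf{AE}_1},\mathsf{PR}_{\mathsf{AE}_2}}\rangle\langle\cdot|$, $\rho_{\mathsf{sh}}=\mathrm{Tr}_{\mathsf E_1\mathsf E_2}|\mathcal A_t^{\mathsf{PR}^{(\mathsf E_1)},\mathsf{PR}^{(\mathsf E_2)}}\rangle\langle\cdot|$ and $\rho_{\mathrm{Haar}}=\mathbb E_{U,V}|\mathcal A_t^{U,V}\rangle\langle\mathcal A_t^{U,V}|$ with $U,V$ independent Haar-random $n$-qubit unitaries. **Theorem.** There are absolute constants $C,C',C''>0$ such that for all $n,m,t\ge0$, all $0\le\lambda\le n$, all $\ell\ge1$, and every $t$-query two-oracle adversary $\mathcal A$: 1. $\mathsf{TD}(\rho_{\mathsf{cf}},\rho_{\mathsf{PR}})\le C\,\dfrac{\sqrt{\ell}\,t^{\ell+1}}{2^{\lambda/2}}$; 2.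 $\mathsf{TD}(\rho_{\mathsf{cf}},\rho_{\mathrm{Haar}})\le C'\,\dfrac{\sqrt{\ell}\,t^{\ell+1}}{2^{\lambda/2}}+\dfrac{4t(t-1)}{N+1}$; 3. for $\ell=1$, $\lambda=n$ the oracles $\mathsf{cfPR}^{(\mathsf E_j)}$ are equal to $\mathsf{PR}^{(\mathsf E_j)}$ $(j=1,2)$, and $\mathsf{TD}(\rho_{\mathsf{sh}},\rho_{\mathrm{Haar}})\le C''\,\dfrac{t^2}{\sqrt N}$. -/

import Mathlib

open scoped BigOperators Matrix Nat

noncomputable section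

namespace PathRec

/-! ### Registers, states, trace distance -/

/-- Bit strings of length `n`; addition is bitwise XOR. The query register `A` has
computational basis `BitString n`, so that its dimension is `N = 2 ^ n`. -/
abbrev BitString (n : ℕ) : Type := Fin n → ZMod 2

/-- The computational basis vector `|x⟩`. -/
def basisKet {n : ℕ} (x : BitString n) : BitString n → ℂ := Pi.single x 1

/-- The trace norm `Tr √(X† X)`. -/
def traceNorm {ι : Type} [Fintype ι] [DecidableEq ι] (X : Matrix ι ι ℂ) : ℝ :=
  ((Matrix.isHermitian_conjTranspose_mul_self X).cfc Real.sqrt).trace.re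

/-- The trace distance `½ ‖ρ - σ‖₁`. -/
def traceDist {ι : Type} [Fintype ι] [DecidableEq ι] (ρ σ : Matrix ι ι ℂ) : ℝ :=
  traceNorm (ρ - σ) / 2

/-- Partial trace over the register `E` of the rank-one operator `|ψ⟩⟨ψ|`. -/
def reducedState {ι E : Type} [Fintype E] (ψ : ι × E → ℂ) : Matrix ι ι ℂ :=
  Matrix.of fun i j => ∑ e, ψ (i, e) * star (ψ (j, e))

/-! ### Adversaries with access to two oracles -/

/-- A `t`-query two-oracle adversary, with an `n`-qubit query register `A` and an `m`-qubit
ancillary register `B`: the `i`-th query goes to the oracle with index `query i`, and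
`unitary i` is applied to `AB` right before that query. -/
structure Adversary (n m t : ℕ) where
  query : Fin t → Fin 2
  unitary : Fin t → Matrix.unitaryGroup (BitString n × BitString m) ℂ

/-- A unitary on `AB`, applied to a state on `ABE` (identity on `E`). -/
def applyLocal {n m : ℕ} {E : Type}
    (U : Matrix (BitString n × BitString m) (BitString n × BitString m) ℂ)
    (ψ : (BitString n × BitString m) × E → ℂ) : (BitString n × BitString m) × E → ℂ :=
  fun p => ∑ q, U p.1 q * ψ (q, p.2)

/-- An operator on `AE`, applied to a state on `ABE` (identity on `B`). -/
def applyOracle {n m : ℕ} {E : Type} [Fintype E]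
    (O : Matrix (BitString n × E) (BitString n × E) ℂ)
    (ψ : (BitString n × BitString m) × E → ℂ) : (BitString n × BitString m) × E → ℂ :=
  fun p => ∑ q, O (p.1.1, p.2) q * ψ ((q.1, p.1.2), q.2)

/-- The view of the adversary after all its queries,
`∏ᵢ (O⁽ⁱ⁾ A⁽ⁱ⁾) |0⟩_{AB} |init⟩_E`, for two oracles `O 0`, `O 1` acting on `AE`. -/
def Adversary.view {n m t : ℕ} (𝒜 : Adversary n m t) {E : Type} [Fintype E]
    (O : Fin 2 → Matrix (BitString n × E) (BitString n × E) ℂ) (init : E → ℂ) :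
    (BitString n × BitString m) × E → ℂ :=
  Fin.foldl t
    (fun ψ i => applyOracle (O (𝒜.query i)) (applyLocal (𝒜.unitary i).1 ψ))
    (fun p => if p.1 = 0 then init p.2 else 0)

/-! ### Relation states -/

/-- A relation on `{0,1}ⁿ × {0,1}ⁿ` without repeated pairs. -/
abbrev Rel (n : ℕ) : Type := Finset (BitString n × BitString n)

/-- The image of a relation. -/
def im {n : ℕ} (R : Rel n) : Finset (BitString n) := R.image Prod.snd

/-- A relation is injective if distinct pairs have distinct second components. -/
def IsInj {n : ℕ} (R : Rel n) : Prop := Set.InjOn Prod.snd (R : Set (BitString n × BitString n))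

/-- Computational basis of a recording register `E`: sequences of at most `N` pairs, that is
`E = ⨁_{k ≤ N} (ℂ^N ⊗ ℂ^N)^{⊗ k}`. -/
abbrev RecIdx (n : ℕ) : Type := Σ k : Fin (2 ^ n + 1), (Fin k → BitString n × BitString n)

/-- The relation state `|R⟩`: the uniform superposition, with amplitude `1 / √(k!)`, of the `k!`
orderings of the `k` (pairwise distinct) pairs of `R`. -/
def relKet {n : ℕ} (R : Rel n) : RecIdx n → ℂ := fun s =>
  if Finset.univ.val.map s.2 = R.val then ((Real.sqrt (R.card ! : ℝ) : ℝ) : ℂ)⁻¹ else 0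

/-! ### Path-recording operators -/

open Classical in
/-- The path-recording map on `AE`,
`|x⟩|R⟩ ↦ (N - |R|)^{-1/2} ∑_{y ∉ Im R} |y⟩|R ∪ {(x,y)}⟩` for injective `R` with `|R| < N`
(and zero on the orthogonal complement of the span of these states). -/
def pr (n : ℕ) : Matrix (BitString n × RecIdx n) (BitString n × RecIdx n) ℂ :=
  ∑ x : BitString n, ∑ R : Rel n with IsInj R ∧ R.card < 2 ^ n,
    Matrix.vecMulVec
      (((Real.sqrt ((2 : ℝ) ^ n - R.card) : ℝ) : ℂ)⁻¹ •
        ∑ y ∈ Finset.univ \ im R,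
          fun p : BitString n × RecIdx n => basisKet y p.1 * relKet (insert (x, y) R) p.2)
      (star fun p : BitString n × RecIdx n => basisKet x p.1 * relKet R p.2)

/-- Two independent path-recording oracles on `A E₁ E₂`: oracle `0` is the path-recording map on
`A E₁` and oracle `1` is the path-recording map on `A E₂`. -/
def prOracle (n : ℕ) (j : Fin 2) :
    Matrix (BitString n × (RecIdx n × RecIdx n)) (BitString n × (RecIdx n × RecIdx n)) ℂ :=
  Matrix.of fun p q =>
    if j = 0 then pr n (p.1, p.2.1) (q.1, q.2.1) * (if p.2.2 = q.2.2 then 1 else 0)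
    else pr n (p.1, p.2.2) (q.1, q.2.2) * (if p.2.1 = q.2.1 then 1 else 0)

/-- The vector `|x⟩_A |R₁⟩_{E₁} |R₂⟩_{E₂}`. -/
def ket {n : ℕ} (x : BitString n) (R₁ R₂ : Rel n) :
    BitString n × (RecIdx n × RecIdx n) → ℂ :=
  fun p => basisKet x p.1 * relKet R₁ p.2.1 * relKet R₂ p.2.2

/-- The first `lam` bits of a bit string. -/
def takeBits {n : ℕ} (lam : ℕ) (x : BitString n) : {j : Fin n // (j : ℕ) < lam} → ZMod 2 :=
  fun j => x j

/-- Strong `ℓ`-fold `lam`-prefix collision-free sets. -/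
def StrongCF {n : ℕ} (ℓ lam : ℕ) (S : Finset (BitString n)) : Prop :=
  ∀ i ≤ ℓ, ∀ S₁ ⊆ S, ∀ S₂ ⊆ S, S₁.card = i → S₂.card = i →
    (∑ x ∈ S₁, takeBits lam x = ∑ y ∈ S₂, takeBits lam y ↔ S₁ = S₂)

open Classical in
/-- The new outputs `y` (not already in `S`) that keep `S ∪ {y}` collision-free. -/
def CF {n : ℕ} (ℓ lam : ℕ) (S : Finset (BitString n)) : Finset (BitString n) :=
  Finset.univ.filter fun y => y ∉ S ∧ StrongCF ℓ lam (insert y S)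

/-- Strong `ℓ`-fold `lam`-prefix collision-free relations (they are injective, and their image is
collision-free). -/
def IsCFRel {n : ℕ} (ℓ lam : ℕ) (R : Rel n) : Prop := IsInj R ∧ StrongCF ℓ lam (im R)

/-- `R_j ∪ {(x, y)}` for the pair of relations `(R₁, R₂)`: the pair `(x, y)` is recorded in
`E₁` if `j = 0` and in `E₂` if `j = 1`. -/
def record {n : ℕ} (j : Fin 2) (x : BitString n) (R₁ R₂ : Rel n) (y : BitString n) :
    BitString n × (RecIdx n × RecIdx n) → ℂ :=
  if j = 0 then ket y (insert (x, y) R₁) R₂ else ket y R₁ (insert (x, y) R₂)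

open Classical in
/-- The two strong `ℓ`-fold `lam`-prefix collision-free path-recording oracles (`j = 0, 1`) on
`A E₁ E₂`; both are constrained by the joint image `Im (R₁ ∪ R₂)`. -/
def cfprOracle (n ℓ lam : ℕ) (j : Fin 2) :
    Matrix (BitString n × (RecIdx n × RecIdx n)) (BitString n × (RecIdx n × RecIdx n)) ℂ :=
  ∑ x : BitString n, ∑ R : Rel n × Rel n with
      IsCFRel ℓ lam R.1 ∧ IsCFRel ℓ lam R.2 ∧ IsCFRel ℓ lam (R.1 ∪ R.2) ∧
        Disjoint R.1 R.2 ∧ (R.1 ∪ R.2).card < 2 ^ n,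
    Matrix.vecMulVec
      (((Real.sqrt ((CF ℓ lam (im (R.1 ∪ R.2))).card : ℝ) : ℝ) : ℂ)⁻¹ •
        ∑ y ∈ CF ℓ lam (im (R.1 ∪ R.2)), record j x R.1 R.2 y)
      (star (ket x R.1 R.2))

open Classical in
/-- The two collision-free path-recording oracles (`j = 0, 1`) on `A E₁ E₂` that share the
constraint that the new output avoids the joint image `Im (R₁ ∪ R₂)`. -/
def sharedPrOracle (n : ℕ) (j : Fin 2) :
    Matrix (BitString n × (RecIdx n × RecIdx n)) (BitString n × (RecIdx n × RecIdx n)) ℂ :=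
  ∑ x : BitString n, ∑ R : Rel n × Rel n with
      IsInj R.1 ∧ IsInj R.2 ∧ IsInj (R.1 ∪ R.2) ∧
        Disjoint R.1 R.2 ∧ (R.1 ∪ R.2).card < 2 ^ n,
    Matrix.vecMulVec
      (((Real.sqrt ((2 : ℝ) ^ n - (im (R.1 ∪ R.2)).card) : ℝ) : ℂ)⁻¹ •
        ∑ y ∈ Finset.univ \ im (R.1 ∪ R.2), record j x R.1 R.2 y)
      (star (ket x R.1 R.2))

/-- The reduced state on `AB` of an adversary with two oracles recording in `E₁ E₂`, where both
recording registers start in the state `|∅⟩` of the empty relation. -/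
def Adversary.recState {n m t : ℕ} (𝒜 : Adversary n m t)
    (O : Fin 2 →
      Matrix (BitString n × (RecIdx n × RecIdx n)) (BitString n × (RecIdx n × RecIdx n)) ℂ) :
    Matrix (BitString n × BitString m) (BitString n × BitString m) ℂ :=
  reducedState (𝒜.view O fun e => relKet ∅ e.1 * relKet ∅ e.2)

/-! ### Haar-random unitaries -/

instance compactSpace_unitaryGroup {ι : Type} [Fintype ι] [DecidableEq ι] :
    CompactSpace (Matrix.unitaryGroup ι ℂ) := by
  refine isCompact_iff_compactSpace.mp (?_ : IsCompact (Matrix.unitaryGroup ι ℂ : Set (Matrix ι ι ℂ)))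
  have hK : IsCompact (Set.pi Set.univ fun _ : ι => Set.pi Set.univ fun _ : ι =>
      Metric.closedBall (0 : ℂ) 1) :=
    isCompact_univ_pi fun _ => isCompact_univ_pi fun _ => isCompact_closedBall 0 1
  refine hK.of_isClosed_subset ?_ ?_
  · exact isClosed_unitary (R := Matrix ι ι ℂ)
  · intro U hU i _ j _
    simpa using entry_norm_bound_of_unitary hU i j

instance measurableSpace_unitaryGroup {ι : Type} [Fintype ι] [DecidableEq ι] :
    MeasurableSpace (Matrix.unitaryGroup ι ℂ) := borel _

instance borelSpace_unitaryGroup {ι : Type} [Fintype ι] [DecidableEq ι] :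
    BorelSpace (Matrix.unitaryGroup ι ℂ) := ⟨rfl⟩

/-- The Haar probability measure on the `n`-qubit unitary group. -/
def haar (n : ℕ) : MeasureTheory.Measure (Matrix.unitaryGroup (BitString n) ℂ) :=
  MeasureTheory.Measure.haarMeasure ⊤

/-- Two unitary oracles on `A` (the register `E` is trivial). -/
def unitaryOracle {n : ℕ} (U V : Matrix.unitaryGroup (BitString n) ℂ) (j : Fin 2) :
    Matrix (BitString n × Unit) (BitString n × Unit) ℂ :=
  Matrix.of fun p q => if j = 0 then U.1 p.1 q.1 else V.1 p.1 q.1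

/-- The averaged state `𝔼_{U,V} |𝒜^{U,V}⟩⟨𝒜^{U,V}|` for independent Haar-random `U`, `V`. -/
def Adversary.haarState {n m t : ℕ} (𝒜 : Adversary n m t) :
    Matrix (BitString n × BitString m) (BitString n × BitString m) ℂ :=
  Matrix.of fun i j =>
    ∫ W, reducedState (𝒜.view (unitaryOracle W.1 W.2) fun _ => 1) i j ∂((haar n).prod (haar n))

end PathRec

end

set_option linter.unusedSectionVars false

namespace PathRec

noncomputable section

/-! ### Iteration -/

/-! The two recorded relations are encoded as one partial function `g`, with `g (j, y) = some x`
when (x, y) is recorded by oracle j. Relation states are orthonormal, so every recording oracle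
becomes a weighted step `recStep w j` on such functions, and the oracles differ only in the weights
(`recState_eq`). Trace distances are tested through Tr(Wρ) with W unitary (`traceDist_le`).

Collision-free against independent recording. From a fixed `g`, one oracle spreads the output
uniformly over the set F of outputs free for oracle j, the other uniformly over a subset Y of F. A
prefix collision caused by y forces the prefix of y to be the XOR of the prefixes of some A and B in
the joint image with |B| = |A| + 1 ≤ ℓ. Hence F \ Y has at most 2 ℓ t^(2ℓ) 2^(n-λ) elements, one
query costs O(√ℓ t^ℓ / 2^(λ/2)) in Euclidean norm (`sum_cfWeight_sub_prWeight_sq_le`), and the t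
costs add up (`l2_cfView_sub_prView_le`). When 2t ≥ N the claimed bound is trivial.

Independent recording against Haar. By left invariance a Haar unitary U may be replaced by P_π D_f H
D_k U, with P_π a random permutation, D_f random signs, H the Hadamard transform and D_k random
cubic phases. Averaging over f turns the signs into a register holding the set S of inputs queried
an odd number of times. On |S| = t the amplitude is the path-recording amplitude divided by the
square root of the probability that π extends `g` (`fourView_spec`). Averaging over π therefore
gives exactly the part of the path-recording state on which the recorded inputs of each oracle are
distinct (`sum_graphOn`); the error is twice the weight of the remaining part
(`norm_sum_fourView_sub_le`).

That weight is small thanks to H D_k: rotating queries before recording amounts to rotating the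
recorded inputs (`recView_twist`). This leaves the reduced state unchanged, but makes two recorded
inputs agree with probability at most 2/N (`sum_twirl_collision_le`). The resulting error of order
t²/N is at most t²/√N, which the collision-free error already dominates. -/

lemma foldl_rel {α β : Type*} (P : ℕ → α → β → Prop) :
    ∀ (t : ℕ) (f : α → Fin t → α) (g : β → Fin t → β) (a : α) (b : β), P 0 a b →
      (∀ (i : Fin t) (a : α) (b : β), P i a b → P (i + 1) (f a i) (g b i)) →
      P t (Fin.foldl t f a) (Fin.foldl t g b) := by
  intro t
  induction t with
  | zero => intro f g a b h0 _; simpa using h0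
  | succ t ih =>
    intro f g a b h0 hs
    rw [Fin.foldl_succ_last, Fin.foldl_succ_last]
    refine hs (Fin.last t) _ _ ?_
    exact ih _ _ a b h0 fun i a b h => hs i.castSucc a b h

lemma foldl_ind {α : Type*} (P : ℕ → α → Prop) (t : ℕ) (f : α → Fin t → α) (a : α) (h0 : P 0 a)
    (hs : ∀ (i : Fin t) (a : α), P i a → P (i + 1) (f a i)) : P t (Fin.foldl t f a) :=
  foldl_rel (fun i a (_ : α) => P i a) t f f a a h0 fun i a _ h => hs i a h

/-! ### Euclidean norm -/

/-- The Euclidean norm of a state vector. -/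
def l2 {α : Type*} [Fintype α] (ψ : α → ℂ) : ℝ :=
  ‖(WithLp.toLp 2 ψ : EuclideanSpace ℂ α)‖

section
variable {α : Type*} [Fintype α]

lemma l2_nonneg (ψ : α → ℂ) : 0 ≤ l2 ψ := norm_nonneg _

lemma l2_sq (ψ : α → ℂ) : l2 ψ ^ 2 = ∑ a, ‖ψ a‖ ^ 2 := by
  simp [l2, EuclideanSpace.norm_sq_eq]

lemma l2_add_le (ψ χ : α → ℂ) : l2 (ψ + χ) ≤ l2 ψ + l2 χ := by
  simpa [l2] using norm_add_le (WithLp.toLp 2 ψ : EuclideanSpace ℂ α) (WithLp.toLp 2 χ)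

lemma l2_sub_le (ψ χ : α → ℂ) : l2 (ψ - χ) ≤ l2 ψ + l2 χ := by
  simpa [l2] using norm_sub_le (WithLp.toLp 2 ψ : EuclideanSpace ℂ α) (WithLp.toLp 2 χ)

lemma norm_sum_star_mul_le (χ ψ : α → ℂ) : ‖∑ a, star (χ a) * ψ a‖ ≤ l2 χ * l2 ψ := by
  have := norm_inner_le_norm (𝕜 := ℂ) (WithLp.toLp 2 χ : EuclideanSpace ℂ α) (WithLp.toLp 2 ψ)
  simpa [l2, PiLp.inner_apply, mul_comm] using this

lemma sum_norm_sq_eq (v : α → ℂ) : ((∑ a, ‖v a‖ ^ 2 : ℝ) : ℂ) = star v ⬝ᵥ v := by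
  simp only [dotProduct, Pi.star_apply, Complex.ofReal_sum, Complex.ofReal_pow]
  refine Finset.sum_congr rfl fun a _ => ?_
  rw [← Complex.conj_mul']; rfl

lemma sum_norm_sq_mulVec [DecidableEq α] {M : Matrix α α ℂ} (hM : M ∈ Matrix.unitaryGroup α ℂ)
    (v : α → ℂ) : ∑ a, ‖(M *ᵥ v) a‖ ^ 2 = ∑ a, ‖v a‖ ^ 2 := by
  have h : star M * M = 1 := (Matrix.mem_unitaryGroup_iff').1 hM
  rw [← Complex.ofReal_inj, sum_norm_sq_eq, sum_norm_sq_eq, Matrix.star_mulVec,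
    ← Matrix.dotProduct_mulVec, Matrix.mulVec_mulVec]
  rw [Matrix.star_eq_conjTranspose] at h
  rw [h, Matrix.one_mulVec]

end

/-! ### Trace distance -/

lemma isHermitian_reducedState {ι E : Type} [Fintype E] (ψ : ι × E → ℂ) :
    (reducedState ψ).IsHermitian := by
  ext i j
  simp only [Matrix.conjTranspose_apply, reducedState, Matrix.of_apply, star_sum, star_mul',
    star_star]
  exact Finset.sum_congr rfl fun e _ => mul_comm _ _

/-- The witness is the sign of X in the functional calculus, so that W X = |X|. The sign takes the
value 1 at 0; otherwise W would only be a partial isometry. -/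
lemma exists_unitary_traceNorm {ι : Type} [Fintype ι] [DecidableEq ι] {X : Matrix ι ι ℂ}
    (hX : X.IsHermitian) :
    ∃ W ∈ Matrix.unitaryGroup ι ℂ, traceNorm X = (W * X).trace.re := by
  have hsa : IsSelfAdjoint X := hX
  have hc : ∀ f : ℝ → ℝ, ContinuousOn f (spectrum ℝ X) := fun f =>
    Matrix.finite_real_spectrum.continuousOn f
  set s : ℝ → ℝ := fun x => if 0 ≤ x then 1 else -1 with hs
  refine ⟨cfc s X, ?_, ?_⟩
  · rw [Matrix.mem_unitaryGroup_iff]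
    have h1 : star (cfc s X) = cfc s X := (cfc_predicate s X : IsSelfAdjoint _)
    rw [h1, ← cfc_mul s s X (hc _) (hc _)]
    have : (fun x => s x * s x) = fun _ => (1 : ℝ) := by
      funext x; simp only [hs]; split_ifs <;> norm_num
    rw [this, cfc_const_one ℝ X]
  · unfold traceNorm
    rw [← Matrix.IsHermitian.cfc_eq]
    have h2 : Xᴴ * X = cfc (fun x : ℝ => x ^ 2) X := by
      rw [cfc_pow_id (R := ℝ) X 2, hX.eq, sq]
    have h3 : cfc s X * X = cfc (fun x => s x * x) X := by
      rw [cfc_mul s (fun x => x) X (hc _) (hc _), cfc_id' ℝ X]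
    rw [h2, h3, ← cfc_comp Real.sqrt (fun x : ℝ => x ^ 2) X hsa
      (Real.continuous_sqrt.continuousOn) (hc _)]
    have : (Real.sqrt ∘ fun x : ℝ => x ^ 2) = fun x => s x * x := by
      funext x
      simp only [Function.comp, hs, Real.sqrt_sq_eq_abs]
      split_ifs with h
      · rw [abs_of_nonneg h, one_mul]
      · rw [abs_of_neg (not_le.1 h)]; ring
    rw [this]

lemma traceDist_le {ι : Type} [Fintype ι] [DecidableEq ι] {ρ σ : Matrix ι ι ℂ}
    (hρ : ρ.IsHermitian) (hσ : σ.IsHermitian) {c : ℝ}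
    (h : ∀ W ∈ Matrix.unitaryGroup ι ℂ, ‖(W * ρ).trace - (W * σ).trace‖ ≤ 2 * c) :
    traceDist ρ σ ≤ c := by
  obtain ⟨W, hW, hWX⟩ := exists_unitary_traceNorm (hρ.sub hσ)
  have h1 := h W hW
  rw [← Matrix.trace_sub, ← mul_sub] at h1
  have h2 := (Complex.re_le_norm _).trans h1
  unfold traceDist
  rw [hWX]
  linarith

/-! ### Local unitaries and reduced states -/

section
variable {n m : ℕ} {E : Type}

lemma applyLocal_sub (U : Matrix (BitString n × BitString m) (BitString n × BitString m) ℂ)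
    (ψ χ : (BitString n × BitString m) × E → ℂ) :
    applyLocal U (ψ - χ) = applyLocal U ψ - applyLocal U χ := by
  funext p
  simp [applyLocal, mul_sub, Finset.sum_sub_distrib]

lemma applyLocal_mul (U V : Matrix (BitString n × BitString m) (BitString n × BitString m) ℂ)
    (ψ : (BitString n × BitString m) × E → ℂ) :
    applyLocal (U * V) ψ = applyLocal U (applyLocal V ψ) := by
  funext p
  simp only [applyLocal, Matrix.mul_apply, Finset.sum_mul, Finset.mul_sum]
  rw [Finset.sum_comm]
  simp only [mul_assoc]

variable [Fintype E]

lemma l2_applyLocal {U : Matrix (BitString n × BitString m) (BitString n × BitString m) ℂ}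
    (hU : U ∈ Matrix.unitaryGroup (BitString n × BitString m) ℂ)
    (ψ : (BitString n × BitString m) × E → ℂ) : l2 (applyLocal U ψ) = l2 ψ := by
  rw [← sq_eq_sq₀ (l2_nonneg _) (l2_nonneg _), l2_sq, l2_sq, Fintype.sum_prod_type_right,
    Fintype.sum_prod_type_right]
  refine Finset.sum_congr rfl fun e _ => ?_
  exact sum_norm_sq_mulVec hU fun q => ψ (q, e)

lemma trace_mul_reducedState
    (W : Matrix (BitString n × BitString m) (BitString n × BitString m) ℂ)
    (ψ : (BitString n × BitString m) × E → ℂ) :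
    (W * reducedState ψ).trace =
      ∑ p : (BitString n × BitString m) × E, star (ψ p) * applyLocal W ψ p := by
  simp only [Matrix.trace, Matrix.diag, Matrix.mul_apply, reducedState, Matrix.of_apply,
    applyLocal, Finset.mul_sum]
  conv_rhs => rw [Fintype.sum_prod_type]
  refine Finset.sum_congr rfl fun i _ => ?_
  rw [Finset.sum_comm]
  refine Finset.sum_congr rfl fun e _ => Finset.sum_congr rfl fun q _ => ?_
  ring

lemma norm_trace_mul_reducedState_le
    {W : Matrix (BitString n × BitString m) (BitString n × BitString m) ℂ}
    (hW : W ∈ Matrix.unitaryGroup (BitString n × BitString m) ℂ)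
    (ψ : (BitString n × BitString m) × E → ℂ) :
    ‖(W * reducedState ψ).trace‖ ≤ l2 ψ ^ 2 := by
  rw [trace_mul_reducedState]
  refine (norm_sum_star_mul_le _ _).trans ?_
  rw [l2_applyLocal hW, sq]

/-- Telescoping in the two arguments of the form ⟨ψ, Wψ⟩, followed by Cauchy-Schwarz. Normalization
is not assumed, because the recording oracles can lose norm. -/
lemma norm_trace_mul_reducedState_sub_le
    {W : Matrix (BitString n × BitString m) (BitString n × BitString m) ℂ}
    (hW : W ∈ Matrix.unitaryGroup (BitString n × BitString m) ℂ)
    (ψ χ : (BitString n × BitString m) × E → ℂ) :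
    ‖(W * reducedState ψ).trace - (W * reducedState χ).trace‖ ≤ (l2 ψ + l2 χ) * l2 (ψ - χ) := by
  have h : (W * reducedState ψ).trace - (W * reducedState χ).trace =
      (∑ p, star (ψ p) * applyLocal W (ψ - χ) p) +
        ∑ p, star ((ψ - χ) p) * applyLocal W χ p := by
    rw [trace_mul_reducedState, trace_mul_reducedState, applyLocal_sub, ← Finset.sum_sub_distrib,
      ← Finset.sum_add_distrib]
    refine Finset.sum_congr rfl fun p _ => ?_
    simp only [Pi.sub_apply, star_sub]
    ring
  rw [h]
  refine (norm_add_le _ _).trans ?_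
  have h1 := norm_sum_star_mul_le ψ (applyLocal W (ψ - χ))
  have h2 := norm_sum_star_mul_le (ψ - χ) (applyLocal W χ)
  rw [l2_applyLocal hW] at h1 h2
  linarith

end

/-! ### Orthonormality of relation states -/

lemma exists_equiv_of_map_univ_val {α : Type*} [DecidableEq α] {k : ℕ} {R : Finset α}
    {s : Fin k → α} (h : Finset.univ.val.map s = R.val) :
    Function.Injective s ∧ ∀ a, a ∈ R ↔ ∃ i, s i = a := by
  constructor
  · have hn : (Finset.univ.val.map s).Nodup := h ▸ R.nodup
    intro i j hij
    exact Multiset.inj_on_of_nodup_map hn i (Finset.mem_univ i) j (Finset.mem_univ j) hij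
  · intro a
    rw [← Finset.mem_val, ← h]
    simp

/-- Orderings of R are the bijections from `Fin R.card` to R. -/
lemma card_enumerations {α : Type*} [Fintype α] [DecidableEq α] (R : Finset α) :
    (Finset.univ.filter fun s : Fin R.card → α => Finset.univ.val.map s = R.val).card =
      R.card ! := by
  have e : {s : Fin R.card → α // Finset.univ.val.map s = R.val} ≃ (Fin R.card ≃ R) :=
    { toFun := fun s => Equiv.ofBijective
        (fun i => ⟨s.1 i, ((exists_equiv_of_map_univ_val s.2).2 _).2 ⟨i, rfl⟩⟩)
        ⟨fun i j hij => (exists_equiv_of_map_univ_val s.2).1 (Subtype.ext_iff.1 hij),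
          fun a => by
            obtain ⟨i, hi⟩ := ((exists_equiv_of_map_univ_val s.2).2 a.1).1 a.2
            exact ⟨i, Subtype.ext hi⟩⟩
      invFun := fun f => ⟨fun i => (f i).1, by
        have h1 : (fun i => (f i).1) = Subtype.val ∘ f := rfl
        rw [h1, ← Multiset.map_map, Multiset.map_univ_val_equiv]
        exact Multiset.attach_map_val _⟩
      left_inv := fun s => rfl
      right_inv := fun f => by ext; rfl }
  rw [← Fintype.card_subtype, Fintype.card_congr e, Fintype.card_equiv R.equivFin.symm]
  simp

/-- A sequence lists only one set, so distinct relation states have disjoint supports. The size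
bound is needed for the norm: a relation with more than N pairs does not fit in the register and has
zero state. -/
lemma sum_star_relKet_mul {n : ℕ} (R R' : Rel n) (hR : R'.card ≤ 2 ^ n) :
    ∑ e, star (relKet R e) * relKet R' e = if R = R' then 1 else 0 := by
  split_ifs with h
  · subst h
    have h1 : ∀ e, star (relKet R e) * relKet R e =
        if Finset.univ.val.map e.2 = R.val then ((R.card ! : ℝ) : ℂ)⁻¹ else 0 := by
      intro e
      unfold relKet
      split_ifs with h
      · rw [Complex.star_def, ← Complex.ofReal_inv, Complex.conj_ofReal, ← Complex.ofReal_mul,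
          ← mul_inv, Real.mul_self_sqrt (by positivity), Complex.ofReal_inv]
      · simp
    simp_rw [h1]
    rw [Fintype.sum_sigma, Finset.sum_eq_single (⟨R.card, by omega⟩ : Fin (2 ^ n + 1))]
    · rw [← Finset.sum_filter, Finset.sum_const, card_enumerations, nsmul_eq_mul]
      push_cast
      exact mul_inv_cancel₀ (by exact_mod_cast (Nat.factorial_pos _).ne')
    · intro k _ hk
      refine Finset.sum_eq_zero fun s _ => if_neg fun hs => hk ?_
      have := congrArg Multiset.card hs
      simp at this
      exact Fin.ext this
    · simp
  · refine Finset.sum_eq_zero fun e _ => ?_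
    unfold relKet
    split_ifs with h1 h2
    · exact absurd (Finset.val_injective (h1.symm.trans h2)) h
    all_goals simp

/-! ### Recording partial functions -/

/-- Pairs of injective relations, encoded as partial functions: `g (j, y) = some x` means that
`(x, y)` is recorded in the `j`-th relation. -/
abbrev PFun (n : ℕ) : Type := Fin 2 × BitString n → Option (BitString n)

/-- Functions are grouped according to their values away from `a`, each group being represented by
its member with value `o` at `a`. With `o = none` this matches the state after a query with the
states before it. -/
lemma sum_eq_sum_update {I κ M : Type*} [Fintype I] [DecidableEq I] [Fintype κ] [DecidableEq κ]
    [AddCommMonoid M] (a : I) (o : κ) (G : (I → κ) → M) :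
    ∑ g, G g = ∑ g : I → κ, if g a = o then ∑ u, G (Function.update g a u) else 0 := by
  rw [← Finset.sum_filter, ← Finset.sum_product']
  symm
  refine Finset.sum_nbij' (fun q => Function.update q.1 a q.2)
    (fun g => (Function.update g a o, g a)) ?_ ?_ ?_ ?_ ?_
  · simp
  · simp
  · rintro ⟨g, u⟩ h
    simp only [Finset.mem_product, Finset.mem_filter, Finset.mem_univ, true_and, and_true] at h
    simp [← h]
  · simp
  · simp

section
variable {n m : ℕ}

/-- The `j`-th relation encoded by a partial function. -/
def rel (g : PFun n) (j : Fin 2) : Rel n := Finset.univ.filter fun q => g (j, q.2) = some q.1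

/-- The image of the `j`-th relation encoded by a partial function. -/
def supp (g : PFun n) (j : Fin 2) : Finset (BitString n) :=
  Finset.univ.filter fun y => g (j, y) ≠ none

lemma mem_rel {g : PFun n} {j : Fin 2} {q : BitString n × BitString n} :
    q ∈ rel g j ↔ g (j, q.2) = some q.1 := by simp [rel]

lemma mem_supp {g : PFun n} {j : Fin 2} {y : BitString n} :
    y ∈ supp g j ↔ g (j, y) ≠ none := by simp [supp]

lemma isInj_rel (g : PFun n) (j : Fin 2) : IsInj (rel g j) := by
  rintro ⟨x, y⟩ hx ⟨x', y'⟩ hx' (h : y = y')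
  rw [Finset.mem_coe, mem_rel] at hx hx'
  subst h
  simp only at hx hx'
  rw [hx] at hx'
  simpa using hx'

lemma im_rel (g : PFun n) (j : Fin 2) : im (rel g j) = supp g j := by
  ext y
  simp only [im, Finset.mem_image, mem_rel, mem_supp, Prod.exists, exists_eq_right]
  exact Option.ne_none_iff_exists'.symm

lemma card_rel (g : PFun n) (j : Fin 2) : (rel g j).card = (supp g j).card := by
  rw [← im_rel, im, Finset.card_image_of_injOn (isInj_rel g j)]

lemma card_bitString (n : ℕ) : Fintype.card (BitString n) = 2 ^ n := by
  simp [BitString]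

lemma card_supp_le (g : PFun n) (j : Fin 2) : (supp g j).card ≤ 2 ^ n :=
  (Finset.card_le_univ _).trans_eq (card_bitString n)

lemma card_rel_le (g : PFun n) (j : Fin 2) : (rel g j).card ≤ 2 ^ n :=
  (card_rel g j).trans_le (card_supp_le g j)

lemma eq_of_rel_eq {g h : PFun n} (hr : ∀ j, rel g j = rel h j) : g = h := by
  funext ⟨j, y⟩
  ext x
  have := congrArg (fun R : Rel n => (x, y) ∈ R) (hr j)
  simpa [mem_rel] using this

lemma rel_update_self {g : PFun n} {j : Fin 2} {y : BitString n} (x : BitString n)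
    (h : g (j, y) = none) :
    rel (Function.update g (j, y) (some x)) j = insert (x, y) (rel g j) := by
  ext ⟨x', y'⟩
  simp only [mem_rel, Finset.mem_insert, Function.update_apply, Prod.mk.injEq, true_and]
  by_cases hy : y' = y
  · subst hy
    simp [h, eq_comm]
  · simp [hy]

lemma rel_update_ne {g : PFun n} {j j' : Fin 2} (hj : j' ≠ j) {y : BitString n}
    (u : Option (BitString n)) : rel (Function.update g (j, y) u) j' = rel g j' := by
  ext ⟨x', y'⟩
  simp [mem_rel, hj]

lemma rel_none (j : Fin 2) : rel (fun _ => none : PFun n) j = ∅ := by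
  ext; simp [mem_rel]

/-- The vector `|R₁⟩|R₂⟩` for the relations encoded by `g`. -/
def pairKet (g : PFun n) : RecIdx n × RecIdx n → ℂ :=
  fun e => relKet (rel g 0) e.1 * relKet (rel g 1) e.2

lemma sum_star_pairKet_mul (g h : PFun n) :
    ∑ e, star (pairKet g e) * pairKet h e = if g = h then 1 else 0 := by
  have h1 : ∑ e, star (pairKet g e) * pairKet h e =
      (∑ e, star (relKet (rel g 0) e) * relKet (rel h 0) e) *
        ∑ e, star (relKet (rel g 1) e) * relKet (rel h 1) e := by
    rw [Fintype.sum_mul_sum, Fintype.sum_prod_type]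
    refine Finset.sum_congr rfl fun a _ => Finset.sum_congr rfl fun b _ => ?_
    simp only [pairKet, star_mul']
    ring
  rw [h1, sum_star_relKet_mul _ _ (card_rel_le h 0), sum_star_relKet_mul _ _ (card_rel_le h 1)]
  by_cases hgh : g = h
  · simp [hgh]
  · rw [if_neg hgh]
    by_cases h0 : rel g 0 = rel h 0
    · have h2 : rel g 1 ≠ rel h 1 := fun h2 => hgh <| eq_of_rel_eq fun j => by
        fin_cases j
        · exact h0
        · exact h2
      simp [h2]
    · simp [h0]

/-- The isometry that writes a partial function as a pair of relation states. -/
def embed (c : (BitString n × BitString m) × PFun n → ℂ) :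
    (BitString n × BitString m) × (RecIdx n × RecIdx n) → ℂ :=
  fun p => ∑ g, c (p.1, g) * pairKet g p.2

lemma reducedState_embed (c : (BitString n × BitString m) × PFun n → ℂ) :
    reducedState (embed c) = reducedState c := by
  ext p q
  simp only [reducedState, Matrix.of_apply, embed, star_sum, star_mul', Finset.sum_mul_sum]
  rw [Finset.sum_comm]
  refine Finset.sum_congr rfl fun g _ => ?_
  rw [Finset.sum_comm]
  have h1 : ∀ h, ∑ e, c (p, g) * pairKet g e * (star (c (q, h)) * star (pairKet h e)) =
      c (p, g) * star (c (q, h)) * if h = g then 1 else 0 := by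
    intro h
    rw [← sum_star_pairKet_mul, Finset.mul_sum]
    exact Finset.sum_congr rfl fun e _ => by ring
  simp_rw [h1]
  simp

lemma applyLocal_embed
    (U : Matrix (BitString n × BitString m) (BitString n × BitString m) ℂ)
    (c : (BitString n × BitString m) × PFun n → ℂ) :
    applyLocal U (embed c) = embed (applyLocal U c) := by
  funext p
  simp only [applyLocal, embed, Finset.mul_sum, Finset.sum_mul]
  rw [Finset.sum_comm]
  simp only [mul_assoc]

/-- A path-recording step with weights `w`:
`|x⟩|g⟩ ↦ ∑_{y : g (j, y) = none} w g y |y⟩|g[(j, y) ↦ x]⟩`. -/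
def recStep (w : PFun n → BitString n → ℝ) (j : Fin 2)
    (ψ : (BitString n × BitString m) × PFun n → ℂ) :
    (BitString n × BitString m) × PFun n → ℂ :=
  fun p => (p.2 (j, p.1.1)).elim 0 fun x =>
    (w (Function.update p.2 (j, p.1.1) none) p.1.1 : ℂ) *
      ψ ((x, p.1.2), Function.update p.2 (j, p.1.1) none)

/-- The state of the recording registers before the first query. -/
def initRec (n m : ℕ) : (BitString n × BitString m) × PFun n → ℂ :=
  fun p => if p.1 = 0 then (if p.2 = fun _ => none then 1 else 0) else 0

/-- The view of an adversary for path-recording oracles with weights `w 0`, `w 1`. -/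
def Adversary.recView {t : ℕ} (𝒜 : Adversary n m t) (w : Fin 2 → PFun n → BitString n → ℝ) :
    (BitString n × BitString m) × PFun n → ℂ :=
  Fin.foldl t (fun ψ i => recStep (w (𝒜.query i)) (𝒜.query i) (applyLocal (𝒜.unitary i).1 ψ))
    (initRec n m)

lemma embed_initRec (n m : ℕ) : embed (initRec n m) =
    fun p => if p.1 = 0 then relKet (∅ : Rel n) p.2.1 * relKet ∅ p.2.2 else 0 := by
  funext p
  simp only [embed, initRec]
  split_ifs
  · rw [Finset.sum_eq_single (fun _ => none)]
    · simp [pairKet, rel_none]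
    · intro g _ hg
      simp [hg]
    · simp
  · simp

lemma record_eq {g : PFun n} {j : Fin 2} {y : BitString n} (x : BitString n)
    (h : g (j, y) = none) :
    record j x (rel g 0) (rel g 1) y =
      fun p => basisKet y p.1 * pairKet (Function.update g (j, y) (some x)) p.2 := by
  funext p
  unfold record
  fin_cases j
  · have h1 := rel_update_self x h
    have h2 := rel_update_ne (g := g) (j := 0) (j' := 1) (by simp) (y := y) (some x)
    simp only [Fin.zero_eta] at h1 h2 ⊢
    simp [ket, pairKet, h1, h2, mul_assoc]
  · have h1 := rel_update_self x h
    have h2 := rel_update_ne (g := g) (j := 1) (j' := 0) (by simp) (y := y) (some x)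
    simp only [Fin.mk_one] at h1 h2 ⊢
    simp [ket, pairKet, h1, h2, mul_assoc]

/-- It suffices to know the oracle on relation states: `embed c` lies in their span, so the
extension by zero to the complement never matters. -/
lemma applyOracle_embed {w : PFun n → BitString n → ℝ} {j : Fin 2}
    {O : Matrix (BitString n × (RecIdx n × RecIdx n)) (BitString n × (RecIdx n × RecIdx n)) ℂ}
    (hO : ∀ x g, O *ᵥ ket x (rel g 0) (rel g 1) =
      ∑ y, if g (j, y) = none then (w g y : ℂ) • record j x (rel g 0) (rel g 1) y else 0)
    (c : (BitString n × BitString m) × PFun n → ℂ) :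
    applyOracle O (embed c) = embed (recStep w j c) := by
  funext ⟨⟨y₀, b⟩, e⟩
  have h1 : applyOracle O (embed c) ((y₀, b), e) =
      ∑ g, ∑ x, c ((x, b), g) * (O *ᵥ ket x (rel g 0) (rel g 1)) (y₀, e) := by
    simp only [applyOracle, embed, Finset.mul_sum, Matrix.mulVec, dotProduct]
    rw [Finset.sum_comm]
    refine Finset.sum_congr rfl fun g _ => ?_
    rw [Finset.sum_comm]
    refine Finset.sum_congr rfl fun q _ => ?_
    rw [Finset.sum_eq_single q.1]
    · simp [ket, basisKet, pairKet]
      ring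
    · intro x _ hx
      simp [ket, basisKet, hx.symm]
    · simp
  have h2 : ∀ x g, (O *ᵥ ket x (rel g 0) (rel g 1)) (y₀, e) =
      if g (j, y₀) = none then
        (w g y₀ : ℂ) * pairKet (Function.update g (j, y₀) (some x)) e else 0 := by
    intro x g
    rw [hO, Finset.sum_apply, Finset.sum_eq_single y₀]
    · split_ifs with h
      · rw [record_eq x h]
        simp [basisKet]
      · simp
    · intro y _ hy
      split_ifs with h
      · rw [record_eq x h]
        simp [basisKet, Pi.single_apply, hy.symm]
      · simp
    · simp
  rw [h1]
  simp_rw [h2]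
  unfold embed
  conv_rhs => rw [sum_eq_sum_update (j, y₀) none]
  refine Finset.sum_congr rfl fun g _ => ?_
  split_ifs with h
  · rw [Fintype.sum_option]
    have h3 : Function.update g (j, y₀) none = g := by rw [← h, Function.update_eq_self]
    simp only [recStep, Function.update_self, Option.elim, zero_mul, zero_add,
      Function.update_idem, h3]
    refine Finset.sum_congr rfl fun x _ => ?_
    ring
  · simp

/-- The bridge to partial functions: `embed` intertwines every step of the two views and, being
isometric on the recording register, preserves the reduced state. -/
lemma recState_eq {t : ℕ} (𝒜 : Adversary n m t) {w : Fin 2 → PFun n → BitString n → ℝ}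
    {O : Fin 2 →
      Matrix (BitString n × (RecIdx n × RecIdx n)) (BitString n × (RecIdx n × RecIdx n)) ℂ}
    (hO : ∀ j x g, O j *ᵥ ket x (rel g 0) (rel g 1) =
      ∑ y, if g (j, y) = none then (w j g y : ℂ) • record j x (rel g 0) (rel g 1) y else 0) :
    𝒜.recState O = reducedState (𝒜.recView w) := by
  rw [← reducedState_embed]
  unfold Adversary.recState Adversary.view Adversary.recView
  congr 1
  refine foldl_rel (fun _ a b => a = embed b) t _ _ _ _ ?_ ?_
  · rw [embed_initRec]
  · rintro i a b rfl
    rw [applyLocal_embed, applyOracle_embed (hO _)]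

end

section
variable {n : ℕ}

/-! ### The oracles on relation states -/

lemma star_basisKet_mul (x x' : BitString n) :
    ∑ a, star (basisKet x a) * basisKet x' a = if x = x' then 1 else 0 := by
  rw [Finset.sum_eq_single x']
  · by_cases h : x = x'
    · subst h; simp [basisKet]
    · simp [basisKet, h, eq_comm]
  · intro a _ ha
    simp [basisKet, ha]
  · simp

lemma star_single_dotProduct (x x' : BitString n) (R R' : Rel n) (hR : R'.card ≤ 2 ^ n) :
    (star fun p : BitString n × RecIdx n => basisKet x p.1 * relKet R p.2) ⬝ᵥ
      (fun p => basisKet x' p.1 * relKet R' p.2) = if x = x' ∧ R = R' then 1 else 0 := by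
  have h1 : (star fun p : BitString n × RecIdx n => basisKet x p.1 * relKet R p.2) ⬝ᵥ
      (fun p => basisKet x' p.1 * relKet R' p.2) =
      (∑ a, star (basisKet x a) * basisKet x' a) * ∑ e, star (relKet R e) * relKet R' e := by
    rw [Fintype.sum_mul_sum, dotProduct, Fintype.sum_prod_type]
    refine Finset.sum_congr rfl fun a _ => Finset.sum_congr rfl fun b _ => ?_
    simp only [Pi.star_apply, star_mul']
    ring
  rw [h1, star_basisKet_mul, sum_star_relKet_mul _ _ hR, ite_and]
  split_ifs <;> simp

lemma star_ket_dotProduct (x x' : BitString n) (R₁ R₂ R₁' R₂' : Rel n) (h₁ : R₁'.card ≤ 2 ^ n)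
    (h₂ : R₂'.card ≤ 2 ^ n) :
    star (ket x R₁ R₂) ⬝ᵥ ket x' R₁' R₂' = if x = x' ∧ R₁ = R₁' ∧ R₂ = R₂' then 1 else 0 := by
  have h3 : star (ket x R₁ R₂) ⬝ᵥ ket x' R₁' R₂' =
      (∑ a, star (basisKet x a) * basisKet x' a) *
        ((∑ e, star (relKet R₁ e) * relKet R₁' e) * ∑ e, star (relKet R₂ e) * relKet R₂' e) := by
    rw [Fintype.sum_mul_sum, ← Fintype.sum_prod_type', Fintype.sum_mul_sum, dotProduct,
      Fintype.sum_prod_type]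
    refine Finset.sum_congr rfl fun a _ => Finset.sum_congr rfl fun b _ => ?_
    simp only [Pi.star_apply, star_mul', ket]
    ring
  rw [h3, star_basisKet_mul, sum_star_relKet_mul _ _ h₁, sum_star_relKet_mul _ _ h₂, ite_and,
    ite_and]
  split_ifs <;> simp

lemma pr_mulVec (x : BitString n) (R : Rel n) (hi : IsInj R) (hR : R.card ≤ 2 ^ n) :
    pr n *ᵥ (fun p => basisKet x p.1 * relKet R p.2) =
      if R.card < 2 ^ n then (((Real.sqrt ((2 : ℝ) ^ n - R.card) : ℝ) : ℂ)⁻¹ •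
        ∑ y ∈ Finset.univ \ im R,
          fun p : BitString n × RecIdx n => basisKet y p.1 * relKet (insert (x, y) R) p.2)
      else 0 := by
  classical
  unfold pr
  simp only [Matrix.sum_mulVec, Matrix.vecMulVec_mulVec]
  simp_rw [star_single_dotProduct _ _ _ _ hR]
  rw [Finset.sum_eq_single x]
  · split_ifs with h
    · rw [Finset.sum_eq_single R]
      · simp
      · intro R' _ hR'
        simp [hR']
      · intro hR'
        exact absurd (Finset.mem_filter.2 ⟨Finset.mem_univ _, hi, h⟩) hR'
    · refine Finset.sum_eq_zero fun R' hR' => ?_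
      have : R' ≠ R := by
        rintro rfl
        exact h (Finset.mem_filter.1 hR').2.2
      simp [this]
  · intro x' _ hx'
    simp [hx']
  · simp

lemma prOracle_mulVec_zero (x : BitString n) (R₁ R₂ : Rel n) :
    prOracle n 0 *ᵥ ket x R₁ R₂ = fun p =>
      (pr n *ᵥ fun p => basisKet x p.1 * relKet R₁ p.2) (p.1, p.2.1) * relKet R₂ p.2.2 := by
  funext ⟨y, e₁, e₂⟩
  simp only [Matrix.mulVec, dotProduct, prOracle, Matrix.of_apply, if_pos, ket,
    Fintype.sum_prod_type, Finset.sum_mul]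
  refine Finset.sum_congr rfl fun a _ => Finset.sum_congr rfl fun b _ => ?_
  rw [Finset.sum_eq_single e₂]
  · simp [mul_assoc]
  · intro e _ he
    simp [he.symm]
  · simp

lemma prOracle_mulVec_one (x : BitString n) (R₁ R₂ : Rel n) :
    prOracle n 1 *ᵥ ket x R₁ R₂ = fun p =>
      (pr n *ᵥ fun p => basisKet x p.1 * relKet R₂ p.2) (p.1, p.2.2) * relKet R₁ p.2.1 := by
  funext ⟨y, e₁, e₂⟩
  simp only [Matrix.mulVec, dotProduct, prOracle, Matrix.of_apply, one_ne_zero, if_false, ket,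
    Fintype.sum_prod_type, Finset.sum_mul]
  refine Finset.sum_congr rfl fun a _ => ?_
  rw [Finset.sum_eq_single e₁]
  · refine Finset.sum_congr rfl fun b _ => ?_
    simp
    ring
  · intro e _ he
    simp [he.symm]
  · simp

/-- The weights of the independent path-recording oracles. -/
def prWeight (n : ℕ) (j : Fin 2) (g : PFun n) (_ : BitString n) : ℝ :=
  (Real.sqrt ((2 : ℝ) ^ n - (supp g j).card))⁻¹

lemma card_supp_lt {g : PFun n} {j : Fin 2} {y : BitString n} (h : g (j, y) = none) :
    (supp g j).card < 2 ^ n := by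
  rw [← card_bitString n]
  refine Finset.card_lt_univ_of_notMem (x := y) ?_
  simp [mem_supp, h]

lemma prOracle_mulVec (j : Fin 2) (x : BitString n) (g : PFun n) :
    prOracle n j *ᵥ ket x (rel g 0) (rel g 1) =
      ∑ y, if g (j, y) = none then
        (prWeight n j g y : ℂ) • record j x (rel g 0) (rel g 1) y else 0 := by
  have key : ∀ p : BitString n × RecIdx n,
      (pr n *ᵥ fun p => basisKet x p.1 * relKet (rel g j) p.2) p =
      ∑ y, if g (j, y) = none then
        (prWeight n j g y : ℂ) * (basisKet y p.1 * relKet (insert (x, y) (rel g j)) p.2) else 0 := by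
    intro p
    rw [pr_mulVec x _ (isInj_rel g j) (card_rel_le g j)]
    split_ifs with h
    · rw [im_rel, card_rel, ← Finset.sum_filter]
      have h1 : (Finset.univ \ supp g j) = Finset.univ.filter fun y => g (j, y) = none := by
        ext y; simp [mem_supp]
      simp only [h1, Pi.smul_apply, Finset.sum_apply, smul_eq_mul, Finset.mul_sum, prWeight,
        Complex.ofReal_inv]
    -- With N pairs recorded no output is free, so the right-hand sum vanishes too.
    · symm
      refine Finset.sum_eq_zero fun y _ => if_neg fun hy => h ?_
      rw [card_rel]
      exact card_supp_lt hy
  funext p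
  rw [Finset.sum_apply]
  fin_cases j
  · simp only [Fin.zero_eta] at key ⊢
    rw [prOracle_mulVec_zero]
    simp only [key, Finset.sum_mul]
    refine Finset.sum_congr rfl fun y _ => ?_
    split_ifs
    · simp [record, ket]
      ring
    · simp
  · simp only [Fin.mk_one] at key ⊢
    rw [prOracle_mulVec_one]
    simp only [key, Finset.sum_mul]
    refine Finset.sum_congr rfl fun y _ => ?_
    split_ifs
    · simp [record, ket]
      ring
    · simp

/-- The pairs of relations on which the collision-free path-recording oracles are defined. -/
def Good (ℓ lam : ℕ) (g : PFun n) : Prop :=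
  IsCFRel ℓ lam (rel g 0) ∧ IsCFRel ℓ lam (rel g 1) ∧ IsCFRel ℓ lam (rel g 0 ∪ rel g 1) ∧
    Disjoint (rel g 0) (rel g 1) ∧ (rel g 0 ∪ rel g 1).card < 2 ^ n

/-- The image of the union of both relations. -/
def suppU (g : PFun n) : Finset (BitString n) := supp g 0 ∪ supp g 1

lemma im_union_rel (g : PFun n) : im (rel g 0 ∪ rel g 1) = suppU g := by
  rw [im, Finset.image_union, suppU, ← im_rel, ← im_rel]
  rfl

lemma notMem_suppU {g : PFun n} {y : BitString n} (hy : y ∉ suppU g) (j : Fin 2) :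
    g (j, y) = none := by
  simp only [suppU, Finset.mem_union, not_or, mem_supp, not_not] at hy
  fin_cases j
  · exact hy.1
  · exact hy.2

open Classical in
/-- The weights of the collision-free path-recording oracles. -/
def cfWeight (n ℓ lam : ℕ) (_ : Fin 2) (g : PFun n) (y : BitString n) : ℝ :=
  if Good ℓ lam g ∧ y ∈ CF ℓ lam (suppU g) then
    (Real.sqrt (CF ℓ lam (suppU g)).card)⁻¹ else 0

lemma cfprOracle_mulVec (ℓ lam : ℕ) (j : Fin 2) (x : BitString n) (g : PFun n) :
    cfprOracle n ℓ lam j *ᵥ ket x (rel g 0) (rel g 1) =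
      ∑ y, if g (j, y) = none then
        (cfWeight n ℓ lam j g y : ℂ) • record j x (rel g 0) (rel g 1) y else 0 := by
  classical
  unfold cfprOracle
  simp only [Matrix.sum_mulVec, Matrix.vecMulVec_mulVec]
  simp_rw [star_ket_dotProduct _ _ _ _ _ _ (card_rel_le g 0) (card_rel_le g 1)]
  rw [Finset.sum_eq_single x]
  · by_cases hg : Good ℓ lam g
    · rw [Finset.sum_eq_single (rel g 0, rel g 1)]
      · simp only [im_union_rel, and_self, if_true, MulOpposite.op_one, one_smul]
        rw [Finset.smul_sum, ← Finset.sum_subset (Finset.subset_univ (CF ℓ lam (suppU g)))]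
        · refine Finset.sum_congr rfl fun y hy => ?_
          have h1 : y ∉ suppU g := (Finset.mem_filter.1 hy).2.1
          rw [if_pos (notMem_suppU h1 j), cfWeight, if_pos ⟨hg, hy⟩, Complex.ofReal_inv]
        · intro y _ hy
          simp [cfWeight, hy]
      · rintro ⟨R₁, R₂⟩ _ hR
        have : ¬(R₁ = rel g 0 ∧ R₂ = rel g 1) := fun h => hR (Prod.ext h.1 h.2)
        simp [this]
      · intro h
        rw [Finset.mem_filter] at h
        unfold Good at hg
        exact absurd ⟨Finset.mem_univ _, hg⟩ h
    · rw [Finset.sum_eq_zero]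
      · symm
        refine Finset.sum_eq_zero fun y _ => ?_
        simp [cfWeight, hg]
      · rintro ⟨R₁, R₂⟩ hR
        have : ¬(R₁ = rel g 0 ∧ R₂ = rel g 1) := by
          rintro ⟨rfl, rfl⟩
          rw [Finset.mem_filter] at hR
          unfold Good at hg
          exact hg hR.2
        simp [this]
  · intro x' _ hx'
    simp [hx']
  · simp

lemma takeBits_injective (n : ℕ) :
    Function.Injective (takeBits n : BitString n → _) := by
  intro x y h
  funext i
  exact congrFun h ⟨i, i.2⟩

/-- Only singletons are compared, and the full prefix determines the string. -/
lemma strongCF_one_self (S : Finset (BitString n)) : StrongCF 1 n S := by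
  intro i hi S₁ _ S₂ _ h₁ h₂
  refine ⟨fun h => ?_, fun h => by rw [h]⟩
  interval_cases i
  · rw [Finset.card_eq_zero] at h₁ h₂
    rw [h₁, h₂]
  · obtain ⟨x, rfl⟩ := Finset.card_eq_one.1 h₁
    obtain ⟨y, rfl⟩ := Finset.card_eq_one.1 h₂
    simp only [Finset.sum_singleton] at h
    rw [takeBits_injective n h]

lemma sharedPrOracle_eq (n : ℕ) (j : Fin 2) : sharedPrOracle n j = cfprOracle n 1 n j := by
  classical
  have h1 : ∀ R : Rel n, IsCFRel 1 n R ↔ IsInj R := fun R =>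
    ⟨fun h => h.1, fun h => ⟨h, strongCF_one_self _⟩⟩
  have h2 : ∀ S : Finset (BitString n), CF 1 n S = Finset.univ \ S := by
    intro S
    ext y
    simp [CF, strongCF_one_self]
  unfold sharedPrOracle cfprOracle
  simp only [h1, h2]
  refine Finset.sum_congr rfl fun x _ => Finset.sum_congr rfl fun R _ => ?_
  rw [Finset.card_sdiff_of_subset (Finset.subset_univ _), Finset.card_univ, card_bitString,
    Nat.cast_sub ((Finset.card_le_univ _).trans_eq (card_bitString n))]
  push_cast
  rfl

end

section
variable {n m : ℕ}

/-! ### Path-recording steps -/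

/-- No interference occurs: the output y and the updated function determine x and the former
function, so distinct branches land on distinct basis vectors. -/
lemma l2_sq_recStep (w : PFun n → BitString n → ℝ) (j : Fin 2)
    (ψ : (BitString n × BitString m) × PFun n → ℂ) :
    l2 (recStep w j ψ) ^ 2 =
      ∑ p, ‖ψ p‖ ^ 2 * ∑ y, if p.2 (j, y) = none then w p.2 y ^ 2 else 0 := by
  rw [l2_sq]
  simp only [Fintype.sum_prod_type (α₁ := BitString n × BitString m),
    Fintype.sum_prod_type (α₁ := BitString n) (α₂ := BitString m)]
  have h1 : ∀ y b, ∑ g : PFun n, ‖recStep w j ψ ((y, b), g)‖ ^ 2 =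
      ∑ g : PFun n, ∑ x, ‖ψ ((x, b), g)‖ ^ 2 * if g (j, y) = none then w g y ^ 2 else 0 := by
    intro y b
    rw [sum_eq_sum_update (j, y) none]
    refine Finset.sum_congr rfl fun g _ => ?_
    split_ifs with h
    · rw [Fintype.sum_option]
      have h3 : Function.update g (j, y) none = g := by rw [← h, Function.update_eq_self]
      simp only [recStep, Function.update_self, Option.elim, norm_zero, Function.update_idem, h3]
      rw [zero_pow two_ne_zero, zero_add]
      refine Finset.sum_congr rfl fun x _ => ?_
      rw [norm_mul, mul_pow, Complex.norm_real, Real.norm_eq_abs, sq_abs, mul_comm]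
    · simp
  simp_rw [h1, Finset.mul_sum]
  rw [Finset.sum_comm, Finset.sum_comm (γ := BitString n)]
  refine Finset.sum_congr rfl fun b _ => ?_
  rw [Finset.sum_comm, Finset.sum_comm (γ := BitString n)]
  refine Finset.sum_congr rfl fun g _ => ?_
  rw [Finset.sum_comm]

lemma recStep_sub (w : PFun n → BitString n → ℝ) (j : Fin 2)
    (ψ χ : (BitString n × BitString m) × PFun n → ℂ) :
    recStep w j (ψ - χ) = recStep w j ψ - recStep w j χ := by
  funext p
  simp only [recStep, Pi.sub_apply]
  cases p.2 (j, p.1.1) <;> simp [mul_sub]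

lemma recStep_sub_left (w w' : PFun n → BitString n → ℝ) (j : Fin 2)
    (ψ : (BitString n × BitString m) × PFun n → ℂ) :
    recStep (w - w') j ψ = recStep w j ψ - recStep w' j ψ := by
  funext p
  simp only [recStep, Pi.sub_apply]
  cases p.2 (j, p.1.1) <;> simp [sub_mul]

/-- The weights need to be controlled only on the support of ψ; this is where invariants of the
reachable states enter. -/
lemma l2_recStep_le {w : PFun n → BitString n → ℝ} {j : Fin 2}
    {ψ : (BitString n × BitString m) × PFun n → ℂ} {c : ℝ} (hc : 0 ≤ c)
    (h : ∀ p, ψ p ≠ 0 → (∑ y, if p.2 (j, y) = none then w p.2 y ^ 2 else 0) ≤ c ^ 2) :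
    l2 (recStep w j ψ) ≤ c * l2 ψ := by
  refine le_of_sq_le_sq ?_ (mul_nonneg hc (l2_nonneg _))
  rw [l2_sq_recStep, mul_pow, l2_sq, Finset.mul_sum]
  refine Finset.sum_le_sum fun p _ => ?_
  by_cases hp : ψ p = 0
  · simp [hp]
  · rw [mul_comm]
    exact mul_le_mul_of_nonneg_right (h p hp) (by positivity)

lemma exists_of_recStep_ne_zero {w : PFun n → BitString n → ℝ} {j : Fin 2}
    {ψ : (BitString n × BitString m) × PFun n → ℂ} {p : (BitString n × BitString m) × PFun n}
    (h : recStep w j ψ p ≠ 0) :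
    ∃ (g : PFun n) (x y : BitString n), g (j, y) = none ∧
      p.2 = Function.update g (j, y) (some x) ∧ w g y ≠ 0 ∧ ∃ q, ψ (q, g) ≠ 0 := by
  unfold recStep at h
  rcases hx : p.2 (j, p.1.1) with _ | x
  · simp [hx] at h
  · rw [hx, Option.elim] at h
    refine ⟨Function.update p.2 (j, p.1.1) none, x, p.1.1, by simp, ?_, ?_, _, right_ne_zero_of_mul h⟩
    · rw [Function.update_idem, ← hx, Function.update_eq_self]
    · exact_mod_cast left_ne_zero_of_mul h

lemma applyLocal_support {E : Type} {Q : E → Prop}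
    (U : Matrix (BitString n × BitString m) (BitString n × BitString m) ℂ)
    {ψ : (BitString n × BitString m) × E → ℂ} (h : ∀ p, ψ p ≠ 0 → Q p.2)
    (p : (BitString n × BitString m) × E) (hp : applyLocal U ψ p ≠ 0) : Q p.2 := by
  obtain ⟨q, _, hq⟩ := Finset.exists_ne_zero_of_sum_ne_zero hp
  exact h (q, p.2) (right_ne_zero_of_mul hq)

lemma l2_initRec : l2 (initRec n m) = 1 := by
  rw [← sq_eq_sq₀ (l2_nonneg _) zero_le_one, l2_sq, Finset.sum_eq_single (0, fun _ => none)]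
  · simp [initRec]
  · rintro ⟨p, g⟩ _ h
    have : ¬(p = 0 ∧ g = fun _ => none) := fun h' => h (by rw [h'.1, h'.2])
    rw [not_and] at this
    by_cases hp : p = 0
    · simp [initRec, this hp]
    · simp [initRec, hp]
  · simp

lemma card_filter_none (g : PFun n) (j : Fin 2) :
    ((Finset.univ.filter fun y => g (j, y) = none).card : ℝ) = 2 ^ n - (supp g j).card := by
  have h := Finset.card_filter_add_card_filter_not (s := (Finset.univ : Finset (BitString n)))
    (fun y => g (j, y) = none)
  rw [Finset.card_univ, card_bitString] at h
  have h' : (2 : ℝ) ^ n = ((2 ^ n : ℕ) : ℝ) := by push_cast; rfl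
  rw [h', ← h]
  simp [supp]

lemma sum_prWeight_sq {g : PFun n} {j : Fin 2} (hg : (supp g j).card < 2 ^ n) :
    (∑ y, if g (j, y) = none then prWeight n j g y ^ 2 else 0) = 1 := by
  rw [← Finset.sum_filter]
  simp only [prWeight]
  have : (0 : ℝ) < 2 ^ n - (supp g j).card := by
    rw [sub_pos]; exact_mod_cast hg
  rw [Finset.sum_const, nsmul_eq_mul, card_filter_none, inv_pow, Real.sq_sqrt this.le]
  exact mul_inv_cancel₀ this.ne'

lemma sum_prWeight_sq_le (g : PFun n) (j : Fin 2) :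
    (∑ y, if g (j, y) = none then prWeight n j g y ^ 2 else 0) ≤ 1 := by
  by_cases hg : (supp g j).card < 2 ^ n
  · exact (sum_prWeight_sq hg).le
  · rw [Finset.sum_eq_zero fun y _ => if_neg fun h => hg (card_supp_lt h)]
    exact zero_le_one

/-- Only a contraction: the sum is 0 when `g` is not good or no collision-free output remains. -/
lemma sum_cfWeight_sq_le (ℓ lam : ℕ) (g : PFun n) (j : Fin 2) :
    (∑ y, if g (j, y) = none then cfWeight n ℓ lam j g y ^ 2 else 0) ≤ 1 := by
  have h1 : (∑ y, if g (j, y) = none then cfWeight n ℓ lam j g y ^ 2 else 0) ≤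
      ∑ y, if y ∈ CF ℓ lam (suppU g) then ((CF ℓ lam (suppU g)).card : ℝ)⁻¹ else 0 := by
    refine Finset.sum_le_sum fun y _ => ?_
    by_cases hy : y ∈ CF ℓ lam (suppU g)
    · rw [if_pos hy]
      unfold cfWeight
      split_ifs
      · rw [inv_pow, Real.sq_sqrt (Nat.cast_nonneg _)]
      · rw [zero_pow two_ne_zero]; positivity
      · positivity
    · simp [cfWeight, hy]
  refine h1.trans ?_
  rw [Finset.sum_ite_mem, Finset.univ_inter, Finset.sum_const, nsmul_eq_mul]
  exact mul_inv_le_one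

/-! ### Counting outputs that create a collision -/

/-- A string with prescribed prefix is determined by its remaining n - λ bits. -/
lemma card_takeBits_fiber_le (lam : ℕ) (hl : lam ≤ n) (v : {j : Fin n // (j : ℕ) < lam} → ZMod 2) :
    (Finset.univ.filter fun y : BitString n => takeBits lam y = v).card ≤ 2 ^ (n - lam) := by
  have h1 : Fintype.card ({j : Fin n // ¬(j : ℕ) < lam} → ZMod 2) = 2 ^ (n - lam) := by
    rw [Fintype.card_fun, ZMod.card, Fintype.card_subtype_compl, Fintype.card_fin]
    congr 2
    rw [Fintype.card_subtype]
    rw [show (Finset.univ.filter fun j : Fin n => (j : ℕ) < lam) =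
      Finset.univ.map (Fin.castLEEmb hl) from ?_]
    · simp
    · ext j
      simp only [Finset.mem_filter, Finset.mem_univ, true_and, Finset.mem_map]
      exact ⟨fun h => ⟨⟨j, h⟩, rfl⟩, by rintro ⟨i, rfl⟩; exact i.2⟩
  rw [← h1, ← Finset.card_univ]
  refine Finset.card_le_card_of_injOn
    (fun (y : BitString n) (j : {j : Fin n // ¬(j : ℕ) < lam}) => y j) (by simp) ?_
  intro y hy y' hy' h
  simp only [Finset.coe_filter, Finset.mem_univ, true_and, Set.mem_ofPred_eq] at hy hy'
  funext j
  by_cases hj : (j : ℕ) < lam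
  · exact congrFun (hy.trans hy'.symm) ⟨j, hj⟩
  · exact congrFun h ⟨j, hj⟩

lemma StrongCF.subset {ℓ lam : ℕ} {S T : Finset (BitString n)} (h : StrongCF ℓ lam T)
    (hST : S ⊆ T) : StrongCF ℓ lam S :=
  fun i hi S₁ h₁ S₂ h₂ => h i hi S₁ (h₁.trans hST) S₂ (h₂.trans hST)

lemma strongCF_empty (ℓ lam : ℕ) : StrongCF ℓ lam (∅ : Finset (BitString n)) := by
  intro i _ S₁ h₁ S₂ h₂ _ _
  rw [Finset.subset_empty.1 h₁, Finset.subset_empty.1 h₂]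
  simp

/-- In a new collision exactly one side contains y: if both or neither did, cancelling y would leave
a collision inside S. Solving the equation for the prefix of y gives the formula, with A the side of
y after removal of y. -/
lemma exists_of_not_strongCF_insert {ℓ lam : ℕ} {S : Finset (BitString n)} {y : BitString n}
    (hS : StrongCF ℓ lam S) (hy : ¬StrongCF ℓ lam (insert y S)) :
    ∃ s < ℓ, ∃ A ∈ S.powersetCard s, ∃ B ∈ S.powersetCard (s + 1),
      takeBits lam y = ∑ x ∈ B, takeBits lam x - ∑ x ∈ A, takeBits lam x := by
  have aux : ∀ i ≤ ℓ, ∀ S₁ ⊆ insert y S, ∀ S₂ ⊆ insert y S, S₁.card = i → S₂.card = i →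
      ∑ x ∈ S₁, takeBits lam x = ∑ x ∈ S₂, takeBits lam x → y ∈ S₁ → y ∉ S₂ →
      ∃ s < ℓ, ∃ A ∈ S.powersetCard s, ∃ B ∈ S.powersetCard (s + 1),
        takeBits lam y = ∑ x ∈ B, takeBits lam x - ∑ x ∈ A, takeBits lam x := by
    intro i hi S₁ h₁ S₂ h₂ c₁ c₂ hs hy₁ hy₂
    have hpos : 0 < S₁.card := Finset.card_pos.2 ⟨y, hy₁⟩
    have hc := Finset.card_erase_of_mem hy₁
    refine ⟨i - 1, by omega, S₁.erase y, ?_, S₂, ?_, ?_⟩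
    · rw [Finset.mem_powersetCard]
      exact ⟨Finset.subset_insert_iff.1 h₁, by omega⟩
    · rw [Finset.mem_powersetCard]
      exact ⟨(Finset.subset_insert_iff_of_notMem hy₂).1 h₂, by omega⟩
    · rw [← hs, ← Finset.add_sum_erase _ _ hy₁, add_sub_cancel_right]
  unfold StrongCF at hy
  push Not at hy
  obtain ⟨i, hi, S₁, h₁, S₂, h₂, c₁, c₂, hne⟩ := hy
  have hs : ∑ x ∈ S₁, takeBits lam x = ∑ x ∈ S₂, takeBits lam x ∧ S₁ ≠ S₂ := by
    rcases hne with h | h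
    · exact h
    · exact absurd (by rw [h.2]) h.1
  by_cases hy₁ : y ∈ S₁
  · by_cases hy₂ : y ∈ S₂
    · exfalso
      have e₁ := Finset.add_sum_erase S₁ (takeBits lam) hy₁
      have e₂ := Finset.add_sum_erase S₂ (takeBits lam) hy₂
      have d₁ := Finset.card_erase_of_mem hy₁
      have d₂ := Finset.card_erase_of_mem hy₂
      have := (hS (i - 1) (by omega) (S₁.erase y) (Finset.subset_insert_iff.1 h₁) (S₂.erase y)
        (Finset.subset_insert_iff.1 h₂) (by omega) (by omega)).1
        (add_left_cancel (e₁.trans (hs.1.trans e₂.symm)))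
      apply hs.2
      rw [← Finset.insert_erase hy₁, ← Finset.insert_erase hy₂, this]
    · exact aux i hi S₁ h₁ S₂ h₂ c₁ c₂ hs.1 hy₁ hy₂
  · by_cases hy₂ : y ∈ S₂
    · exact aux i hi S₂ h₂ S₁ h₁ c₂ c₁ hs.1.symm hy₂ hy₁
    · exact absurd ((hS i hi S₁ ((Finset.subset_insert_iff_of_notMem hy₁).1 h₁) S₂
        ((Finset.subset_insert_iff_of_notMem hy₂).1 h₂) c₁ c₂).1 hs.1) hs.2

open Classical in
-- Union bound over the possible (s, A, B): ℓ values of s, at most |S|^(2s+1) pairs, and 2^(n-λ)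
-- strings for each prescribed prefix.
lemma card_not_strongCF_insert_le {ℓ lam : ℕ} (hl : lam ≤ n) {S : Finset (BitString n)}
    (hS : StrongCF ℓ lam S) :
    (Finset.univ.filter fun y => ¬StrongCF ℓ lam (insert y S)).card ≤
      ℓ * S.card ^ (2 * ℓ - 1) * 2 ^ (n - lam) := by
  have h1 : (Finset.univ.filter fun y => ¬StrongCF ℓ lam (insert y S)) ⊆
      (Finset.range ℓ).biUnion fun s =>
        (S.powersetCard s ×ˢ S.powersetCard (s + 1)).biUnion fun q =>
          Finset.univ.filter fun y : BitString n =>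
            takeBits lam y = ∑ x ∈ q.2, takeBits lam x - ∑ x ∈ q.1, takeBits lam x := by
    intro y hy
    obtain ⟨s, hs, A, hA, B, hB, h⟩ :=
      exists_of_not_strongCF_insert hS (Finset.mem_filter.1 hy).2
    refine Finset.mem_biUnion.2 ⟨s, Finset.mem_range.2 hs, Finset.mem_biUnion.2
      ⟨(A, B), Finset.mem_product.2 ⟨hA, hB⟩, ?_⟩⟩
    simpa using h
  refine (Finset.card_le_card h1).trans ?_
  refine (Finset.card_biUnion_le_card_mul _ _ (S.card ^ (2 * ℓ - 1) * 2 ^ (n - lam)) ?_).trans ?_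
  · intro s hs
    rw [Finset.mem_range] at hs
    refine (Finset.card_biUnion_le_card_mul _ _ (2 ^ (n - lam)) fun q _ =>
      card_takeBits_fiber_le lam hl _).trans ?_
    refine Nat.mul_le_mul_right _ ?_
    rw [Finset.card_product, Finset.card_powersetCard, Finset.card_powersetCard]
    -- An empty S is separate because powers of 0 are not monotone in the exponent; there no B of
    -- size s + 1 exists.
    rcases Nat.eq_zero_or_pos S.card with h0 | h0
    · simp [h0]
    · calc S.card.choose s * S.card.choose (s + 1) ≤ S.card ^ s * S.card ^ (s + 1) :=
            Nat.mul_le_mul (Nat.choose_le_pow _ _) (Nat.choose_le_pow _ _)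
        _ = S.card ^ (2 * s + 1) := by rw [← pow_add]; congr 1; ring
        _ ≤ S.card ^ (2 * ℓ - 1) := Nat.pow_le_pow_right h0 (by omega)
  · rw [Finset.card_range, mul_assoc]

/-- Disjoint images, which is stronger than disjoint relations, are what make the union injective.
-/
lemma good_of {ℓ lam : ℕ} {g : PFun n} (hc : StrongCF ℓ lam (suppU g))
    (hd : Disjoint (supp g 0) (supp g 1)) (hn : (suppU g).card < 2 ^ n) : Good ℓ lam g := by
  have h0 : supp g 0 ⊆ suppU g := Finset.subset_union_left
  have h1 : supp g 1 ⊆ suppU g := Finset.subset_union_right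
  have hy : ∀ {j : Fin 2} {q}, q ∈ rel g j → q.2 ∈ supp g j := by
    intro j q hq
    rw [mem_rel] at hq
    rw [mem_supp, hq]
    simp
  have hinj : IsInj (rel g 0 ∪ rel g 1) := by
    intro a ha b hb hab
    rw [Finset.mem_coe, Finset.mem_union] at ha hb
    rcases ha with ha | ha <;> rcases hb with hb | hb
    · exact isInj_rel g 0 ha hb hab
    · exact absurd (hab ▸ hy ha) (Finset.disjoint_right.1 hd (hy hb))
    · exact absurd (hab ▸ hy ha) (Finset.disjoint_left.1 hd (hy hb))
    · exact isInj_rel g 1 ha hb hab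
  refine ⟨⟨isInj_rel g 0, ?_⟩, ⟨isInj_rel g 1, ?_⟩, ⟨hinj, ?_⟩, ?_, ?_⟩
  · rw [im_rel]; exact hc.subset h0
  · rw [im_rel]; exact hc.subset h1
  · rw [im_union_rel]; exact hc
  · rw [Finset.disjoint_left]
    exact fun q hq hq' => Finset.disjoint_left.1 hd (hy hq) (hy hq')
  · rwa [← Finset.card_image_of_injOn hinj, ← im, im_union_rel]

end

/-! ### Collision-free against independent path recording -/

/-- For nonempty Y the sum is 2 - 2√(|Y|/|F|), and √r ≥ r on [0, 1]. For empty Y it equals 1, as the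
inverse of √0 is 0 by convention. -/
lemma sum_uniform_sub_sq_le {α : Type*} [DecidableEq α] {F Y : Finset α} (hY : Y ⊆ F)
    (hF : 0 < F.card) :
    ∑ y ∈ F, ((if y ∈ Y then (Real.sqrt Y.card)⁻¹ else 0) - (Real.sqrt F.card)⁻¹) ^ 2 ≤
      2 * ((F.card : ℝ) - Y.card) / F.card := by
  set a := (Real.sqrt F.card)⁻¹ with ha
  set b := (Real.sqrt Y.card)⁻¹ with hb
  have hF' : (0 : ℝ) < F.card := by exact_mod_cast hF
  have haa : F.card * a ^ 2 = 1 := by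
    rw [ha, inv_pow, Real.sq_sqrt hF'.le, mul_inv_cancel₀ hF'.ne']
  have h1 : ∑ y ∈ F, ((if y ∈ Y then b else 0) - a) ^ 2 =
      Y.card * (b ^ 2 - 2 * a * b) + F.card * a ^ 2 := by
    have h2 : ∀ y, ((if y ∈ Y then b else 0) - a) ^ 2 =
        (if y ∈ Y then b ^ 2 - 2 * a * b else 0) + a ^ 2 := by
      intro y; split_ifs <;> ring
    simp_rw [h2]
    rw [Finset.sum_add_distrib, Finset.sum_ite_mem, Finset.inter_eq_right.2 hY, Finset.sum_const,
      Finset.sum_const, nsmul_eq_mul, nsmul_eq_mul]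
  rw [h1, haa, mul_div_assoc, sub_div, div_self hF'.ne']
  rcases Nat.eq_zero_or_pos Y.card with h0 | h0
  · simp [h0]
  · have hY' : (0 : ℝ) < Y.card := by exact_mod_cast h0
    have hle : Real.sqrt Y.card ≤ Real.sqrt F.card :=
      Real.sqrt_le_sqrt (by exact_mod_cast Finset.card_le_card hY)
    have hsY := Real.sqrt_pos.2 hY'
    have hsF := Real.sqrt_pos.2 hF'
    have hbb : Y.card * b ^ 2 = 1 := by
      rw [hb, inv_pow, Real.sq_sqrt hY'.le, mul_inv_cancel₀ hY'.ne']
    have hab : (Y.card : ℝ) / F.card ≤ Y.card * (a * b) := by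
      rw [div_eq_mul_inv]
      refine mul_le_mul_of_nonneg_left ?_ hY'.le
      rw [← Real.mul_self_sqrt hF'.le, mul_inv, ha, hb]
      exact mul_le_mul_of_nonneg_left (inv_anti₀ hsY hle) (inv_nonneg.2 hsF.le)
    nlinarith

section
variable {n m : ℕ}

/-- A free output outside `CF` is either already used by the other oracle or creates a collision.
The factor 2 absorbs the former kind into the count of the latter. -/
lemma card_none_sub_card_CF_le {ℓ lam : ℕ} (hl : lam ≤ n) (hℓ : 1 ≤ ℓ) {g : PFun n}
    (hc : StrongCF ℓ lam (suppU g)) (j : Fin 2) :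
    (Finset.univ.filter fun y => g (j, y) = none).card ≤ (CF ℓ lam (suppU g)).card +
      2 * (ℓ * (suppU g).card ^ (2 * ℓ - 1) * 2 ^ (n - lam)) := by
  classical
  have h1 : (Finset.univ.filter fun y => g (j, y) = none) ⊆
      CF ℓ lam (suppU g) ∪ (suppU g ∪
        Finset.univ.filter fun y => ¬StrongCF ℓ lam (insert y (suppU g))) := by
    intro y _
    simp only [CF, Finset.mem_union, Finset.mem_filter, Finset.mem_univ, true_and]
    tauto
  have h2 := card_not_strongCF_insert_le hl hc
  have h3 : (suppU g).card ≤ ℓ * (suppU g).card ^ (2 * ℓ - 1) * 2 ^ (n - lam) :=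
    calc (suppU g).card ≤ (suppU g).card ^ (2 * ℓ - 1) := Nat.le_self_pow (by omega) _
      _ = 1 * (suppU g).card ^ (2 * ℓ - 1) * 1 := by ring
      _ ≤ _ := Nat.mul_le_mul (Nat.mul_le_mul_right _ hℓ) Nat.one_le_two_pow
  have h4 := (Finset.card_le_card h1).trans ((Finset.card_union_le _ _).trans
    (Nat.add_le_add_left (Finset.card_union_le _ _) _))
  omega

/-- The constant 8 is a product of three factors 2: from `sum_uniform_sub_sq_le`, from
`card_none_sub_card_CF_le`, and from |F| ≥ N/2, which follows from 2t ≤ N. -/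
lemma sum_cfWeight_sub_prWeight_sq_le {ℓ lam t : ℕ} (hl : lam ≤ n) (hℓ : 1 ≤ ℓ)
    (ht : 2 * t ≤ 2 ^ n) {g : PFun n} (hc : StrongCF ℓ lam (suppU g))
    (hd : Disjoint (supp g 0) (supp g 1)) (hk : (suppU g).card < t) (j : Fin 2) :
    (∑ y, if g (j, y) = none then (cfWeight n ℓ lam j - prWeight n j) g y ^ 2 else 0) ≤
      8 * (ℓ * (t : ℝ) ^ (2 * ℓ) / 2 ^ lam) := by
  classical
  have hg : Good ℓ lam g := good_of hc hd (by omega)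
  have hj : (supp g j).card ≤ (suppU g).card := by
    refine Finset.card_le_card ?_
    fin_cases j
    · exact Finset.subset_union_left
    · exact Finset.subset_union_right
  set F := Finset.univ.filter fun y => g (j, y) = none with hF
  set Y := CF ℓ lam (suppU g) with hY
  have hcF : (F.card : ℝ) = 2 ^ n - (supp g j).card := card_filter_none g j
  have hYF : Y ⊆ F := by
    intro y hy
    rw [hF, Finset.mem_filter]
    exact ⟨Finset.mem_univ _, notMem_suppU (Finset.mem_filter.1 hy).2.1 j⟩
  have ht' : 2 * (t : ℝ) ≤ 2 ^ n := by exact_mod_cast ht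
  have hjt : ((supp g j).card : ℝ) ≤ t := by exact_mod_cast hj.trans hk.le
  have hNpos : (0 : ℝ) < 2 ^ n := by positivity
  have hFlow : (2 : ℝ) ^ n / 2 ≤ F.card := by rw [hcF]; linarith
  have hFpos : (0 : ℝ) < F.card := by linarith
  rw [← Finset.sum_filter]
  have h1 : ∀ y, (cfWeight n ℓ lam j - prWeight n j) g y =
      (if y ∈ Y then (Real.sqrt Y.card)⁻¹ else 0) - (Real.sqrt F.card)⁻¹ := by
    intro y
    simp only [Pi.sub_apply, cfWeight, prWeight, hg, true_and, hcF]
    rfl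
  simp_rw [h1]
  refine (sum_uniform_sub_sq_le hYF (by exact_mod_cast hFpos)).trans ?_
  have h2 : (F.card : ℝ) - Y.card ≤ 2 * (ℓ * (t : ℝ) ^ (2 * ℓ) * 2 ^ (n - lam)) := by
    have h3 : F.card ≤ Y.card + 2 * (ℓ * t ^ (2 * ℓ) * 2 ^ (n - lam)) := by
      refine (card_none_sub_card_CF_le hl hℓ hc j).trans ?_
      have h4 : (suppU g).card ^ (2 * ℓ - 1) ≤ t ^ (2 * ℓ) :=
        (Nat.pow_le_pow_left hk.le _).trans (Nat.pow_le_pow_right (by omega) (by omega))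
      gcongr
    have : (F.card : ℝ) ≤ Y.card + 2 * (ℓ * (t : ℝ) ^ (2 * ℓ) * 2 ^ (n - lam)) := by
      exact_mod_cast h3
    linarith
  have h5 : (2 : ℝ) ^ n = 2 ^ (n - lam) * 2 ^ lam := by
    rw [← pow_add, Nat.sub_add_cancel hl]
  have h6 : (0 : ℝ) < 2 ^ lam := by positivity
  rw [div_le_iff₀ hFpos]
  calc 2 * ((F.card : ℝ) - Y.card) ≤ 4 * (ℓ * (t : ℝ) ^ (2 * ℓ) * 2 ^ (n - lam)) := by linarith
    _ = 8 * (ℓ * (t : ℝ) ^ (2 * ℓ) / 2 ^ lam) * (2 ^ n / 2) := by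
      rw [h5]; field_simp; ring
    _ ≤ _ := mul_le_mul_of_nonneg_left hFlow (by positivity)

/-! ### Hybrid argument over the queries -/

lemma suppU_update {g : PFun n} {j : Fin 2} {y : BitString n} (x : BitString n) :
    suppU (Function.update g (j, y) (some x)) = insert y (suppU g) := by
  ext y'
  simp only [suppU, Finset.mem_union, mem_supp, Finset.mem_insert, Function.update_apply,
    Prod.mk.injEq]
  by_cases hy : y' = y
  · subst hy
    fin_cases j <;> simp
  · simp [hy]

lemma supp_update_self {g : PFun n} {j : Fin 2} {y : BitString n} (x : BitString n) :
    supp (Function.update g (j, y) (some x)) j = insert y (supp g j) := by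
  ext y'
  simp only [mem_supp, Finset.mem_insert, Function.update_apply, Prod.mk.injEq, true_and]
  by_cases hy : y' = y <;> simp [hy]

lemma supp_update_ne {g : PFun n} {j j' : Fin 2} (hj : j' ≠ j) {y : BitString n}
    (u : Option (BitString n)) : supp (Function.update g (j, y) u) j' = supp g j' := by
  ext y'
  simp [mem_supp, hj]

lemma disjoint_supp_update {g : PFun n} {j : Fin 2} {y : BitString n} (x : BitString n)
    (hd : Disjoint (supp g 0) (supp g 1)) (hy : y ∉ suppU g) :
    Disjoint (supp (Function.update g (j, y) (some x)) 0)
      (supp (Function.update g (j, y) (some x)) 1) := by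
  rw [suppU, Finset.mem_union, not_or] at hy
  fin_cases j
  · simp only [Fin.zero_eta]
    rw [supp_update_self, supp_update_ne (by simp), Finset.disjoint_insert_left]
    exact ⟨hy.2, hd⟩
  · simp only [Fin.mk_one]
    rw [supp_update_self, supp_update_ne (by simp), Finset.disjoint_insert_right]
    exact ⟨hy.1, hd⟩

lemma l2_recView_le {t : ℕ} (𝒜 : Adversary n m t) (w : Fin 2 → PFun n → BitString n → ℝ)
    (hw : ∀ j g, (∑ y, if g (j, y) = none then w j g y ^ 2 else 0) ≤ 1) :
    l2 (𝒜.recView w) ≤ 1 := by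
  refine foldl_ind (fun _ a => l2 a ≤ 1) t _ _ l2_initRec.le fun i a h => ?_
  have := l2_recStep_le (w := w (𝒜.query i)) (j := 𝒜.query i)
    (ψ := applyLocal (𝒜.unitary i).1 a) zero_le_one fun p _ => by
      rw [one_pow]; exact hw _ _
  rw [l2_applyLocal (𝒜.unitary i).2, one_mul] at this
  exact this.trans h

/-- The collision-free view stays on functions with disjoint, jointly collision-free images, having
exactly one recorded output per query. These are the functions on which the two weights are close,
so the weights are compared along this view only. -/
lemma l2_cfView_sub_prView_le {ℓ lam t : ℕ} (hl : lam ≤ n) (hℓ : 1 ≤ ℓ) (ht : 2 * t ≤ 2 ^ n)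
    (𝒜 : Adversary n m t) :
    l2 (𝒜.recView (cfWeight n ℓ lam) - 𝒜.recView (prWeight n)) ≤
      t * Real.sqrt (8 * (ℓ * (t : ℝ) ^ (2 * ℓ) / 2 ^ lam)) := by
  set ε := Real.sqrt (8 * (ℓ * (t : ℝ) ^ (2 * ℓ) / 2 ^ lam)) with hε
  have hε0 : 0 ≤ ε := Real.sqrt_nonneg _
  have key := foldl_rel (fun i (a b : (BitString n × BitString m) × PFun n → ℂ) =>
      l2 (a - b) ≤ i * ε ∧ l2 a ≤ 1 ∧ ∀ p, a p ≠ 0 →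
        StrongCF ℓ lam (suppU p.2) ∧ Disjoint (supp p.2 0) (supp p.2 1) ∧ (suppU p.2).card = i) t
    (fun ψ i => recStep (cfWeight n ℓ lam (𝒜.query i)) (𝒜.query i)
      (applyLocal (𝒜.unitary i).1 ψ))
    (fun ψ i => recStep (prWeight n (𝒜.query i)) (𝒜.query i) (applyLocal (𝒜.unitary i).1 ψ))
    (initRec n m) (initRec n m) ?_ ?_
  · exact key.1
  · refine ⟨by simp [l2], l2_initRec.le, ?_⟩
    intro p hp
    have h1 : p.2 = fun _ => none := by
      by_contra h
      simp [initRec, h] at hp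
    have h2 : ∀ j, supp (fun _ => none : PFun n) j = ∅ := by
      intro j; ext; simp [mem_supp]
    rw [h1, suppU, h2, h2]
    exact ⟨strongCF_empty _ _, by simp, by simp⟩
  · rintro i a b ⟨h1, h2, h3⟩
    set j := 𝒜.query i
    set U := (𝒜.unitary i).1
    have hU := (𝒜.unitary i).2
    have h3' := applyLocal_support (Q := fun g => StrongCF ℓ lam (suppU g) ∧
      Disjoint (supp g 0) (supp g 1) ∧ (suppU g).card = i) U h3
    refine ⟨?_, ?_, ?_⟩
    -- The new error changes the weights on the collision-free state; the old error passes through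
    -- the path-recording step, which is a contraction.
    · have e : recStep (cfWeight n ℓ lam j) j (applyLocal U a) -
          recStep (prWeight n j) j (applyLocal U b) =
          recStep (cfWeight n ℓ lam j - prWeight n j) j (applyLocal U a) +
            recStep (prWeight n j) j (applyLocal U (a - b)) := by
        rw [recStep_sub_left, applyLocal_sub, recStep_sub]
        abel
      rw [e]
      refine (l2_add_le _ _).trans ?_
      have e1 := l2_recStep_le (w := cfWeight n ℓ lam j - prWeight n j) (j := j)
        (ψ := applyLocal U a) hε0 (by
          intro p hp
          obtain ⟨hc, hd, hk⟩ := h3' p hp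
          rw [hε, Real.sq_sqrt (by positivity)]
          exact sum_cfWeight_sub_prWeight_sq_le hl hℓ ht hc hd (hk ▸ i.2) j)
      have e2 := l2_recStep_le (w := prWeight n j) (j := j)
        (ψ := applyLocal U (a - b)) zero_le_one (by
          intro p _
          rw [one_pow]
          exact sum_prWeight_sq_le _ _)
      rw [l2_applyLocal hU] at e1 e2
      push_cast
      nlinarith
    · have e1 := l2_recStep_le (w := cfWeight n ℓ lam j) (j := j)
        (ψ := applyLocal U a) zero_le_one (by
          intro p _
          rw [one_pow]
          exact sum_cfWeight_sq_le _ _ _ _)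
      rw [l2_applyLocal hU] at e1
      linarith
    · intro p hp
      obtain ⟨g, x, y, hgy, hpg, hw, q, hq⟩ := exists_of_recStep_ne_zero hp
      obtain ⟨hc, hd, hk⟩ := h3' _ hq
      simp only at hc hd hk
      have hy : Good ℓ lam g ∧ y ∈ CF ℓ lam (suppU g) := by
        by_contra h
        exact hw (if_neg h)
      classical
      obtain ⟨hyn, hyc⟩ := (Finset.mem_filter.1 hy.2).2
      rw [hpg, suppU_update]
      exact ⟨hyc, disjoint_supp_update x hd hyn, by rw [Finset.card_insert_of_notMem hyn, hk]⟩

/-- The error bound `√ℓ t^{ℓ+1} / 2^{lam/2}`. -/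
def cfError (ℓ lam t : ℕ) : ℝ := Real.sqrt ℓ * (t : ℝ) ^ (ℓ + 1) / (2 : ℝ) ^ ((lam : ℝ) / 2)

lemma two_rpow_half (k : ℕ) : (2 : ℝ) ^ ((k : ℝ) / 2) = Real.sqrt (2 ^ k) := by
  rw [Real.sqrt_eq_rpow, ← Real.rpow_natCast, ← Real.rpow_mul (by norm_num)]
  congr 1
  ring

lemma cfError_nonneg (ℓ lam t : ℕ) : 0 ≤ cfError ℓ lam t := by
  unfold cfError; positivity

lemma sq_div_sqrt_le_cfError {ℓ lam : ℕ} (t : ℕ) (hl : lam ≤ n) (hℓ : 1 ≤ ℓ) :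
    (t : ℝ) ^ 2 / Real.sqrt (2 ^ n) ≤ cfError ℓ lam t := by
  unfold cfError
  rw [two_rpow_half]
  have h1 : Real.sqrt ((2 : ℝ) ^ lam) ≤ Real.sqrt (2 ^ n) :=
    Real.sqrt_le_sqrt (pow_le_pow_right₀ (by norm_num) hl)
  have h2 : (t : ℝ) ^ 2 ≤ Real.sqrt ℓ * (t : ℝ) ^ (ℓ + 1) := by
    rcases Nat.eq_zero_or_pos t with rfl | h0
    · simp
    · have h3 : (1 : ℝ) ≤ t := by exact_mod_cast h0
      have h4 : (1 : ℝ) ≤ Real.sqrt ℓ := by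
        rw [Real.one_le_sqrt]; exact_mod_cast hℓ
      have h5 : (t : ℝ) ^ 2 ≤ (t : ℝ) ^ (ℓ + 1) := pow_le_pow_right₀ h3 (by omega)
      nlinarith [pow_nonneg (zero_le_one.trans h3) (ℓ + 1)]
  exact div_le_div₀ (by positivity) h2 (by positivity) h1

lemma one_le_four_mul_sq_div_sqrt {t : ℕ} (h : 2 ^ n ≤ 2 * t) :
    1 ≤ 4 * ((t : ℝ) ^ 2 / Real.sqrt (2 ^ n)) := by
  have h1 : (2 : ℝ) ^ n ≤ 2 * t := by exact_mod_cast h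
  have h2 : (1 : ℝ) ≤ 2 ^ n := one_le_pow₀ (by norm_num)
  have h3 : Real.sqrt ((2 : ℝ) ^ n) ≤ 2 ^ n := by
    rw [Real.sqrt_le_left (by positivity)]; nlinarith
  have h4 : 0 < Real.sqrt ((2 : ℝ) ^ n) := by positivity
  rw [← mul_div_assoc, one_le_div h4]
  nlinarith

lemma norm_trace_cf_sub_pr_le {ℓ lam t : ℕ} (hl : lam ≤ n) (hℓ : 1 ≤ ℓ) (𝒜 : Adversary n m t)
    {W : Matrix (BitString n × BitString m) (BitString n × BitString m) ℂ}
    (hW : W ∈ Matrix.unitaryGroup (BitString n × BitString m) ℂ) :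
    ‖(W * reducedState (𝒜.recView (cfWeight n ℓ lam))).trace -
      (W * reducedState (𝒜.recView (prWeight n))).trace‖ ≤ 2 * (4 * cfError ℓ lam t) := by
  have hcf := l2_recView_le 𝒜 _ fun j g => sum_cfWeight_sq_le ℓ lam g j
  have hpr := l2_recView_le 𝒜 _ fun j g => sum_prWeight_sq_le g j
  have h0 := norm_trace_mul_reducedState_sub_le hW (𝒜.recView (cfWeight n ℓ lam))
    (𝒜.recView (prWeight n))
  have hs := l2_nonneg (𝒜.recView (cfWeight n ℓ lam) - 𝒜.recView (prWeight n))
  rcases le_total (2 * t) (2 ^ n) with ht | ht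
  · have h1 := l2_cfView_sub_prView_le hl hℓ ht 𝒜
    have h2 : t * Real.sqrt (8 * (ℓ * (t : ℝ) ^ (2 * ℓ) / 2 ^ lam)) ≤ 4 * cfError ℓ lam t := by
      have h3 : Real.sqrt (8 * (ℓ * (t : ℝ) ^ (2 * ℓ) / 2 ^ lam)) =
          Real.sqrt 8 * (Real.sqrt ℓ * (t : ℝ) ^ ℓ / Real.sqrt (2 ^ lam)) := by
        rw [Real.sqrt_mul (by norm_num), Real.sqrt_div (by positivity),
          Real.sqrt_mul (by positivity), mul_comm 2 ℓ, pow_mul, Real.sqrt_sq (by positivity)]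
      have h4 : Real.sqrt 8 ≤ 4 := by
        rw [Real.sqrt_le_left (by norm_num)]; norm_num
      have h5 : t * Real.sqrt (8 * (ℓ * (t : ℝ) ^ (2 * ℓ) / 2 ^ lam)) =
          Real.sqrt 8 * cfError ℓ lam t := by
        rw [h3, cfError, two_rpow_half, pow_succ]
        ring
      rw [h5]
      exact mul_le_mul_of_nonneg_right h4 (cfError_nonneg _ _ _)
    nlinarith
  -- For 2t ≥ N the left side is at most 2 by subnormalization, and the right side is at least 2.
  · have h1 := one_le_four_mul_sq_div_sqrt ht
    have h2 := sq_div_sqrt_le_cfError t hl hℓ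
    have h3 := l2_sub_le (𝒜.recView (cfWeight n ℓ lam)) (𝒜.recView (prWeight n))
    have h4 := norm_trace_mul_reducedState_le hW (𝒜.recView (cfWeight n ℓ lam))
    have h5 := norm_trace_mul_reducedState_le hW (𝒜.recView (prWeight n))
    have h6 := norm_sub_le (W * reducedState (𝒜.recView (cfWeight n ℓ lam))).trace
      (W * reducedState (𝒜.recView (prWeight n))).trace
    have h7 := l2_nonneg (𝒜.recView (cfWeight n ℓ lam))
    have h8 := l2_nonneg (𝒜.recView (prWeight n))
    nlinarith

end

/-! ### Tensor powers of matrices -/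

section
variable {I κ : Type*} [Fintype I] [DecidableEq I] [Fintype κ] [DecidableEq κ]

/-- The tensor product of a family of matrices. -/
def tensor (M : I → Matrix κ κ ℂ) : Matrix (I → κ) (I → κ) ℂ :=
  Matrix.of fun g h => ∏ i, M i (g i) (h i)

lemma tensor_mul (M M' : I → Matrix κ κ ℂ) :
    tensor M * tensor M' = tensor fun i => M i * M' i := by
  ext g h
  simp only [Matrix.mul_apply, tensor, Matrix.of_apply, ← Finset.prod_mul_distrib]
  rw [Finset.prod_univ_sum, Fintype.piFinset_univ]

lemma tensor_one : tensor (fun _ : I => (1 : Matrix κ κ ℂ)) = 1 := by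
  ext g h
  simp only [tensor, Matrix.of_apply, Matrix.one_apply]
  rw [Fintype.prod_ite_zero]
  simp [funext_iff]

lemma star_tensor (M : I → Matrix κ κ ℂ) : star (tensor M) = tensor fun i => star (M i) := by
  ext g h
  simp [tensor, Matrix.star_apply]

lemma tensor_mem_unitaryGroup {M : I → Matrix κ κ ℂ}
    (hM : ∀ i, M i ∈ Matrix.unitaryGroup κ ℂ) : tensor M ∈ Matrix.unitaryGroup (I → κ) ℂ := by
  rw [Matrix.mem_unitaryGroup_iff, star_tensor, tensor_mul, ← tensor_one]
  congr 1
  funext i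
  exact Matrix.mem_unitaryGroup_iff.1 (hM i)

/-- The extension of a matrix by the identity on an additional basis vector `none`. -/
def liftOpt (C : Matrix κ κ ℂ) : Matrix (Option κ) (Option κ) ℂ :=
  Matrix.of fun a b => a.elim (b.elim 1 fun _ => 0) fun x => b.elim 0 fun y => C x y

@[simp] lemma liftOpt_none_none (C : Matrix κ κ ℂ) : liftOpt C none none = 1 := rfl
@[simp] lemma liftOpt_none_some (C : Matrix κ κ ℂ) (y : κ) : liftOpt C none (some y) = 0 := rfl
@[simp] lemma liftOpt_some_none (C : Matrix κ κ ℂ) (x : κ) : liftOpt C (some x) none = 0 := rfl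
@[simp] lemma liftOpt_some_some (C : Matrix κ κ ℂ) (x y : κ) :
    liftOpt C (some x) (some y) = C x y := rfl

lemma liftOpt_mul (C D : Matrix κ κ ℂ) : liftOpt C * liftOpt D = liftOpt (C * D) := by
  ext a b
  rw [Matrix.mul_apply, Fintype.sum_option]
  cases a <;> cases b <;> simp [Matrix.mul_apply]

lemma liftOpt_one : liftOpt (1 : Matrix κ κ ℂ) = 1 := by
  ext a b
  cases a <;> cases b <;> simp [Matrix.one_apply]

lemma star_liftOpt (C : Matrix κ κ ℂ) : star (liftOpt C) = liftOpt (star C) := by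
  ext a b
  cases a <;> cases b <;> simp [Matrix.star_apply]

lemma liftOpt_mem_unitaryGroup {C : Matrix κ κ ℂ} (hC : C ∈ Matrix.unitaryGroup κ ℂ) :
    liftOpt C ∈ Matrix.unitaryGroup (Option κ) ℂ := by
  rw [Matrix.mem_unitaryGroup_iff, star_liftOpt, liftOpt_mul, Matrix.mem_unitaryGroup_iff.1 hC,
    liftOpt_one]

lemma liftOpt_ne_zero {C : Matrix κ κ ℂ} {a b : Option κ} (h : liftOpt C a b ≠ 0) :
    a = none ↔ b = none := by
  cases a <;> cases b <;> simp_all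

end

/-! ### Operators on the recording registers -/

section
variable {n m : ℕ}

/-- An operator on the recording registers. -/
def applyRec {E : Type} [Fintype E] (V : Matrix E E ℂ)
    (ψ : (BitString n × BitString m) × E → ℂ) : (BitString n × BitString m) × E → ℂ :=
  fun p => (V *ᵥ fun h => ψ (p.1, h)) p.2

lemma applyLocal_applyRec {E : Type} [Fintype E] (V : Matrix E E ℂ)
    (U : Matrix (BitString n × BitString m) (BitString n × BitString m) ℂ)
    (ψ : (BitString n × BitString m) × E → ℂ) :
    applyLocal U (applyRec V ψ) = applyRec V (applyLocal U ψ) := by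
  funext p
  simp only [applyLocal, applyRec, Matrix.mulVec, dotProduct, Finset.mul_sum]
  rw [Finset.sum_comm]
  refine Finset.sum_congr rfl fun a _ => Finset.sum_congr rfl fun b _ => ?_
  ring

lemma applyRec_mul {E : Type} [Fintype E] (V V' : Matrix E E ℂ)
    (ψ : (BitString n × BitString m) × E → ℂ) :
    applyRec (V * V') ψ = applyRec V (applyRec V' ψ) := by
  funext p
  simp only [applyRec, ← Matrix.mulVec_mulVec]

lemma reducedState_applyRec {E : Type} [Fintype E] [DecidableEq E] {V : Matrix E E ℂ}
    (hV : V ∈ Matrix.unitaryGroup E ℂ) (ψ : (BitString n × BitString m) × E → ℂ) :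
    reducedState (applyRec V ψ) = reducedState ψ := by
  ext p q
  have h : star V * V = 1 := (Matrix.mem_unitaryGroup_iff').1 hV
  rw [Matrix.star_eq_conjTranspose] at h
  have h1 : ∀ a b : E → ℂ, ∑ e, a e * star (b e) = star b ⬝ᵥ a := fun a b =>
    Finset.sum_congr rfl fun e _ => mul_comm _ _
  simp only [reducedState, Matrix.of_apply, applyRec]
  rw [h1, h1, Matrix.star_mulVec, ← Matrix.dotProduct_mulVec, Matrix.mulVec_mulVec, h,
    Matrix.one_mulVec]

/-- The action of a pair of single-register matrices on the recorded inputs. -/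
def onRec (C : Fin 2 → Matrix (BitString n) (BitString n) ℂ) : Matrix (PFun n) (PFun n) ℂ :=
  tensor fun i => liftOpt (C i.1)

lemma onRec_mul (C D : Fin 2 → Matrix (BitString n) (BitString n) ℂ) :
    onRec C * onRec D = onRec fun j => C j * D j := by
  simp only [onRec, tensor_mul, liftOpt_mul]

lemma onRec_mem_unitaryGroup {C : Fin 2 → Matrix (BitString n) (BitString n) ℂ}
    (hC : ∀ j, C j ∈ Matrix.unitaryGroup (BitString n) ℂ) :
    onRec C ∈ Matrix.unitaryGroup (PFun n) ℂ :=
  tensor_mem_unitaryGroup fun i => liftOpt_mem_unitaryGroup (hC i.1)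

/-- The operator `C ⊗ 1` on `AB`. -/
def onA (m : ℕ) (C : Matrix (BitString n) (BitString n) ℂ) :
    Matrix (BitString n × BitString m) (BitString n × BitString m) ℂ :=
  Matrix.kronecker C 1

lemma onA_mem_unitaryGroup {C : Matrix (BitString n) (BitString n) ℂ}
    (hC : C ∈ Matrix.unitaryGroup (BitString n) ℂ) :
    onA m C ∈ Matrix.unitaryGroup (BitString n × BitString m) ℂ :=
  Matrix.kronecker_mem_unitary hC (one_mem _)

lemma applyLocal_onA {E : Type} (C : Matrix (BitString n) (BitString n) ℂ)
    (ψ : (BitString n × BitString m) × E → ℂ) (p : (BitString n × BitString m) × E) :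
    applyLocal (onA m C) ψ p = ∑ x, C p.1.1 x * ψ ((x, p.1.2), p.2) := by
  simp only [applyLocal, onA, Fintype.sum_prod_type]
  refine Finset.sum_congr rfl fun x _ => ?_
  rw [Finset.sum_eq_single p.1.2]
  · simp [Matrix.kronecker, Matrix.kroneckerMap_apply]
  · intro b _ hb
    simp [Matrix.kronecker, Matrix.kroneckerMap_apply, hb.symm]
  · simp

/-- The adversary that applies `C j` to the query register before each query to oracle `j`. -/
def Adversary.twist {t : ℕ} (𝒜 : Adversary n m t)
    (C : Fin 2 → Matrix.unitaryGroup (BitString n) ℂ) : Adversary n m t where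
  query := 𝒜.query
  unitary i := ⟨onA m (C (𝒜.query i)).1, onA_mem_unitaryGroup (C (𝒜.query i)).2⟩ * 𝒜.unitary i

/-- A query moves its input into the record, so rotating the query register before the step is the
same as rotating the newly recorded input after it. The old records are rotated on both sides, and
the weights do not notice because they depend only on which entries are filled. -/
lemma recStep_onRec {w : PFun n → BitString n → ℝ}
    (hw : ∀ g h : PFun n, (∀ i, g i = none ↔ h i = none) → ∀ y, w g y = w h y) (j : Fin 2)
    (C : Fin 2 → Matrix (BitString n) (BitString n) ℂ)
    (ψ : (BitString n × BitString m) × PFun n → ℂ) :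
    recStep w j (applyLocal (onA m (C j)) (applyRec (onRec C) ψ)) =
      applyRec (onRec C) (recStep w j ψ) := by
  funext ⟨⟨y, b⟩, g⟩
  set L : Fin 2 × BitString n → Matrix (Option (BitString n)) (Option (BitString n)) ℂ :=
    fun i => liftOpt (C i.1) with hL
  set rest : PFun n → PFun n → ℂ := fun g h =>
    ∏ i ∈ Finset.univ.erase (j, y), L i (g i) (h i) with hrest
  have hsplit : ∀ g h : PFun n, onRec C g h = L (j, y) (g (j, y)) (h (j, y)) * rest g h := by
    intro g h
    exact (Finset.mul_prod_erase _ _ (Finset.mem_univ (j, y))).symm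
  have hrest_left : ∀ (g h : PFun n) u, rest (Function.update g (j, y) u) h = rest g h := by
    intro g h u
    refine Finset.prod_congr rfl fun i hi => ?_
    rw [Function.update_of_ne (Finset.ne_of_mem_erase hi)]
  have hrest_right : ∀ (g h : PFun n) u, rest g (Function.update h (j, y) u) = rest g h := by
    intro g h u
    refine Finset.prod_congr rfl fun i hi => ?_
    rw [Function.update_of_ne (Finset.ne_of_mem_erase hi)]
  have hR : applyRec (onRec C) (recStep w j ψ) ((y, b), g) =
      ∑ h : PFun n, if h (j, y) = none then
        ∑ x, L (j, y) (g (j, y)) (some x) * rest g h * (w h y * ψ ((x, b), h)) else 0 := by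
    simp only [applyRec, Matrix.mulVec, dotProduct]
    rw [sum_eq_sum_update (j, y) none]
    refine Finset.sum_congr rfl fun h _ => ?_
    split_ifs with hh
    · rw [Fintype.sum_option]
      have h3 : Function.update h (j, y) none = h := by rw [← hh, Function.update_eq_self]
      simp only [recStep, hsplit, hrest_right, Function.update_self, Option.elim,
        Function.update_idem, h3, mul_zero, zero_add, hh]
    · rfl
  rw [hR]
  simp only [recStep]
  rcases hg : g (j, y) with _ | x₀
  · simp [hL]
  · simp only [Option.elim, applyLocal_onA, applyRec, Matrix.mulVec, dotProduct, hsplit,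
      hrest_left, Function.update_self, Finset.mul_sum]
    rw [Finset.sum_comm]
    refine Finset.sum_congr rfl fun h _ => ?_
    split_ifs with hh
    · refine Finset.sum_congr rfl fun x _ => ?_
      rw [hh]
      -- A nonzero matrix entry forces `g` and `h` to be filled at the same positions away from (j,
      -- y), so their weights agree once the entry at (j, y) is emptied.
      by_cases hz : rest g h = 0
      · simp [hz]
      · rw [hw (Function.update g (j, y) none) h ?_ y]
        · simp only [hL, liftOpt_none_none, liftOpt_some_some]
          ring
        · intro i
          by_cases hi : i = (j, y)
          · subst hi
            simp [hh]
          · rw [Function.update_of_ne hi]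
            exact liftOpt_ne_zero
              (Finset.prod_ne_zero_iff.1 hz i (Finset.mem_erase.2 ⟨hi, Finset.mem_univ _⟩))
    · obtain ⟨u, hu⟩ := Option.ne_none_iff_exists'.1 hh
      refine Finset.sum_eq_zero fun x _ => ?_
      simp [hu, hL]

lemma applyRec_onRec_initRec (C : Fin 2 → Matrix (BitString n) (BitString n) ℂ) :
    applyRec (onRec C) (initRec n m) = initRec n m := by
  funext ⟨p, g⟩
  simp only [applyRec, Matrix.mulVec, dotProduct, initRec]
  by_cases hp : p = 0
  · simp only [hp, mul_ite, mul_one, mul_zero, Finset.sum_ite_eq', Finset.mem_univ, if_true]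
    split_ifs with hg
    · subst hg
      simp [onRec, tensor]
    · obtain ⟨i, hi⟩ := Function.ne_iff.1 hg
      obtain ⟨u, hu⟩ := Option.ne_none_iff_exists'.1 hi
      refine Finset.prod_eq_zero (Finset.mem_univ i) ?_
      simp [hu]
  · simp [hp]

lemma supp_congr {g h : PFun n} (hgh : ∀ i, g i = none ↔ h i = none) (j : Fin 2) :
    supp g j = supp h j := by
  ext y
  simp [mem_supp, hgh]

lemma recView_twist {t : ℕ} (𝒜 : Adversary n m t)
    (C : Fin 2 → Matrix.unitaryGroup (BitString n) ℂ) :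
    (𝒜.twist C).recView (prWeight n) =
      applyRec (onRec fun j => (C j).1) (𝒜.recView (prWeight n)) := by
  refine foldl_rel (fun _ a b => a = applyRec (onRec fun j => (C j).1) b) t _ _ _ _ ?_ ?_
  · rw [applyRec_onRec_initRec]
  · rintro i a b rfl
    rw [← recStep_onRec, ← applyLocal_applyRec, ← applyLocal_mul]
    · rfl
    · intro g h hgh y
      simp only [prWeight, supp_congr hgh]

/-- The exact right unitary invariance of path recording: rotating all queries acts unitarily on the
traced-out record. -/
lemma reducedState_recView_twist {t : ℕ} (𝒜 : Adversary n m t)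
    (C : Fin 2 → Matrix.unitaryGroup (BitString n) ℂ) :
    reducedState ((𝒜.twist C).recView (prWeight n)) =
      reducedState (𝒜.recView (prWeight n)) := by
  rw [recView_twist, reducedState_applyRec (onRec_mem_unitaryGroup fun j => (C j).2)]

end

/-! ### Random phases -/

section
variable {X : Type*} [Fintype X] [DecidableEq X]

/-- A primitive cubic character. -/
abbrev cubic : AddChar (ZMod 3) ℂ := ZMod.stdAddChar

lemma norm_cubic (a : ZMod 3) : ‖cubic a‖ = 1 := AddChar.norm_apply cubic a

lemma cubic_sum (s : Finset X) (f : X → ZMod 3) :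
    cubic (∑ x ∈ s, f x) = ∏ x ∈ s, cubic (f x) := by
  induction s using Finset.induction_on with
  | empty => simp
  | insert a s ha ih => rw [Finset.sum_insert ha, Finset.prod_insert ha, AddChar.map_add_eq_mul, ih]

lemma sum_cubic (v : X → ZMod 3) :
    ∑ k : X → ZMod 3, cubic (∑ x, k x * v x) =
      if v = 0 then (Fintype.card (X → ZMod 3) : ℂ) else 0 := by
  have h1 : ∑ k : X → ZMod 3, cubic (∑ x, k x * v x) = ∏ x, ∑ e : ZMod 3, cubic (e * v x) := by
    rw [Finset.prod_univ_sum, Fintype.piFinset_univ]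
    refine Finset.sum_congr rfl fun k _ => ?_
    rw [cubic_sum]
  rw [h1]
  have h2 : ∀ x, ∑ e : ZMod 3, cubic (e * v x) = if v x = 0 then 3 else 0 := by
    intro x
    have := AddChar.sum_mulShift (v x) (ZMod.isPrimitive_stdAddChar 3)
    rw [this, ZMod.card]
    norm_cast
  simp_rw [h2]
  rw [Fintype.prod_ite_zero]
  simp [funext_iff]

/-- This is why cubic phases replace signs: modulo 2 all diagonal pairs (u, u) would give the zero
vector, while modulo 3 the unordered pair is recovered, since 1 + 1 is neither 0 nor 1. -/
lemma single_add_single_eq {u v u' v' : X}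
    (h : (Pi.single u 1 + Pi.single v 1 : X → ZMod 3) = Pi.single u' 1 + Pi.single v' 1) :
    (u', v') = (u, v) ∨ (u', v') = (v, u) := by
  have hinj : ∀ a b : X, (Pi.single a 1 : X → ZMod 3) = Pi.single b 1 → a = b := by
    intro a b hab
    by_contra hne
    have := congrFun hab a
    simp [hne] at this
  by_cases h1 : u = u'
  · subst h1
    left
    rw [hinj _ _ (add_left_cancel h)]
  · by_cases h2 : u = v'
    · subst h2
      right
      rw [add_comm (Pi.single u' 1)] at h
      rw [hinj _ _ (add_left_cancel h)]
    · exfalso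
      have := congrFun h u
      simp only [Pi.add_apply, Pi.single_apply, h1, h2, if_true, if_false] at this
      by_cases h3 : u = v
      · simp only [h3, if_true] at this
        exact absurd this (by decide)
      · simp only [h3, if_false] at this
        exact absurd this (by decide)

/-- Parseval for characters on (ZMod 3)^X. The pairs giving one character are a pair and its swap,
so grouping them costs at most a factor 2. -/
lemma sum_norm_sq_sum_cubic_le (a : X × X → ℂ) :
    ∑ k : X → ZMod 3, ‖∑ q : X × X, a q * (cubic (k q.1) * cubic (k q.2))‖ ^ 2 ≤
      Fintype.card (X → ZMod 3) * (2 * ∑ q, ‖a q‖ ^ 2) := by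
  set e : X × X → X → ZMod 3 := fun q => Pi.single q.1 1 + Pi.single q.2 1 with he
  have hchar : ∀ (k : X → ZMod 3) q, cubic (k q.1) * cubic (k q.2) = cubic (∑ x, k x * e q x) := by
    intro k q
    rw [← AddChar.map_add_eq_mul]
    congr 1
    simp [he, mul_add, Finset.sum_add_distrib, Pi.single_apply]
  have hstar : ∀ z : ZMod 3, star (cubic z) = cubic (-z) := fun z =>
    (AddChar.map_neg_eq_conj cubic z).symm
  have hC : ((∑ k : X → ZMod 3,
      ‖∑ q : X × X, a q * (cubic (k q.1) * cubic (k q.2))‖ ^ 2 : ℝ) : ℂ) =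
      ∑ q, ∑ q', Fintype.card (X → ZMod 3) * (if e q = e q' then a q * star (a q') else 0) := by
    have h1 : ∀ k : X → ZMod 3,
        ((‖∑ q : X × X, a q * (cubic (k q.1) * cubic (k q.2))‖ ^ 2 : ℝ) : ℂ) =
        ∑ q, ∑ q', a q * star (a q') * cubic (∑ x, k x * (e q - e q') x) := by
      intro k
      rw [Complex.ofReal_pow, ← Complex.mul_conj', ← Complex.star_def, star_sum,
        Finset.sum_mul_sum]
      refine Finset.sum_congr rfl fun q _ => Finset.sum_congr rfl fun q' _ => ?_
      rw [star_mul', hchar, hchar, hstar]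
      simp only [Pi.sub_apply, mul_sub]
      rw [Finset.sum_sub_distrib, sub_eq_add_neg, AddChar.map_add_eq_mul]
      ring
    rw [Complex.ofReal_sum]
    simp_rw [h1]
    rw [Finset.sum_comm]
    refine Finset.sum_congr rfl fun q _ => ?_
    rw [Finset.sum_comm]
    refine Finset.sum_congr rfl fun q' _ => ?_
    rw [← Finset.mul_sum, sum_cubic]
    simp only [sub_eq_zero]
    split_ifs <;> ring
  have hfib : ∀ q, ∑ q', (if e q = e q' then ‖a q'‖ ^ 2 else 0) ≤ ‖a q‖ ^ 2 + ‖a q.swap‖ ^ 2 := by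
    intro q
    have h2 : ∀ q', (if e q = e q' then ‖a q'‖ ^ 2 else 0) ≤
        (if q' = q then ‖a q'‖ ^ 2 else 0) + (if q' = q.swap then ‖a q'‖ ^ 2 else 0) := by
      intro q'
      split_ifs with h3 h4 h5 h5 h4 h5 h5
      all_goals first | positivity | skip
      · linarith [sq_nonneg ‖a q'‖]
      · linarith
      · linarith
      · exact absurd (single_add_single_eq h3) (by
          rintro (h | h)
          · exact h4 h
          · exact h5 h)
    refine (Finset.sum_le_sum fun q' _ => h2 q').trans ?_
    rw [Finset.sum_add_distrib]
    simp
  have hfib' : ∑ q, ∑ q', (if e q = e q' then ‖a q'‖ ^ 2 else 0) ≤ 2 * ∑ q, ‖a q‖ ^ 2 := by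
    refine (Finset.sum_le_sum fun q _ => hfib q).trans ?_
    rw [Finset.sum_add_distrib, two_mul]
    refine add_le_add le_rfl (le_of_eq ?_)
    exact Equiv.sum_comp (Equiv.prodComm X X) fun q => ‖a q‖ ^ 2
  have hle := Complex.re_le_norm ((∑ k : X → ZMod 3,
      ‖∑ q : X × X, a q * (cubic (k q.1) * cubic (k q.2))‖ ^ 2 : ℝ) : ℂ)
  rw [Complex.ofReal_re, hC] at hle
  refine hle.trans ?_
  -- Cross terms are split by 2|a||b| ≤ |a|² + |b|², symmetrically, so that either half reduces to
  -- the fibre bound `hfib'`.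
  have hn : ∀ q q', ‖(Fintype.card (X → ZMod 3) : ℂ) *
      (if e q = e q' then a q * star (a q') else 0)‖ ≤ Fintype.card (X → ZMod 3) *
      ((if e q = e q' then ‖a q'‖ ^ 2 else 0) / 2 + (if e q' = e q then ‖a q‖ ^ 2 else 0) / 2) := by
    intro q q'
    rw [norm_mul, Complex.norm_natCast]
    refine mul_le_mul_of_nonneg_left ?_ (Nat.cast_nonneg _)
    by_cases h : e q = e q'
    · rw [if_pos h, if_pos h, if_pos h.symm, norm_mul, norm_star]
      nlinarith [sq_nonneg (‖a q‖ - ‖a q'‖)]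
    · simp [h, Ne.symm h]
  refine (norm_sum_le _ _).trans ((Finset.sum_le_sum fun q _ => (norm_sum_le _ _).trans
    (Finset.sum_le_sum fun q' _ => hn q q')).trans ?_)
  simp only [← Finset.mul_sum, Finset.sum_add_distrib, ← Finset.sum_div]
  refine mul_le_mul_of_nonneg_left ?_ (Nat.cast_nonneg _)
  have h5 : ∑ q, ∑ q', (if e q' = e q then ‖a q‖ ^ 2 else 0) =
      ∑ q, ∑ q', (if e q = e q' then ‖a q'‖ ^ 2 else 0) := Finset.sum_comm
  rw [h5]
  linarith

end

/-! ### The Hadamard transform with random phases -/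

/-- The one-qubit Hadamard matrix. -/
def hadOne : Matrix (ZMod 2) (ZMod 2) ℂ :=
  Matrix.of fun a b => ((Real.sqrt 2 : ℝ) : ℂ)⁻¹ * if a = 1 ∧ b = 1 then -1 else 1

lemma hadOne_mem : hadOne ∈ Matrix.unitaryGroup (ZMod 2) ℂ := by
  have h2 : ((Real.sqrt 2 : ℝ) : ℂ)⁻¹ * ((Real.sqrt 2 : ℝ) : ℂ)⁻¹ = 1 / 2 := by
    rw [← mul_inv, ← Complex.ofReal_mul, Real.mul_self_sqrt (by norm_num)]
    norm_num
  rw [Matrix.mem_unitaryGroup_iff]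
  have hu : (Finset.univ : Finset (ZMod 2)) = {0, 1} := rfl
  have h01 : (0 : ZMod 2) ≠ 1 := by decide
  ext a b
  rw [Matrix.mul_apply, hu, Finset.sum_pair h01]
  have hab : ∀ c : ZMod 2, c = 0 ∨ c = 1 := by decide
  rcases hab a with rfl | rfl <;> rcases hab b with rfl | rfl <;>
    simp [hadOne, Matrix.star_apply, h2] <;> norm_num

lemma norm_hadOne (a b : ZMod 2) : ‖hadOne a b‖ ^ 2 = 1 / 2 := by
  have h : ‖(if a = 1 ∧ b = 1 then -1 else 1 : ℂ)‖ = 1 := by split_ifs <;> simp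
  simp only [hadOne, Matrix.of_apply]
  rw [norm_mul, h, mul_one, norm_inv, Complex.norm_real, Real.norm_eq_abs, inv_pow, sq_abs,
    Real.sq_sqrt (by norm_num)]
  norm_num

/-- The Hadamard transform on `n` qubits. -/
def had (n : ℕ) : Matrix (BitString n) (BitString n) ℂ := tensor fun _ => hadOne

lemma norm_had (n : ℕ) (x y : BitString n) : ‖had n x y‖ ^ 2 = ((2 : ℝ) ^ n)⁻¹ := by
  simp only [had, tensor, Matrix.of_apply, norm_prod, ← Finset.prod_pow, norm_hadOne]
  simp

/-- The Hadamard transform after the diagonal matrix with phases `k`. -/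
def hadPhase {n : ℕ} (k : BitString n → ZMod 3) : Matrix.unitaryGroup (BitString n) ℂ :=
  ⟨had n * Matrix.diagonal fun x => cubic (k x), mul_mem
    (tensor_mem_unitaryGroup fun _ => hadOne_mem) (by
      rw [Matrix.mem_unitaryGroup_iff, Matrix.star_eq_conjTranspose,
        Matrix.diagonal_conjTranspose, Matrix.diagonal_mul_diagonal, ← Matrix.diagonal_one]
      congr 1
      funext x
      rw [Pi.star_apply, Complex.star_def, Complex.mul_conj', norm_cubic]
      simp)⟩

lemma hadPhase_apply {n : ℕ} (k : BitString n → ZMod 3) (x y : BitString n) :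
    (hadPhase k).1 x y = had n x y * cubic (k y) := by
  simp [hadPhase, Matrix.mul_diagonal]

/-! ### Collisions after a random twirl -/

section
variable {I κ : Type*} [Fintype I] [DecidableEq I] [Fintype κ] [DecidableEq κ]

lemma sum_eq_sum_update_update {A : Type*} [AddCommMonoid A] {a b : I} (hab : a ≠ b) (o : κ)
    (G : (I → κ) → A) :
    ∑ g, G g = ∑ g : I → κ, if g a = o ∧ g b = o then
      ∑ u, ∑ v, G (Function.update (Function.update g a u) b v) else 0 := by
  rw [sum_eq_sum_update b o, sum_eq_sum_update a o]
  refine Finset.sum_congr rfl fun g _ => ?_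
  simp only [Function.update_of_ne hab.symm, ite_and]
  split_ifs <;> simp

lemma tensor_pair_mulVec {a b : I} (hab : a ≠ b) (M : I → Matrix κ κ ℂ) (c : (I → κ) → ℂ)
    (g : I → κ) :
    (tensor (fun i => if i = a ∨ i = b then M i else 1) *ᵥ c) g =
      ∑ q : κ × κ, M a (g a) q.1 * M b (g b) q.2 *
        c (Function.update (Function.update g a q.1) b q.2) := by
  symm
  refine Fintype.sum_of_injective
    (fun q : κ × κ => Function.update (Function.update g a q.1) b q.2) ?_ _ _ ?_ ?_
  · rintro ⟨u, v⟩ ⟨u', v'⟩ h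
    have h1 := congrFun h a
    have h2 := congrFun h b
    simp [Function.update_of_ne hab] at h1 h2
    rw [h1, h2]
  · intro h hh
    have : ∃ i, i ≠ a ∧ i ≠ b ∧ g i ≠ h i := by
      by_contra hne
      push Not at hne
      refine hh ⟨(h a, h b), ?_⟩
      funext i
      by_cases h1 : i = b
      · subst h1; simp
      · by_cases h2 : i = a
        · subst h2; simp [h1]
        · simp [h1, h2, hne i h2 h1]
    obtain ⟨i, h1, h2, h3⟩ := this
    refine mul_eq_zero_of_left (Finset.prod_eq_zero (Finset.mem_univ i) ?_) _
    simp [h1, h2, h3]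
  · rintro ⟨u, v⟩
    congr 1
    simp only [tensor, Matrix.of_apply]
    rw [Fintype.prod_eq_mul a b hab]
    · simp [Function.update_of_ne hab]
    · rintro i ⟨h1, h2⟩
      rw [if_neg (by tauto), Function.update_of_ne h2, Function.update_of_ne h1,
        Matrix.one_apply_eq]

/-- The factors away from `a` and `b` are unitary and commute with the projection onto the event, so
they do not affect its weight. -/
lemma sum_tensor_eq_sum_tensor_pair {a b : I} {M : I → Matrix κ κ ℂ}
    (hM : ∀ i, M i ∈ Matrix.unitaryGroup κ ℂ) (Q : κ → κ → Prop) [∀ u v, Decidable (Q u v)]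
    (c : (I → κ) → ℂ) :
    ∑ g, (if Q (g a) (g b) then ‖(tensor M *ᵥ c) g‖ ^ 2 else 0) =
      ∑ g, if Q (g a) (g b) then
        ‖(tensor (fun i => if i = a ∨ i = b then M i else 1) *ᵥ c) g‖ ^ 2 else 0 := by
  set P : I → Matrix κ κ ℂ := fun i => if i = a ∨ i = b then M i else 1 with hP
  set R : I → Matrix κ κ ℂ := fun i => if i = a ∨ i = b then 1 else M i with hR
  have hRP : tensor M = tensor R * tensor P := by
    rw [tensor_mul]
    congr 1
    funext i
    simp only [hR, hP]
    split_ifs <;> simp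
  have hRu : tensor R ∈ Matrix.unitaryGroup (I → κ) ℂ := tensor_mem_unitaryGroup fun i => by
    simp only [hR]
    split_ifs
    · exact one_mem _
    · exact hM i
  have hite : ∀ v : (I → κ) → ℂ, ∑ g, (if Q (g a) (g b) then ‖v g‖ ^ 2 else 0) =
      ∑ g, ‖(fun g => if Q (g a) (g b) then v g else 0) g‖ ^ 2 := by
    intro v
    refine Finset.sum_congr rfl fun g _ => ?_
    by_cases h : Q (g a) (g b) <;> simp [h]
  rw [hite, hite]
  refine Eq.trans ?_ (sum_norm_sq_mulVec hRu _)
  rw [hRP, ← Matrix.mulVec_mulVec]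
  refine Finset.sum_congr rfl fun g _ => ?_
  congr 2
  simp only [Matrix.mulVec, dotProduct]
  have hz : ∀ h : I → κ, tensor R g h ≠ 0 → g a = h a ∧ g b = h b := by
    intro h hne
    have hne' := Finset.prod_ne_zero_iff.1 hne
    constructor
    · by_contra hab
      exact hne' a (Finset.mem_univ _) (by simp [hR, hab])
    · by_contra hab
      exact hne' b (Finset.mem_univ _) (by simp [hR, hab])
  split_ifs with hQ
  · refine Finset.sum_congr rfl fun h _ => ?_
    by_cases h0 : tensor R g h = 0
    · simp [h0]
    · rw [if_pos]
      rw [← (hz h h0).1, ← (hz h h0).2]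
      exact hQ
  · symm
    refine Finset.sum_eq_zero fun h _ => ?_
    by_cases h0 : tensor R g h = 0
    · simp [h0]
    · rw [if_neg, mul_zero]
      rw [← (hz h h0).1, ← (hz h h0).2]
      exact hQ

end

section
variable {n m : ℕ}

/-- The partial twirl on the recorded inputs. -/
abbrev twirl (k : BitString n → ZMod 3) : Fin 2 → Matrix.unitaryGroup (BitString n) ℂ :=
  fun _ => hadPhase k

/-- For a fixed common value z, the amplitude is a sum over former inputs (u, v) with phases ω^(k u
+ k v) and Hadamard coefficients of squared modulus 1/N each. Averaging over k gives at most 2/N²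
times the former weight, and there are N values of z. -/
lemma sum_twirl_collision_le {a b : Fin 2 × BitString n} (hab : a ≠ b) (c : PFun n → ℂ) :
    ∑ k : BitString n → ZMod 3, ∑ g : PFun n, (if (∃ z, g a = some z ∧ g b = some z) then
        ‖(onRec (fun j => (twirl k j).1) *ᵥ c) g‖ ^ 2 else 0) ≤
      Fintype.card (BitString n → ZMod 3) * (2 / 2 ^ n *
        ∑ h : PFun n, if h a ≠ none ∧ h b ≠ none then ‖c h‖ ^ 2 else 0) := by
  classical
  set K : ℝ := ((Fintype.card (BitString n → ZMod 3) : ℕ) : ℝ)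
  set F : PFun n → ℝ := fun g => ∑ q : BitString n × BitString n,
    ‖c (Function.update (Function.update g a (some q.1)) b (some q.2))‖ ^ 2 with hF
  have h1 : ∀ k : BitString n → ZMod 3,
      ∑ g : PFun n, (if (∃ z, g a = some z ∧ g b = some z) then
        ‖(onRec (fun j => (twirl k j).1) *ᵥ c) g‖ ^ 2 else 0) =
      ∑ g : PFun n, if (∃ z, g a = some z ∧ g b = some z) then
        ‖∑ q : Option (BitString n) × Option (BitString n),
          liftOpt (hadPhase k).1 (g a) q.1 * liftOpt (hadPhase k).1 (g b) q.2 *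
          c (Function.update (Function.update g a q.1) b q.2)‖ ^ 2 else 0 := by
    intro k
    rw [onRec, sum_tensor_eq_sum_tensor_pair
      (fun i => liftOpt_mem_unitaryGroup (hadPhase k).2) fun u v => ∃ z, u = some z ∧ v = some z]
    simp_rw [tensor_pair_mulVec hab]
  simp_rw [h1]
  rw [Finset.sum_comm]
  have h2 : ∀ g : PFun n, ∑ k : BitString n → ZMod 3,
      (if (∃ z, g a = some z ∧ g b = some z) then
        ‖∑ q : Option (BitString n) × Option (BitString n),
          liftOpt (hadPhase k).1 (g a) q.1 * liftOpt (hadPhase k).1 (g b) q.2 *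
          c (Function.update (Function.update g a q.1) b q.2)‖ ^ 2 else 0) ≤
      if (∃ z, g a = some z ∧ g b = some z) then K * (2 * (((2 ^ n)⁻¹) ^ 2 * F g)) else 0 := by
    intro g
    split_ifs with hg
    · obtain ⟨z, hza, hzb⟩ := hg
      have h3 : ∀ k : BitString n → ZMod 3,
          ∑ q : Option (BitString n) × Option (BitString n),
            liftOpt (hadPhase k).1 (g a) q.1 * liftOpt (hadPhase k).1 (g b) q.2 *
            c (Function.update (Function.update g a q.1) b q.2) =
          ∑ q : BitString n × BitString n, (had n z q.1 * had n z q.2 *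
            c (Function.update (Function.update g a (some q.1)) b (some q.2))) *
              (cubic (k q.1) * cubic (k q.2)) := by
        intro k
        rw [hza, hzb, Fintype.sum_prod_type, Fintype.sum_option, Fintype.sum_prod_type]
        simp only [liftOpt_some_none, zero_mul, Finset.sum_const_zero, zero_add,
          Fintype.sum_option, mul_zero, liftOpt_some_some, hadPhase_apply]
        refine Finset.sum_congr rfl fun u _ => Finset.sum_congr rfl fun v _ => ?_
        ring
      simp_rw [h3]
      refine (sum_norm_sq_sum_cubic_le _).trans (le_of_eq ?_)
      congr 2
      rw [hF, Finset.mul_sum]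
      refine Finset.sum_congr rfl fun q _ => ?_
      rw [norm_mul, norm_mul, mul_pow, mul_pow, norm_had, norm_had]
      ring
    · simp
  refine (Finset.sum_le_sum fun g _ => h2 g).trans (le_of_eq ?_)
  have hF' : ∀ (g : PFun n) u v, F (Function.update (Function.update g a u) b v) = F g := by
    intro g u v
    simp only [hF]
    refine Finset.sum_congr rfl fun q _ => ?_
    congr 3
    funext i
    by_cases hb : i = b
    · subst hb; simp
    · by_cases ha : i = a
      · subst ha; simp [hb]
      · simp [ha, hb]
  refine (sum_eq_sum_update_update hab none _).trans ?_
  have hR := sum_eq_sum_update_update hab none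
    fun h : PFun n => if h a ≠ none ∧ h b ≠ none then ‖c h‖ ^ 2 else 0
  rw [hR, Finset.mul_sum, Finset.mul_sum]
  refine Finset.sum_congr rfl fun g _ => ?_
  split_ifs
  · simp only [Function.update_of_ne hab, Function.update_self, hF']
    have h4 : ∀ A : ℝ, ∑ u : Option (BitString n), ∑ v : Option (BitString n),
        (if (∃ z, u = some z ∧ v = some z) then A else 0) = 2 ^ n * A := by
      intro A
      simp only [Fintype.sum_option]
      simp
    rw [h4]
    have h5 : ∑ u : Option (BitString n), ∑ v : Option (BitString n),
        (if u ≠ none ∧ v ≠ none then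
          ‖c (Function.update (Function.update g a u) b v)‖ ^ 2 else 0) = F g := by
      simp only [Fintype.sum_option, hF, Fintype.sum_prod_type]
      simp
    rw [h5]
    field_simp
  · simp

/-- A partial function that is injective in each of its two blocks. -/
def BlockInj (g : PFun n) : Prop :=
  ∀ j y y' x, g (j, y) = some x → g (j, y') = some x → y = y'

open Classical in
/-- The weight of a state on partial functions that are not injective. -/
def collision (ψ : (BitString n × BitString m) × PFun n → ℂ) : ℝ :=
  ∑ p, if BlockInj p.2 then 0 else ‖ψ p‖ ^ 2

/-- The number of recorded pairs. -/
def size (g : PFun n) : ℕ := (supp g 0).card + (supp g 1).card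

/-- Union bound over ordered pairs of distinct positions in the same block. Those with both entries
filled number at most |g_0|² + |g_1|² ≤ t². -/
lemma sum_collision_twirl_le {t : ℕ} (ψ : (BitString n × BitString m) × PFun n → ℂ)
    (hψ : ∀ p, ψ p ≠ 0 → size p.2 = t) :
    ∑ k : BitString n → ZMod 3, collision (applyRec (onRec fun j => (twirl k j).1) ψ) ≤
      Fintype.card (BitString n → ZMod 3) * (2 * t ^ 2 / 2 ^ n * l2 ψ ^ 2) := by
  classical
  set T : Finset (Fin 2 × BitString n × BitString n) :=
    Finset.univ.filter fun s => s.2.1 ≠ s.2.2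
  set K : ℝ := ((Fintype.card (BitString n → ZMod 3) : ℕ) : ℝ) with hK
  have h1 : ∀ (χ : (BitString n × BitString m) × PFun n → ℂ), collision χ ≤
      ∑ p, ∑ s ∈ T, ∑ g : PFun n, if (∃ z, g (s.1, s.2.1) = some z ∧ g (s.1, s.2.2) = some z)
        then ‖χ (p, g)‖ ^ 2 else 0 := by
    intro χ
    unfold collision
    rw [Fintype.sum_prod_type (α₁ := BitString n × BitString m)]
    refine Finset.sum_le_sum fun p _ => ?_
    rw [Finset.sum_comm]
    refine Finset.sum_le_sum fun g _ => ?_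
    have hnn : ∀ s ∈ T, 0 ≤ if (∃ z, g (s.1, s.2.1) = some z ∧ g (s.1, s.2.2) = some z)
        then ‖χ (p, g)‖ ^ 2 else 0 := by
      intro s _
      split_ifs
      · positivity
      · exact le_rfl
    split_ifs with hg
    · exact Finset.sum_nonneg hnn
    · unfold BlockInj at hg
      push Not at hg
      obtain ⟨j, y, y', x, hy, hy', hne⟩ := hg
      have := Finset.single_le_sum hnn (a := (j, y, y'))
        (Finset.mem_filter.2 ⟨Finset.mem_univ _, hne⟩)
      simp only at this
      rwa [if_pos ⟨x, hy, hy'⟩] at this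
  have h2 : ∑ k : BitString n → ZMod 3, collision (applyRec (onRec fun j => (twirl k j).1) ψ) ≤
      ∑ p, ∑ s ∈ T, K * (2 / 2 ^ n * ∑ h : PFun n,
        if h (s.1, s.2.1) ≠ none ∧ h (s.1, s.2.2) ≠ none then ‖ψ (p, h)‖ ^ 2 else 0) := by
    refine (Finset.sum_le_sum fun k _ => h1 _).trans ?_
    rw [Finset.sum_comm]
    refine Finset.sum_le_sum fun p _ => ?_
    rw [Finset.sum_comm]
    refine Finset.sum_le_sum fun s hs => ?_
    refine sum_twirl_collision_le ?_ fun h => ψ (p, h)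
    intro h
    exact (Finset.mem_filter.1 hs).2 (Prod.ext_iff.1 h).2
  refine h2.trans ?_
  simp only [← Finset.mul_sum]
  rw [mul_div_right_comm, mul_assoc]
  refine mul_le_mul_of_nonneg_left (mul_le_mul_of_nonneg_left ?_ (by positivity)) (by positivity)
  rw [l2_sq, Fintype.sum_prod_type (α₁ := BitString n × BitString m), Finset.mul_sum]
  refine Finset.sum_le_sum fun p _ => ?_
  rw [Finset.sum_comm, Finset.mul_sum]
  refine Finset.sum_le_sum fun h _ => ?_
  by_cases h0 : ψ (p, h) = 0
  · simp [h0]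
  rw [← Finset.sum_filter, Finset.sum_const, nsmul_eq_mul]
  refine mul_le_mul_of_nonneg_right ?_ (by positivity)
  have h3 : (T.filter fun s => h (s.1, s.2.1) ≠ none ∧ h (s.1, s.2.2) ≠ none).card ≤
      (supp h 0).card ^ 2 + (supp h 1).card ^ 2 := by
    have h4 : (T.filter fun s => h (s.1, s.2.1) ≠ none ∧ h (s.1, s.2.2) ≠ none) ⊆
        (Finset.univ : Finset (Fin 2)).biUnion fun j => {j} ×ˢ (supp h j ×ˢ supp h j) := by
      rintro ⟨j, y, y'⟩ hs
      have := (Finset.mem_filter.1 hs).2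
      simp [mem_supp, this.1, this.2]
    refine ((Finset.card_le_card h4).trans Finset.card_biUnion_le).trans (le_of_eq ?_)
    simp only [Fin.sum_univ_two, Finset.card_product, Finset.card_singleton, one_mul, sq]
  have h5 := hψ _ h0
  simp only [size] at h5
  have h6 : (supp h 0).card ^ 2 + (supp h 1).card ^ 2 ≤ t ^ 2 := by
    rw [← h5, add_sq]
    nlinarith [Nat.zero_le ((supp h 0).card * (supp h 1).card)]
  exact_mod_cast h3.trans h6

end

/-! ### Counting permutations that extend a partial injection -/

section
variable {X : Type*} [Fintype X] [DecidableEq X]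

lemma exists_perm_extend (γ : X → Option X)
    (hγ : ∀ y y' x, γ y = some x → γ y' = some x → y = y') :
    ∃ σ : Equiv.Perm X, ∀ y x, γ y = some x → σ x = y := by
  classical
  have hd : ∀ y : {y // γ y ≠ none}, ∃ x, γ y.1 = some x := fun y =>
    Option.ne_none_iff_exists'.1 y.2
  choose φx hφx using hd
  have hbij : Function.Bijective
      (fun y : {y // γ y ≠ none} => (⟨φx y, y.1, hφx y⟩ : {x // ∃ y, γ y = some x})) := by
    constructor
    · intro y y' h
      have h1 : φx y = φx y' := congrArg Subtype.val h
      exact Subtype.ext (hγ _ _ _ (hφx y) (h1 ▸ hφx y'))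
    · rintro ⟨x, y, hy⟩
      refine ⟨⟨y, by rw [hy]; simp⟩, Subtype.ext ?_⟩
      have := hφx ⟨y, by rw [hy]; simp⟩
      exact (Option.some_injective _ (hy.symm.trans this)).symm
  set e := (Equiv.ofBijective _ hbij).symm with he
  refine ⟨e.extendSubtype, fun y x hy => ?_⟩
  rw [Equiv.extendSubtype_apply_of_mem e x ⟨y, hy⟩]
  have : e ⟨x, y, hy⟩ = ⟨y, by rw [hy]; simp⟩ := by
    rw [he, Equiv.symm_apply_eq]
    refine Subtype.ext ?_
    have := hφx ⟨y, by rw [hy]; simp⟩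
    exact Option.some_injective _ (hy.symm.trans this)
  rw [this]

open Classical in
-- Translating by one extension identifies all extensions with the permutations fixing the k
-- prescribed outputs, of which there are (N - k)!.
lemma card_perm_extend_mul (γ : X → Option X)
    (hγ : ∀ y y' x, γ y = some x → γ y' = some x → y = y') :
    (Finset.univ.filter fun σ : Equiv.Perm X => ∀ y x, γ y = some x → σ x = y).card *
      (Fintype.card X).descFactorial (Finset.univ.filter fun y => γ y ≠ none).card =
      (Fintype.card X)! := by
  obtain ⟨σ₀, hσ₀⟩ := exists_perm_extend γ hγ
  have e1 : {σ : Equiv.Perm X // ∀ y x, γ y = some x → σ x = y} ≃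
      {σ : Equiv.Perm X // ∀ y, ¬(γ y = none) → σ y = y} :=
    { toFun := fun σ => ⟨σ.1 * σ₀⁻¹, fun y hy => by
        obtain ⟨x, hx⟩ := Option.ne_none_iff_exists'.1 hy
        rw [Equiv.Perm.mul_apply, Equiv.Perm.inv_eq_iff_eq.2 (hσ₀ y x hx).symm]
        exact σ.2 y x hx⟩
      invFun := fun σ => ⟨σ.1 * σ₀, fun y x hx => by
        rw [Equiv.Perm.mul_apply, hσ₀ y x hx]
        exact σ.2 y (by rw [hx]; simp)⟩
      left_inv := fun σ => by simp
      right_inv := fun σ => by simp }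
  have e2 := e1.trans (Equiv.Perm.subtypeEquivSubtypePerm fun y => γ y = none).symm
  rw [← Fintype.card_subtype, Fintype.card_congr e2, Fintype.card_perm]
  have h1 := Finset.card_filter_add_card_filter_not (s := (Finset.univ : Finset X))
    (fun y => γ y = none)
  rw [Finset.card_univ] at h1
  rw [Fintype.card_subtype, show (Finset.univ.filter fun y => γ y = none).card =
    Fintype.card X - (Finset.univ.filter fun y => γ y ≠ none).card by
      simp only [ne_eq]; omega]
  exact Nat.factorial_mul_descFactorial (Finset.card_le_univ _)

end

/-! ### Permutations with random signs -/

section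
variable {n m : ℕ}

/-- The permutation matrix of `σ` with signs `s`. -/
def signedPerm (σ : Equiv.Perm (BitString n)) (s : BitString n → ℤˣ) :
    Matrix.unitaryGroup (BitString n) ℂ :=
  ⟨Matrix.of fun y x => if x = σ.symm y then ((s x : ℤ) : ℂ) else 0, by
    rw [Matrix.mem_unitaryGroup_iff]
    ext y y'
    simp only [Matrix.mul_apply, Matrix.star_apply, Matrix.of_apply, ite_mul, zero_mul,
      Finset.sum_ite_eq', Finset.mem_univ, if_true, Matrix.one_apply,
      EmbeddingLike.apply_eq_iff_eq]
    split_ifs with h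
    · rcases Int.units_eq_one_or (s (σ.symm y)) with h | h <;> simp [h]
    · simp⟩

/-- The character `f ↦ ∏_{i ∈ S} f i`. -/
def chi (S : Finset (Fin 2 × BitString n)) (f : Fin 2 × BitString n → ℤˣ) : ℂ :=
  ∏ i ∈ S, ((f i : ℤ) : ℂ)

lemma star_chi (S : Finset (Fin 2 × BitString n)) (f : Fin 2 × BitString n → ℤˣ) :
    star (chi S f) = chi S f := by
  simp [chi]

lemma sq_units_cast (u : ℤˣ) : ((u : ℤ) : ℂ) * ((u : ℤ) : ℂ) = 1 := by
  rcases Int.units_eq_one_or u with h | h <;> simp [h]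

lemma symmDiff_singleton_of_mem {α : Type*} [DecidableEq α] {S : Finset α} {i : α} (h : i ∈ S) :
    symmDiff S {i} = S.erase i := by
  ext a
  simp only [Finset.mem_symmDiff, Finset.mem_singleton, Finset.mem_erase]
  constructor
  · rintro (⟨h1, h2⟩ | ⟨rfl, h2⟩)
    · exact ⟨h2, h1⟩
    · exact absurd h h2
  · exact fun h1 => Or.inl ⟨h1.2, h1.1⟩

lemma symmDiff_singleton_of_notMem {α : Type*} [DecidableEq α] {S : Finset α} {i : α}
    (h : i ∉ S) : symmDiff S {i} = insert i S := by
  ext a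
  simp only [Finset.mem_symmDiff, Finset.mem_singleton, Finset.mem_insert]
  constructor
  · rintro (⟨h1, -⟩ | ⟨h1, -⟩)
    · exact Or.inr h1
    · exact Or.inl h1
  · rintro (rfl | h1)
    · exact Or.inr ⟨rfl, h⟩
    · exact Or.inl ⟨h1, fun h2 => h (h2 ▸ h1)⟩

lemma chi_symmDiff (S : Finset (Fin 2 × BitString n)) (i : Fin 2 × BitString n)
    (f : Fin 2 × BitString n → ℤˣ) :
    chi (symmDiff S {i}) f = ((f i : ℤ) : ℂ) * chi S f := by
  by_cases h : i ∈ S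
  · rw [symmDiff_singleton_of_mem h, chi, chi, ← Finset.mul_prod_erase S _ h, ← mul_assoc,
      sq_units_cast, one_mul]
  · rw [symmDiff_singleton_of_notMem h, chi, chi, Finset.prod_insert h]

lemma sum_chi_mul (S T : Finset (Fin 2 × BitString n)) :
    ∑ f, chi S f * chi T f =
      if S = T then (Fintype.card (Fin 2 × BitString n → ℤˣ) : ℂ) else 0 := by
  split_ifs with h
  · subst h
    have : ∀ f, chi S f * chi S f = 1 := fun f => by
      rw [chi, ← Finset.prod_mul_distrib]
      exact Finset.prod_eq_one fun i _ => sq_units_cast _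
    simp [this]
  · have h1 : ∀ f, chi S f * chi T f = ∏ i, ((if i ∈ S then ((f i : ℤ) : ℂ) else 1) *
        if i ∈ T then ((f i : ℤ) : ℂ) else 1) := by
      intro f
      rw [Finset.prod_mul_distrib, Finset.prod_ite_mem, Finset.prod_ite_mem, Finset.univ_inter,
        Finset.univ_inter]
      rfl
    simp_rw [h1]
    have h2 := Finset.prod_univ_sum (fun _ : Fin 2 × BitString n => (Finset.univ : Finset ℤˣ))
      (fun i e => (if i ∈ S then ((e : ℤ) : ℂ) else 1) * if i ∈ T then ((e : ℤ) : ℂ) else 1)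
    rw [Fintype.piFinset_univ] at h2
    rw [← h2]
    have h3 : ∃ i, ¬(i ∈ S ↔ i ∈ T) := by
      by_contra hne
      push Not at hne
      exact h (Finset.ext hne)
    obtain ⟨i, hi⟩ := h3
    refine Finset.prod_eq_zero (Finset.mem_univ i) ?_
    rw [UnitsInt.univ, Finset.sum_pair (by decide)]
    by_cases hS : i ∈ S <;> by_cases hT : i ∈ T <;> simp_all

/-- A query to a permutation oracle in the Fourier basis of the sign functions. -/
def fourStep (π : Fin 2 → Equiv.Perm (BitString n)) (j : Fin 2)
    (ψ : (BitString n × BitString m) × Finset (Fin 2 × BitString n) → ℂ) :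
    (BitString n × BitString m) × Finset (Fin 2 × BitString n) → ℂ :=
  fun p => ψ (((π j).symm p.1.1, p.1.2), symmDiff p.2 {(j, (π j).symm p.1.1)})

/-- The view for permutation oracles with signs, in the Fourier basis of the sign functions. -/
def Adversary.fourView {t : ℕ} (𝒜 : Adversary n m t) (π : Fin 2 → Equiv.Perm (BitString n)) :
    (BitString n × BitString m) × Finset (Fin 2 × BitString n) → ℂ :=
  Fin.foldl t (fun ψ i => fourStep π (𝒜.query i) (applyLocal (𝒜.unitary i).1 ψ))
    fun p => if p.1 = 0 then (if p.2 = ∅ then 1 else 0) else 0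

/-- The view for two unitary oracles. -/
def Adversary.unitaryView {t : ℕ} (𝒜 : Adversary n m t)
    (C : Fin 2 → Matrix.unitaryGroup (BitString n) ℂ) :
    (BitString n × BitString m) × Unit → ℂ :=
  𝒜.view (unitaryOracle (C 0) (C 1)) fun _ => 1

lemma applyOracle_unitaryOracle (C : Fin 2 → Matrix.unitaryGroup (BitString n) ℂ) (j : Fin 2)
    (ψ : (BitString n × BitString m) × Unit → ℂ) :
    applyOracle (unitaryOracle (C 0) (C 1) j) ψ = applyLocal (onA m (C j).1) ψ := by
  funext p
  rw [applyLocal_onA]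
  simp only [applyOracle, unitaryOracle, Matrix.of_apply, Fintype.sum_prod_type]
  refine Finset.sum_congr rfl fun x _ => ?_
  fin_cases j <;> simp

lemma unitaryView_twist {t : ℕ} (𝒜 : Adversary n m t)
    (C D : Fin 2 → Matrix.unitaryGroup (BitString n) ℂ) :
    (𝒜.twist C).unitaryView D = 𝒜.unitaryView fun j => D j * C j := by
  unfold Adversary.unitaryView Adversary.view
  congr 1
  funext ψ i
  rw [applyOracle_unitaryOracle D, applyOracle_unitaryOracle fun j => D j * C j]
  have h1 : ∀ j, onA m (D j * C j).1 = onA m (D j).1 * onA m (C j).1 := by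
    intro j
    simp [onA, Matrix.kronecker, ← Matrix.mul_kronecker_mul]
  rw [h1, applyLocal_mul, ← applyLocal_mul (onA m (C _).1)]
  rfl

/-- A query on input x to oracle j multiplies by the sign f (j, x), which maps the character of S to
that of S with (j, x) toggled. -/
lemma unitaryView_signedPerm {t : ℕ} (𝒜 : Adversary n m t)
    (π : Fin 2 → Equiv.Perm (BitString n)) (f : Fin 2 × BitString n → ℤˣ) :
    𝒜.unitaryView (fun j => signedPerm (π j) fun x => f (j, x)) =
      fun p => ∑ S, chi S f * 𝒜.fourView π (p.1, S) := by
  unfold Adversary.unitaryView Adversary.view Adversary.fourView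
  refine foldl_rel (fun _ (a : (BitString n × BitString m) × Unit → ℂ)
    (b : (BitString n × BitString m) × Finset (Fin 2 × BitString n) → ℂ) =>
      a = fun p => ∑ S, chi S f * b (p.1, S)) t _ _ _ _ ?_ ?_
  · funext p
    by_cases hp : p.1 = 0 <;> simp [hp, chi]
  · rintro i a b rfl
    rw [applyOracle_unitaryOracle fun j => signedPerm (π j) fun x => f (j, x)]
    have h1 : applyLocal (𝒜.unitary i).1
        (fun p : (BitString n × BitString m) × Unit => ∑ S, chi S f * b (p.1, S)) =
        fun p => ∑ S, chi S f * applyLocal (𝒜.unitary i).1 b (p.1, S) := by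
      funext p
      simp only [applyLocal, Finset.mul_sum]
      rw [Finset.sum_comm]
      refine Finset.sum_congr rfl fun S _ => Finset.sum_congr rfl fun q _ => ?_
      ring
    rw [h1]
    funext p
    rw [applyLocal_onA]
    simp only [signedPerm, Matrix.of_apply, ite_mul, zero_mul, Finset.sum_ite_eq',
      Finset.mem_univ, if_true, fourStep]
    set j := 𝒜.query i
    set x := (π j).symm p.1.1
    have hinv : Function.Involutive
        fun S : Finset (Fin 2 × BitString n) => symmDiff S {(j, x)} := fun S =>
      symmDiff_symmDiff_cancel_right _ _
    rw [← Equiv.sum_comp hinv.toPerm, Finset.mul_sum]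
    refine Finset.sum_congr rfl fun S _ => ?_
    simp only [Function.Involutive.coe_toPerm, chi_symmDiff]
    rw [← mul_assoc, ← mul_assoc, sq_units_cast, one_mul]

end

section
variable {n m : ℕ}

/-! ### Signed permutations against path recording -/

/-- The partial function recorded by the set `S` of queried inputs. -/
def graphOn (π : Fin 2 → Equiv.Perm (BitString n)) (S : Finset (Fin 2 × BitString n)) : PFun n :=
  fun i => if (i.1, (π i.1).symm i.2) ∈ S then some ((π i.1).symm i.2) else none

lemma graphOn_erase (π : Fin 2 → Equiv.Perm (BitString n)) (S : Finset (Fin 2 × BitString n))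
    (j : Fin 2) (y : BitString n) :
    graphOn π (S.erase (j, (π j).symm y)) = Function.update (graphOn π S) (j, y) none := by
  funext ⟨j', y'⟩
  by_cases h : (j', y') = (j, y)
  · rw [h]
    simp [graphOn]
  · rw [Function.update_of_ne h]
    have h1 : (j', (π j').symm y') ≠ (j, (π j).symm y) := by
      intro h2
      rw [Prod.mk.injEq] at h2
      obtain ⟨rfl, h3⟩ := h2
      exact h (by rw [(π j').symm.injective h3])
    simp [graphOn, h1]

lemma card_eq_size_graphOn (π : Fin 2 → Equiv.Perm (BitString n))
    (S : Finset (Fin 2 × BitString n)) : S.card = size (graphOn π S) := by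
  have h1 : ∀ j, (supp (graphOn π S) j).card = ∑ x, if (j, x) ∈ S then 1 else 0 := by
    intro j
    rw [supp, Finset.card_filter, ← Equiv.sum_comp (π j)]
    refine Finset.sum_congr rfl fun x _ => ?_
    simp [graphOn]
  have h2 : S.card = ∑ i, if i ∈ S then 1 else 0 := by simp
  rw [size, h1, h1, h2, Fintype.sum_prod_type, Fin.sum_univ_two]

/-- The normalization `∏_j √(N (N - 1) ⋯ (N - |g_j| + 1))`. -/
def extNorm (g : PFun n) : ℝ :=
  ∏ j, Real.sqrt ((2 ^ n).descFactorial (supp g j).card : ℕ)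

lemma extNorm_sq (g : PFun n) :
    extNorm g ^ 2 = ∏ j, (((2 ^ n).descFactorial (supp g j).card : ℕ) : ℝ) := by
  rw [extNorm, ← Finset.prod_pow]
  exact Finset.prod_congr rfl fun j _ => Real.sq_sqrt (Nat.cast_nonneg _)

/-- Recording one more pair multiplies `extNorm` by √(N - k), which cancels the path-recording
weight. -/
lemma extNorm_mul_prWeight {g : PFun n} {j : Fin 2} {y x : BitString n}
    (h : g (j, y) = some x) :
    extNorm g * prWeight n j (Function.update g (j, y) none) y =
      extNorm (Function.update g (j, y) none) := by
  set g₀ := Function.update g (j, y) none with hg₀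
  have hg : g = Function.update g₀ (j, y) (some x) := by
    rw [hg₀, Function.update_idem, ← h, Function.update_eq_self]
  have hy : g₀ (j, y) = none := by simp [hg₀]
  have h1 : (supp g j).card = (supp g₀ j).card + 1 := by
    rw [hg, supp_update_self, Finset.card_insert_of_notMem]
    simp [mem_supp, hy]
  have h2 : ∀ j' ≠ j, supp g j' = supp g₀ j' := fun j' hj' => by
    rw [hg, supp_update_ne hj']
  have hlt := card_supp_lt hy
  have hpos : (0 : ℝ) < 2 ^ n - (supp g₀ j).card := by
    rw [sub_pos]; exact_mod_cast hlt
  unfold extNorm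
  have hp : ∀ F : Fin 2 → ℝ, ∏ j', F j' = F j * ∏ j' ∈ Finset.univ.erase j, F j' := fun F =>
    (Finset.mul_prod_erase _ _ (Finset.mem_univ j)).symm
  rw [hp, hp]
  have h3 : ∏ j' ∈ Finset.univ.erase j,
      Real.sqrt ((2 ^ n).descFactorial (supp g j').card : ℕ) =
      ∏ j' ∈ Finset.univ.erase j, Real.sqrt ((2 ^ n).descFactorial (supp g₀ j').card : ℕ) :=
    Finset.prod_congr rfl fun j' hj' => by rw [h2 j' (Finset.ne_of_mem_erase hj')]
  rw [h3, h1, Nat.descFactorial_succ, Nat.cast_mul, Nat.cast_sub hlt.le,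
    Real.sqrt_mul (by push_cast; exact hpos.le), prWeight]
  push_cast
  have := (Real.sqrt_pos.2 hpos).ne'
  field_simp

/-- After i queries at most i inputs are toggled, and |S| = i means that all queried inputs were
distinct. On such S the last query must have added its input, so `S` and its graph lose one entry
together and the recursion is that of path recording, up to `extNorm`. -/
lemma fourView_spec {t : ℕ} (𝒜 : Adversary n m t) (π : Fin 2 → Equiv.Perm (BitString n))
    (p : BitString n × BitString m) (S : Finset (Fin 2 × BitString n)) :
    (t < S.card → 𝒜.fourView π (p, S) = 0) ∧
      (S.card = t → 𝒜.fourView π (p, S) =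
        extNorm (graphOn π S) * 𝒜.recView (prWeight n) (p, graphOn π S)) := by
  revert p S
  refine foldl_rel (fun i (a : (BitString n × BitString m) × Finset (Fin 2 × BitString n) → ℂ)
    (b : (BitString n × BitString m) × PFun n → ℂ) =>
      ∀ p S, (i < S.card → a (p, S) = 0) ∧
        (S.card = i → a (p, S) = extNorm (graphOn π S) * b (p, graphOn π S))) t _ _ _ _ ?_ ?_
  · intro p S
    constructor
    · intro h
      have : S ≠ ∅ := Finset.nonempty_iff_ne_empty.1 (Finset.card_pos.1 h)
      simp [this]
    · intro h
      rw [Finset.card_eq_zero] at h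
      subst h
      have h1 : graphOn π ∅ = fun _ => none := by funext i; simp [graphOn]
      have h2 : extNorm (fun _ => none : PFun n) = 1 := by simp [extNorm, supp]
      rw [h1, h2]
      simp [initRec]
  · intro i a b hab
    set U := (𝒜.unitary i).1
    set j := 𝒜.query i
    have hU : ∀ p S, ((i : ℕ) < S.card → applyLocal U a (p, S) = 0) ∧
        (S.card = i → applyLocal U a (p, S) =
          extNorm (graphOn π S) * applyLocal U b (p, graphOn π S)) := by
      intro p S
      constructor
      · intro h
        exact Finset.sum_eq_zero fun q _ => by rw [(hab q S).1 h, mul_zero]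
      · intro h
        simp only [applyLocal, Finset.mul_sum]
        refine Finset.sum_congr rfl fun q _ => ?_
        rw [(hab q S).2 h]
        ring
    rintro ⟨y, b'⟩ S
    simp only [fourStep]
    set x := (π j).symm y with hx
    by_cases hxS : (j, x) ∈ S
    · have h1 := symmDiff_singleton_of_mem hxS
      have h2 := Finset.card_erase_add_one hxS
      rw [h1]
      refine ⟨fun h => (hU _ _).1 (by omega), fun h => ?_⟩
      rw [(hU _ _).2 (by omega), hx, graphOn_erase]
      have h3 : graphOn π S (j, y) = some x := by simp only [graphOn, ← hx, hxS, if_true]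
      simp only [recStep, h3, Option.elim]
      rw [← mul_assoc, ← Complex.ofReal_mul, extNorm_mul_prWeight h3]
    -- Here the query would have removed x from a set larger than the number of earlier queries,
    -- where the amplitude vanishes.
    · have h1 := symmDiff_singleton_of_notMem hxS
      have h2 := Finset.card_insert_of_notMem hxS
      have h3 : graphOn π S (j, y) = none := by simp only [graphOn, ← hx, hxS, if_false]
      rw [h1]
      refine ⟨fun h => (hU _ _).1 (by omega), fun h => ?_⟩
      rw [(hU _ _).1 (by omega)]
      simp [recStep, h3]

/-- `π` extends the partial injections recorded by `g`. -/
def Extends (π : Fin 2 → Equiv.Perm (BitString n)) (g : PFun n) : Prop :=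
  ∀ j y x, g (j, y) = some x → π j x = y

lemma graphOn_eq_iff (π : Fin 2 → Equiv.Perm (BitString n)) (S : Finset (Fin 2 × BitString n))
    (g : PFun n) :
    graphOn π S = g ↔ Extends π g ∧ S = Finset.univ.filter fun i => g (i.1, π i.1 i.2) ≠ none := by
  constructor
  · rintro rfl
    refine ⟨fun j y x h => ?_, ?_⟩
    · simp only [graphOn] at h
      split_ifs at h
      rw [← Option.some_injective _ h, Equiv.apply_symm_apply]
    · ext i
      simp [graphOn]
  · rintro ⟨he, rfl⟩
    funext ⟨j, y⟩
    simp only [graphOn, Finset.mem_filter, Finset.mem_univ, true_and, Equiv.apply_symm_apply]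
    split_ifs with h
    · obtain ⟨x, hx⟩ := Option.ne_none_iff_exists'.1 h
      rw [hx, ← he j y x hx, Equiv.symm_apply_apply]
    · exact (not_not.1 h).symm

open Classical in
-- For block-injective `g` the squared normalization is the inverse of the probability that random
-- permutations extend `g`; otherwise nothing extends `g`.
lemma card_extends_mul_extNorm_sq (g : PFun n) :
    ((Finset.univ.filter fun π : Fin 2 → Equiv.Perm (BitString n) => Extends π g).card : ℝ) *
      extNorm g ^ 2 =
      if BlockInj g then (Fintype.card (Fin 2 → Equiv.Perm (BitString n)) : ℝ) else 0 := by
  split_ifs with hg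
  · have h1 : (Finset.univ.filter fun π : Fin 2 → Equiv.Perm (BitString n) => Extends π g) =
        Fintype.piFinset fun j => Finset.univ.filter fun σ : Equiv.Perm (BitString n) =>
          ∀ y x, g (j, y) = some x → σ x = y := by
      ext π
      simp [Extends, Fintype.mem_piFinset]
    rw [h1, Fintype.card_piFinset, extNorm_sq, Nat.cast_prod, ← Finset.prod_mul_distrib]
    have h2 : ∀ j, (((Finset.univ.filter fun σ : Equiv.Perm (BitString n) =>
        ∀ y x, g (j, y) = some x → σ x = y).card : ℕ) : ℝ) *
        (((2 ^ n).descFactorial (supp g j).card : ℕ) : ℝ) =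
        ((Fintype.card (Equiv.Perm (BitString n)) : ℕ) : ℝ) := by
      intro j
      rw [Fintype.card_perm, ← card_perm_extend_mul (fun y => g (j, y)) (hg j), card_bitString]
      push_cast
      rfl
    rw [Finset.prod_congr rfl fun j _ => h2 j]
    simp
  · have h1 : (Finset.univ.filter fun π : Fin 2 → Equiv.Perm (BitString n) => Extends π g) = ∅ := by
      rw [Finset.filter_eq_empty_iff]
      intro π _ he
      exact hg fun j y y' x hy hy' => (he j y x hy).symm.trans (he j y' x hy')
    simp [h1]

open Classical in
-- For fixed π, the sets S of size t correspond to the functions of size t that π extends.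
-- Exchanging the sums, the count of extensions cancels the normalization.
lemma sum_graphOn {t : ℕ} (Φ : PFun n → ℂ) (hΦ : ∀ g, Φ g ≠ 0 → size g = t) :
    ∑ π : Fin 2 → Equiv.Perm (BitString n), ∑ S with S.card = t,
        ((extNorm (graphOn π S) ^ 2 : ℝ) : ℂ) * Φ (graphOn π S) =
      Fintype.card (Fin 2 → Equiv.Perm (BitString n)) *
        ∑ g, if BlockInj g then Φ g else 0 := by
  have h1 : ∀ π : Fin 2 → Equiv.Perm (BitString n), ∑ S with S.card = t,
      ((extNorm (graphOn π S) ^ 2 : ℝ) : ℂ) * Φ (graphOn π S) =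
      ∑ g, if Extends π g then ((extNorm g ^ 2 : ℝ) : ℂ) * Φ g else 0 := by
    intro π
    rw [← Finset.sum_filter (s := Finset.univ)]
    have hz : ∀ g, size g ≠ t → Φ g = 0 := fun g h => by_contra fun h' => h (hΦ g h')
    rw [← Finset.sum_filter_add_sum_filter_not (Finset.univ.filter fun g => Extends π g)
      (fun g => size g = t)]
    rw [Finset.sum_eq_zero (s := Finset.filter (fun g => ¬size g = t) _), add_zero]
    · refine Finset.sum_nbij' (graphOn π)
        (fun g => Finset.univ.filter fun i => g (i.1, π i.1 i.2) ≠ none) ?_ ?_ ?_ ?_ ?_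
      · intro S hS
        simp only [Finset.mem_filter, Finset.mem_univ, true_and] at hS ⊢
        exact ⟨((graphOn_eq_iff π S _).1 rfl).1, by rw [← card_eq_size_graphOn, hS]⟩
      · intro g hg
        simp only [Finset.mem_filter, Finset.mem_univ, true_and] at hg ⊢
        rw [card_eq_size_graphOn π, (graphOn_eq_iff π _ g).2 ⟨hg.1, rfl⟩, hg.2]
      · intro S _
        exact ((graphOn_eq_iff π S _).1 rfl).2.symm
      · intro g hg
        simp only [Finset.mem_filter, Finset.mem_univ, true_and] at hg
        exact (graphOn_eq_iff π _ g).2 ⟨hg.1, rfl⟩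
      · intro S _
        rfl
    · intro g hg
      rw [hz g (Finset.mem_filter.1 hg).2, mul_zero]
  simp_rw [h1]
  rw [Finset.sum_comm, Finset.mul_sum]
  refine Finset.sum_congr rfl fun g _ => ?_
  rw [← Finset.sum_filter, Finset.sum_const, nsmul_eq_mul, ← mul_assoc]
  have h2 := congrArg (fun r : ℝ => (r : ℂ)) (card_extends_mul_extNorm_sq g)
  simp only [Complex.ofReal_mul, Complex.ofReal_natCast] at h2
  rw [h2]
  by_cases hg : BlockInj g <;> simp [hg]

end

section
variable {n m : ℕ}

/-! ### Sizes and norms of the views -/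

lemma size_update {g : PFun n} {j : Fin 2} {y : BitString n} (x : BitString n)
    (h : g (j, y) = none) : size (Function.update g (j, y) (some x)) = size g + 1 := by
  have hy : y ∉ supp g j := by simp [mem_supp, h]
  unfold size
  fin_cases j
  · simp only [Fin.zero_eta] at hy ⊢
    rw [supp_update_self, supp_update_ne (by simp), Finset.card_insert_of_notMem hy]
    omega
  · simp only [Fin.mk_one] at hy ⊢
    rw [supp_update_self, supp_update_ne (by simp), Finset.card_insert_of_notMem hy]
    omega

/-- Before each query fewer than t pairs are recorded; if t ≤ N a free output remains and the step
preserves the norm. -/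
lemma recView_prWeight_spec {t : ℕ} (𝒜 : Adversary n m t) :
    (∀ p, 𝒜.recView (prWeight n) p ≠ 0 → size p.2 = t) ∧
      (t ≤ 2 ^ n → l2 (𝒜.recView (prWeight n)) = 1) := by
  have key := foldl_ind (fun i (a : (BitString n × BitString m) × PFun n → ℂ) =>
    (∀ p, a p ≠ 0 → size p.2 = i) ∧ (t ≤ 2 ^ n → l2 a = 1)) t
    (fun ψ i => recStep (prWeight n (𝒜.query i)) (𝒜.query i) (applyLocal (𝒜.unitary i).1 ψ))
    (initRec n m) ?_ ?_
  · exact key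
  · refine ⟨fun p hp => ?_, fun _ => l2_initRec⟩
    have h1 : p.2 = fun _ => none := by
      by_contra h
      simp [initRec, h] at hp
    simp [h1, size, supp]
  · rintro i a ⟨h1, h2⟩
    have h1' := applyLocal_support (Q := fun g => size g = i) (𝒜.unitary i).1 h1
    refine ⟨fun p hp => ?_, fun ht => ?_⟩
    · obtain ⟨g, x, y, hgy, hpg, -, q, hq⟩ := exists_of_recStep_ne_zero hp
      rw [hpg, size_update x hgy]
      have := h1' _ hq
      simp only at this
      rw [this]
    · rw [← sq_eq_sq₀ (l2_nonneg _) zero_le_one, ← h2 ht, ← l2_applyLocal (𝒜.unitary i).2 a,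
        l2_sq_recStep, l2_sq]
      refine Finset.sum_congr rfl fun p _ => ?_
      by_cases hp : applyLocal (𝒜.unitary i).1 a p = 0
      · rw [hp, norm_zero]; ring
      · have h3 : size p.2 = i := h1' p hp
        have h4 := i.2
        have h5 : (supp p.2 (𝒜.query i)).card ≤ size p.2 := by
          unfold size
          have : 𝒜.query i = 0 ∨ 𝒜.query i = 1 := by omega
          rcases this with h | h <;> rw [h] <;> omega
        rw [sum_prWeight_sq (by omega), mul_one]

lemma l2_fourStep (π : Fin 2 → Equiv.Perm (BitString n)) (j : Fin 2)
    (ψ : (BitString n × BitString m) × Finset (Fin 2 × BitString n) → ℂ) :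
    l2 (fourStep π j ψ) = l2 ψ := by
  rw [← sq_eq_sq₀ (l2_nonneg _) (l2_nonneg _), l2_sq, l2_sq]
  simp only [Fintype.sum_prod_type (α₁ := BitString n × BitString m),
    Fintype.sum_prod_type (α₁ := BitString n) (α₂ := BitString m)]
  rw [← Equiv.sum_comp (π j)]
  refine Finset.sum_congr rfl fun x _ => Finset.sum_congr rfl fun b _ => ?_
  have hinv : Function.Involutive
      fun S : Finset (Fin 2 × BitString n) => symmDiff S {(j, x)} := fun S =>
    symmDiff_symmDiff_cancel_right _ _
  rw [← Equiv.sum_comp hinv.toPerm]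
  simp [fourStep]

lemma l2_fourView {t : ℕ} (𝒜 : Adversary n m t) (π : Fin 2 → Equiv.Perm (BitString n)) :
    l2 (𝒜.fourView π) = 1 := by
  refine foldl_ind (fun _ a => l2 a = 1) t _ _ ?_ ?_
  · rw [← sq_eq_sq₀ (l2_nonneg _) zero_le_one, l2_sq, Finset.sum_eq_single (0, ∅)]
    · simp
    · rintro ⟨p, S⟩ _ h
      by_cases hp : p = 0
      · have : S ≠ ∅ := fun h' => h (by rw [hp, h'])
        simp [this]
      · simp [hp]
    · simp
  · intro i a h
    rw [l2_fourStep, l2_applyLocal (𝒜.unitary i).2, h]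

/-! ### The trace form on slices -/

/-- The quadratic form of a matrix. -/
def quadForm {ι : Type*} [Fintype ι] (W : Matrix ι ι ℂ) (v : ι → ℂ) : ℂ :=
  ∑ p, star (v p) * (W *ᵥ v) p

lemma trace_mul_reducedState_eq_sum {E : Type} [Fintype E]
    (W : Matrix (BitString n × BitString m) (BitString n × BitString m) ℂ)
    (ψ : (BitString n × BitString m) × E → ℂ) :
    (W * reducedState ψ).trace = ∑ e, quadForm W fun p => ψ (p, e) := by
  rw [trace_mul_reducedState, Fintype.sum_prod_type_right]
  rfl

lemma norm_quadForm_le {ι : Type*} [Fintype ι] [DecidableEq ι] {W : Matrix ι ι ℂ}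
    (hW : W ∈ Matrix.unitaryGroup ι ℂ) (v : ι → ℂ) : ‖quadForm W v‖ ≤ ∑ p, ‖v p‖ ^ 2 := by
  refine (norm_sum_star_mul_le _ _).trans (le_of_eq ?_)
  have : l2 (W *ᵥ v) = l2 v := by
    rw [← sq_eq_sq₀ (l2_nonneg _) (l2_nonneg _), l2_sq, l2_sq, sum_norm_sq_mulVec hW]
  rw [this, ← sq, l2_sq]

lemma quadForm_smul {ι : Type*} [Fintype ι] (W : Matrix ι ι ℂ) (r : ℝ) (v : ι → ℂ) :
    quadForm W (fun p => (r : ℂ) * v p) = ((r ^ 2 : ℝ) : ℂ) * quadForm W v := by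
  have : (fun p => (r : ℂ) * v p) = (r : ℂ) • v := rfl
  rw [this, quadForm, quadForm, Matrix.mulVec_smul, Finset.mul_sum]
  refine Finset.sum_congr rfl fun p _ => ?_
  simp only [Pi.smul_apply, smul_eq_mul, star_mul', Complex.star_def, Complex.conj_ofReal]
  push_cast
  ring

/-- Orthogonality of characters: averaging over the signs is tracing out the register that holds S.
-/
lemma sum_signs_reducedState {t : ℕ} (𝒜 : Adversary n m t)
    (π : Fin 2 → Equiv.Perm (BitString n)) :
    ∑ f : Fin 2 × BitString n → ℤˣ,
        reducedState (𝒜.unitaryView fun j => signedPerm (π j) fun x => f (j, x)) =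
      (Fintype.card (Fin 2 × BitString n → ℤˣ) : ℂ) • reducedState (𝒜.fourView π) := by
  ext p q
  rw [Matrix.sum_apply, Matrix.smul_apply]
  simp only [unitaryView_signedPerm, reducedState, Matrix.of_apply, Finset.univ_unique,
    Finset.sum_singleton, star_sum, star_mul', star_chi, Finset.sum_mul_sum, smul_eq_mul]
  rw [Finset.sum_comm, Finset.mul_sum]
  refine Finset.sum_congr rfl fun S _ => ?_
  rw [Finset.sum_comm]
  have h1 : ∀ T, ∑ f, chi S f * 𝒜.fourView π (p, S) * (chi T f * star (𝒜.fourView π (q, T))) =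
      𝒜.fourView π (p, S) * star (𝒜.fourView π (q, T)) *
        if S = T then (Fintype.card (Fin 2 × BitString n → ℤˣ) : ℂ) else 0 := by
    intro T
    rw [← sum_chi_mul, Finset.mul_sum]
    exact Finset.sum_congr rfl fun f _ => by ring
  simp_rw [h1]
  simp only [mul_ite, mul_zero, Finset.sum_ite_eq, Finset.mem_univ, if_true]
  ring

/-- On average over π, the slices |S| = t reproduce the block-injective part of the path-recording
state exactly. The factor 2 accounts for the two leftovers, the smaller slices and the non-injective
part, which have equal weight because both states are normalized. -/
lemma norm_sum_fourView_sub_le {t : ℕ} (ht : t ≤ 2 ^ n) (𝒜 : Adversary n m t)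
    {W : Matrix (BitString n × BitString m) (BitString n × BitString m) ℂ}
    (hW : W ∈ Matrix.unitaryGroup (BitString n × BitString m) ℂ) :
    ‖∑ π : Fin 2 → Equiv.Perm (BitString n), (W * reducedState (𝒜.fourView π)).trace -
        Fintype.card (Fin 2 → Equiv.Perm (BitString n)) *
          (W * reducedState (𝒜.recView (prWeight n))).trace‖ ≤
      Fintype.card (Fin 2 → Equiv.Perm (BitString n)) *
        (2 * collision (𝒜.recView (prWeight n))) := by
  classical
  set K := Fintype.card (Fin 2 → Equiv.Perm (BitString n)) with hK
  set c := 𝒜.recView (prWeight n) with hc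
  obtain ⟨hsize, hnorm⟩ := recView_prWeight_spec 𝒜
  have htop : ∀ (π : Fin 2 → Equiv.Perm (BitString n)) S, S.card = t →
      (fun p => 𝒜.fourView π (p, S)) =
        fun p => (extNorm (graphOn π S) : ℂ) * c (p, graphOn π S) := fun π S hS => by
    funext p
    exact (fourView_spec 𝒜 π p S).2 hS
  have hs1 : ∑ π : Fin 2 → Equiv.Perm (BitString n), ∑ S with S.card = t,
      quadForm W (fun p => 𝒜.fourView π (p, S)) =
      K * ∑ g, if BlockInj g then quadForm W (fun p => c (p, g)) else 0 := by
    rw [← sum_graphOn (t := t)]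
    · refine Finset.sum_congr rfl fun π _ => Finset.sum_congr rfl fun S hS => ?_
      rw [htop π S (Finset.mem_filter.1 hS).2, quadForm_smul]
    · intro g hg
      obtain ⟨p, -, hp⟩ := Finset.exists_ne_zero_of_sum_ne_zero hg
      exact hsize (p, g) (star_ne_zero.1 (left_ne_zero_of_mul hp))
  have hs2 : ∑ π : Fin 2 → Equiv.Perm (BitString n), ∑ S with S.card = t,
      ∑ p, ‖𝒜.fourView π (p, S)‖ ^ 2 =
      K * ∑ g, if BlockInj g then ∑ p, ‖c (p, g)‖ ^ 2 else 0 := by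
    have h := sum_graphOn (t := t) (fun g => ((∑ p, ‖c (p, g)‖ ^ 2 : ℝ) : ℂ)) (by
      intro g hg
      obtain ⟨p, -, hp⟩ := Finset.exists_ne_zero_of_sum_ne_zero (Complex.ofReal_ne_zero.1 hg)
      exact hsize (p, g) fun h0 => hp (by rw [show c (p, g) = 0 from h0, norm_zero]; ring))
    have hi : ((∑ g, if BlockInj g then ∑ p, ‖c (p, g)‖ ^ 2 else 0 : ℝ) : ℂ) =
        ∑ g, if BlockInj g then ((∑ p, ‖c (p, g)‖ ^ 2 : ℝ) : ℂ) else 0 := by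
      rw [Complex.ofReal_sum]
      exact Finset.sum_congr rfl fun g _ => by by_cases hg : BlockInj g <;> simp [hg]
    rw [← Complex.ofReal_inj, Complex.ofReal_mul, Complex.ofReal_natCast, hi, ← h]
    push_cast
    refine Finset.sum_congr rfl fun π _ => Finset.sum_congr rfl fun S hS => ?_
    rw [Finset.mul_sum]
    refine Finset.sum_congr rfl fun p _ => ?_
    rw [congrFun (htop π S (Finset.mem_filter.1 hS).2) p, norm_mul, Complex.norm_real,
      Real.norm_eq_abs]
    norm_cast
    rw [mul_pow, sq_abs]
  have hcol : collision c = ∑ g, if BlockInj g then 0 else ∑ p, ‖c (p, g)‖ ^ 2 := by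
    unfold collision
    rw [Fintype.sum_prod_type_right]
    refine Finset.sum_congr rfl fun g _ => ?_
    by_cases hg : BlockInj g <;> simp [hg]
  have hone : ∑ g, ∑ p, ‖c (p, g)‖ ^ 2 = 1 := by
    rw [← Fintype.sum_prod_type_right (f := fun q => ‖c q‖ ^ 2), ← l2_sq, hnorm ht, one_pow]
  have hinj : (∑ g, if BlockInj g then ∑ p, ‖c (p, g)‖ ^ 2 else 0) = 1 - collision c := by
    rw [hcol, ← hone, ← Finset.sum_sub_distrib]
    refine Finset.sum_congr rfl fun g _ => ?_
    split_ifs <;> ring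
  have hrest : ∑ π : Fin 2 → Equiv.Perm (BitString n), ∑ S with ¬S.card = t,
      ∑ p, ‖𝒜.fourView π (p, S)‖ ^ 2 = K * collision c := by
    have h1 : ∀ π : Fin 2 → Equiv.Perm (BitString n), ∑ S with ¬S.card = t,
        ∑ p, ‖𝒜.fourView π (p, S)‖ ^ 2 =
        1 - ∑ S with S.card = t, ∑ p, ‖𝒜.fourView π (p, S)‖ ^ 2 := by
      intro π
      rw [eq_sub_iff_add_eq', Finset.sum_filter_add_sum_filter_not,
        ← Fintype.sum_prod_type_right (f := fun q => ‖𝒜.fourView π q‖ ^ 2), ← l2_sq,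
        l2_fourView, one_pow]
    simp_rw [h1]
    rw [Finset.sum_sub_distrib, hs2, hinj]
    simp only [Finset.sum_const, Finset.card_univ, nsmul_eq_mul, ← hK]
    ring
  have heq : ∑ π : Fin 2 → Equiv.Perm (BitString n), (W * reducedState (𝒜.fourView π)).trace -
        K * (W * reducedState c).trace =
      ∑ π : Fin 2 → Equiv.Perm (BitString n), ∑ S with ¬S.card = t,
        quadForm W (fun p => 𝒜.fourView π (p, S)) -
        K * ∑ g, if BlockInj g then 0 else quadForm W (fun p => c (p, g)) := by
    have h1 : ∑ π : Fin 2 → Equiv.Perm (BitString n), (W * reducedState (𝒜.fourView π)).trace =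
        (K * ∑ g, if BlockInj g then quadForm W (fun p => c (p, g)) else 0) +
        ∑ π : Fin 2 → Equiv.Perm (BitString n), ∑ S with ¬S.card = t,
          quadForm W (fun p => 𝒜.fourView π (p, S)) := by
      rw [← hs1, ← Finset.sum_add_distrib]
      refine Finset.sum_congr rfl fun π _ => ?_
      rw [trace_mul_reducedState_eq_sum, Finset.sum_filter_add_sum_filter_not]
    have h2 : (W * reducedState c).trace =
        (∑ g, if BlockInj g then quadForm W (fun p => c (p, g)) else 0) +
        ∑ g, if BlockInj g then 0 else quadForm W (fun p => c (p, g)) := by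
      rw [trace_mul_reducedState_eq_sum, ← Finset.sum_add_distrib]
      refine Finset.sum_congr rfl fun g _ => ?_
      split_ifs <;> simp
    rw [h1, h2]
    ring
  rw [heq]
  have hb1 : ‖∑ π : Fin 2 → Equiv.Perm (BitString n), ∑ S with ¬S.card = t,
      quadForm W (fun p => 𝒜.fourView π (p, S))‖ ≤ K * collision c := by
    rw [← hrest]
    exact (norm_sum_le _ _).trans (Finset.sum_le_sum fun π _ => (norm_sum_le _ _).trans
      (Finset.sum_le_sum fun S _ => norm_quadForm_le hW _))
  have hb2 : ‖(K : ℂ) * ∑ g, if BlockInj g then 0 else quadForm W (fun p => c (p, g))‖ ≤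
      K * collision c := by
    rw [norm_mul, Complex.norm_natCast, hcol]
    refine mul_le_mul_of_nonneg_left ((norm_sum_le _ _).trans (Finset.sum_le_sum fun g _ => ?_))
      (Nat.cast_nonneg _)
    split_ifs
    · simp
    · exact norm_quadForm_le hW _
  refine (norm_sub_le _ _).trans ?_
  linarith

/-- The randomness of signed permutations after a randomly phased Hadamard transform. -/
abbrev Seed (n : ℕ) : Type :=
  (BitString n → ZMod 3) × (Fin 2 → Equiv.Perm (BitString n)) × (Fin 2 × BitString n → ℤˣ)

/-- The pair of unitaries sampled by a seed. -/
def sample (s : Seed n) (j : Fin 2) : Matrix.unitaryGroup (BitString n) ℂ :=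
  signedPerm (s.2.1 j) (fun x => s.2.2 (j, x)) * hadPhase s.1

/-- The fixed unitaries U and the phased Hadamard are absorbed into the adversary. The reduced
path-recording state does not see them, while the collision weight is averaged down. One phase
vector serves both oracles, because only collisions within one oracle count. -/
lemma norm_sum_seed_sub_le {t : ℕ} (ht : t ≤ 2 ^ n) (𝒜 : Adversary n m t)
    {W : Matrix (BitString n × BitString m) (BitString n × BitString m) ℂ}
    (hW : W ∈ Matrix.unitaryGroup (BitString n × BitString m) ℂ)
    (U : Fin 2 → Matrix.unitaryGroup (BitString n) ℂ) :
    ‖∑ s : Seed n, (W * reducedState (𝒜.unitaryView fun j => sample s j * U j)).trace -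
        Fintype.card (Seed n) * (W * reducedState (𝒜.recView (prWeight n))).trace‖ ≤
      Fintype.card (Seed n) * (4 * t ^ 2 / 2 ^ n) := by
  set Kp := Fintype.card (Fin 2 → Equiv.Perm (BitString n)) with hKp
  set Kf := Fintype.card (Fin 2 × BitString n → ℤˣ) with hKf
  set Kk := Fintype.card (BitString n → ZMod 3) with hKk
  set z := (W * reducedState (𝒜.recView (prWeight n))).trace with hz
  have hcard : Fintype.card (Seed n) = Kk * (Kp * Kf) := by
    rw [Fintype.card_prod, Fintype.card_prod]
  set 𝒜k : (BitString n → ZMod 3) → Adversary n m t :=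
    fun k => 𝒜.twist fun j => hadPhase k * U j with h𝒜k
  have hview : ∀ k π (f : Fin 2 × BitString n → ℤˣ),
      𝒜.unitaryView (fun j => sample (k, π, f) j * U j) =
        (𝒜k k).unitaryView fun j => signedPerm (π j) fun x => f (j, x) := by
    intro k π f
    rw [h𝒜k, unitaryView_twist]
    simp only [sample, mul_assoc]
  have hsum : ∑ s : Seed n, (W * reducedState (𝒜.unitaryView fun j => sample s j * U j)).trace =
      ∑ k, (Kf : ℂ) * ∑ π : Fin 2 → Equiv.Perm (BitString n),
        (W * reducedState ((𝒜k k).fourView π)).trace := by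
    rw [Fintype.sum_prod_type]
    refine Finset.sum_congr rfl fun k _ => ?_
    rw [Fintype.sum_prod_type, Finset.mul_sum]
    refine Finset.sum_congr rfl fun π _ => ?_
    simp_rw [hview]
    rw [← Matrix.trace_sum, ← Finset.mul_sum, sum_signs_reducedState, Matrix.mul_smul,
      Matrix.trace_smul, smul_eq_mul]
  have hsplit : ∑ s : Seed n,
        (W * reducedState (𝒜.unitaryView fun j => sample s j * U j)).trace -
        Fintype.card (Seed n) * z =
      ∑ k, (Kf : ℂ) * (∑ π : Fin 2 → Equiv.Perm (BitString n),
        (W * reducedState ((𝒜k k).fourView π)).trace - Kp * z) := by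
    rw [hsum, hcard]
    simp only [mul_sub, Finset.sum_sub_distrib, Finset.sum_const, Finset.card_univ, nsmul_eq_mul,
      ← hKk]
    push_cast
    ring
  have hcol : ∑ k, collision ((𝒜k k).recView (prWeight n)) ≤ Kk * (2 * t ^ 2 / 2 ^ n) := by
    have h1 : ∀ k, (𝒜k k).recView (prWeight n) = applyRec (onRec fun j => (twirl k j).1)
        ((𝒜.twist U).recView (prWeight n)) := by
      intro k
      rw [h𝒜k, recView_twist, recView_twist, ← applyRec_mul, onRec_mul]
      rfl
    simp_rw [h1]
    obtain ⟨h2, h3⟩ := recView_prWeight_spec (𝒜.twist U)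
    have h4 := sum_collision_twirl_le _ h2
    rw [h3 ht, one_pow, mul_one] at h4
    exact h4
  rw [hsplit]
  calc _ ≤ ∑ k, (Kf : ℝ) * (Kp * (2 * collision ((𝒜k k).recView (prWeight n)))) := by
        refine (norm_sum_le _ _).trans (Finset.sum_le_sum fun k _ => ?_)
        rw [norm_mul, Complex.norm_natCast]
        refine mul_le_mul_of_nonneg_left ?_ (Nat.cast_nonneg _)
        have h := norm_sum_fourView_sub_le ht (𝒜k k) hW
        rwa [h𝒜k, reducedState_recView_twist] at h
    _ = Kf * Kp * 2 * ∑ k, collision ((𝒜k k).recView (prWeight n)) := by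
        rw [Finset.mul_sum]
        exact Finset.sum_congr rfl fun k _ => by ring
    _ ≤ Kf * Kp * 2 * (Kk * (2 * t ^ 2 / 2 ^ n)) :=
        mul_le_mul_of_nonneg_left hcol (by positivity)
    _ = _ := by
        rw [hcard]
        push_cast
        ring

end

/-! ### Haar-random unitaries -/

open MeasureTheory

lemma continuous_foldl {Z ι : Type*} [TopologicalSpace Z] : ∀ (t : ℕ)
    (f : Z → (ι → ℂ) → Fin t → (ι → ℂ)) (a : ι → ℂ)
    (_ : ∀ (i : Fin t) (g : Z → ι → ℂ), Continuous g → Continuous fun z => f z (g z) i),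
    Continuous fun z => Fin.foldl t (f z) a := by
  intro t
  induction t with
  | zero => intro f a _; simpa using continuous_const
  | succ t ih =>
    intro f a hf
    simp only [Fin.foldl_succ_last]
    exact hf (Fin.last t) _ (ih _ a fun i g hg => hf i.castSucc g hg)

section
variable {n m : ℕ}

instance secondCountableTopology_unitaryGroup :
    SecondCountableTopology (Matrix.unitaryGroup (BitString n) ℂ) :=
  haveI : SecondCountableTopology (Matrix (BitString n) (BitString n) ℂ) :=
    inferInstanceAs (SecondCountableTopology (BitString n → BitString n → ℂ))
  TopologicalSpace.Subtype.secondCountableTopology _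

instance isProbabilityMeasure_haar : IsProbabilityMeasure (haar n) :=
  ⟨by
    have h := Measure.haarMeasure_self
      (K₀ := (⊤ : TopologicalSpace.PositiveCompacts (Matrix.unitaryGroup (BitString n) ℂ)))
    simpa [haar] using h⟩

instance isMulLeftInvariant_haar : (haar n).IsMulLeftInvariant :=
  inferInstanceAs (Measure.haarMeasure _).IsMulLeftInvariant

lemma continuous_unitaryView {t : ℕ} (𝒜 : Adversary n m t) :
    Continuous fun C : Matrix.unitaryGroup (BitString n) ℂ × Matrix.unitaryGroup (BitString n) ℂ =>
      𝒜.unitaryView ![C.1, C.2] := by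
  refine continuous_foldl t
    (fun (C : Matrix.unitaryGroup (BitString n) ℂ × Matrix.unitaryGroup (BitString n) ℂ)
      (ψ : (BitString n × BitString m) × Unit → ℂ) i =>
        applyOracle (unitaryOracle C.1 C.2 (𝒜.query i)) (applyLocal (𝒜.unitary i).1 ψ))
    _ fun i g hg => ?_
  have h1 : ∀ q, Continuous fun C => g C q := fun q => (continuous_apply q).comp hg
  refine continuous_pi fun p => ?_
  simp only [applyOracle, applyLocal]
  refine continuous_finsetSum _ fun q _ => Continuous.mul ?_
    (continuous_finsetSum _ fun r _ => continuous_const.mul (h1 _))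
  have h2 : ∀ x y, Continuous fun U : Matrix.unitaryGroup (BitString n) ℂ => U.1 x y :=
    fun x y => continuous_subtype_val.matrix_elem x y
  simp only [unitaryOracle, Matrix.of_apply]
  split_ifs
  · exact (h2 _ _).comp continuous_fst
  · exact (h2 _ _).comp continuous_snd

lemma continuous_reducedState_unitaryView {t : ℕ} (𝒜 : Adversary n m t)
    (i j : BitString n × BitString m) :
    Continuous fun C : Matrix.unitaryGroup (BitString n) ℂ × Matrix.unitaryGroup (BitString n) ℂ =>
      reducedState (𝒜.unitaryView ![C.1, C.2]) i j := by
  have h1 : ∀ q, Continuous fun C : Matrix.unitaryGroup (BitString n) ℂ ×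
      Matrix.unitaryGroup (BitString n) ℂ => 𝒜.unitaryView ![C.1, C.2] q :=
    fun q => (continuous_apply q).comp (continuous_unitaryView 𝒜)
  simp only [reducedState, Matrix.of_apply]
  exact continuous_finsetSum _ fun e _ => (h1 _).mul (h1 _).star

lemma integrable_of_continuous {f : Matrix.unitaryGroup (BitString n) ℂ ×
    Matrix.unitaryGroup (BitString n) ℂ → ℂ} (hf : Continuous f) :
    Integrable f ((haar n).prod (haar n)) :=
  hf.integrable_of_hasCompactSupport (HasCompactSupport.of_compactSpace f)

lemma isHermitian_haarState {t : ℕ} (𝒜 : Adversary n m t) : 𝒜.haarState.IsHermitian := by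
  ext i j
  simp only [Matrix.conjTranspose_apply, Adversary.haarState, Matrix.of_apply]
  rw [Complex.star_def, ← integral_conj]
  refine integral_congr_ae (Filter.Eventually.of_forall fun C => ?_)
  exact congrFun (congrFun (isHermitian_reducedState
    (𝒜.view (unitaryOracle C.1 C.2) fun _ => 1)) i) j

lemma trace_mul_haarState {t : ℕ} (𝒜 : Adversary n m t)
    (W : Matrix (BitString n × BitString m) (BitString n × BitString m) ℂ) :
    (W * 𝒜.haarState).trace =
      ∫ C, (W * reducedState (𝒜.unitaryView ![C.1, C.2])).trace ∂((haar n).prod (haar n)) := by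
  simp only [Matrix.trace, Matrix.diag, Matrix.mul_apply]
  have hint : ∀ i j, Integrable (fun C : Matrix.unitaryGroup (BitString n) ℂ ×
      Matrix.unitaryGroup (BitString n) ℂ =>
        W i j * reducedState (𝒜.unitaryView ![C.1, C.2]) j i) ((haar n).prod (haar n)) :=
    fun i j => (integrable_of_continuous (continuous_reducedState_unitaryView 𝒜 j i)).const_mul _
  rw [integral_finsetSum _ fun i _ => integrable_finsetSum _ fun j _ => hint i j]
  refine Finset.sum_congr rfl fun i _ => ?_
  rw [integral_finsetSum _ fun j _ => hint i j]
  refine Finset.sum_congr rfl fun j _ => ?_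
  rw [integral_const_mul]
  rfl

/-- Left invariance replaces the integrand by its average over all seeds, and the seed bound holds
uniformly in the Haar variable. -/
lemma norm_trace_haar_sub_pr_le_of_le {t : ℕ} (ht : t ≤ 2 ^ n) (𝒜 : Adversary n m t)
    {W : Matrix (BitString n × BitString m) (BitString n × BitString m) ℂ}
    (hW : W ∈ Matrix.unitaryGroup (BitString n × BitString m) ℂ) :
    ‖(W * 𝒜.haarState).trace - (W * reducedState (𝒜.recView (prWeight n))).trace‖ ≤
      4 * t ^ 2 / 2 ^ n := by
  set μ := (haar n).prod (haar n) with hμ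
  set z := (W * reducedState (𝒜.recView (prWeight n))).trace with hz
  set F : Matrix.unitaryGroup (BitString n) ℂ × Matrix.unitaryGroup (BitString n) ℂ → ℂ :=
    fun C => (W * reducedState (𝒜.unitaryView ![C.1, C.2])).trace with hF
  set K := Fintype.card (Seed n) with hK
  have hKpos : (0 : ℝ) < K := by
    have : 0 < K := Fintype.card_pos
    exact_mod_cast this
  have hFc : Continuous F := by
    simp only [hF, Matrix.trace, Matrix.diag, Matrix.mul_apply]
    exact continuous_finsetSum _ fun i _ => continuous_finsetSum _ fun j _ =>
      continuous_const.mul (continuous_reducedState_unitaryView 𝒜 j i)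
  have hshift : ∀ s : Seed n, Integrable (fun C => F ((sample s 0, sample s 1) * C)) μ := fun s =>
    integrable_of_continuous (hFc.comp (continuous_const.mul continuous_id))
  have hinv : ∀ s : Seed n, ∫ C, F ((sample s 0, sample s 1) * C) ∂μ = ∫ C, F C ∂μ := fun s =>
    integral_mul_left_eq_self F (sample s 0, sample s 1)
  have heq : (K : ℂ) * (∫ C, F C ∂μ - z) =
      ∫ C, (∑ s : Seed n, F ((sample s 0, sample s 1) * C) - K * z) ∂μ := by
    rw [integral_sub (integrable_finsetSum _ fun s _ => hshift s) (integrable_const _),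
      integral_finsetSum _ fun s _ => hshift s]
    simp only [hinv, Finset.sum_const, Finset.card_univ, nsmul_eq_mul, integral_const,
      probReal_univ, one_smul, mul_sub, ← hK]
  have hbound : ∀ C, ‖∑ s : Seed n, F ((sample s 0, sample s 1) * C) - K * z‖ ≤
      K * (4 * t ^ 2 / 2 ^ n) := by
    intro C
    refine le_of_eq_of_le ?_ (norm_sum_seed_sub_le ht 𝒜 hW ![C.1, C.2])
    congr 2
  have hle := norm_integral_le_of_norm_le_const (μ := μ) (Filter.Eventually.of_forall hbound)
  rw [← heq, probReal_univ, mul_one, norm_mul, Complex.norm_natCast] at hle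
  rw [trace_mul_haarState]
  exact le_of_mul_le_mul_left hle hKpos

lemma l2_unitaryView {t : ℕ} (𝒜 : Adversary n m t)
    (C : Fin 2 → Matrix.unitaryGroup (BitString n) ℂ) : l2 (𝒜.unitaryView C) = 1 := by
  refine foldl_ind (fun _ a => l2 a = 1) t _ _ ?_ ?_
  · rw [← sq_eq_sq₀ (l2_nonneg _) zero_le_one, l2_sq, Finset.sum_eq_single (0, ())]
    · simp
    · rintro ⟨p, e⟩ _ h
      have : p ≠ 0 := fun h' => h (by rw [h'])
      simp [this]
    · simp
  · intro i a h
    rw [applyOracle_unitaryOracle, l2_applyLocal (onA_mem_unitaryGroup (C _).2),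
      l2_applyLocal (𝒜.unitary i).2, h]

lemma norm_trace_haar_sub_pr_le {t : ℕ} (𝒜 : Adversary n m t)
    {W : Matrix (BitString n × BitString m) (BitString n × BitString m) ℂ}
    (hW : W ∈ Matrix.unitaryGroup (BitString n × BitString m) ℂ) :
    ‖(W * 𝒜.haarState).trace - (W * reducedState (𝒜.recView (prWeight n))).trace‖ ≤
      2 * (4 * ((t : ℝ) ^ 2 / Real.sqrt (2 ^ n))) := by
  rcases le_total t (2 ^ n) with ht | ht
  · refine (norm_trace_haar_sub_pr_le_of_le ht 𝒜 hW).trans ?_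
    have h1 : (1 : ℝ) ≤ 2 ^ n := one_le_pow₀ (by norm_num)
    have h2 : Real.sqrt ((2 : ℝ) ^ n) ≤ 2 ^ n := by
      rw [Real.sqrt_le_left (by positivity)]; nlinarith
    have h3 : (t : ℝ) ^ 2 / 2 ^ n ≤ (t : ℝ) ^ 2 / Real.sqrt (2 ^ n) :=
      div_le_div_of_nonneg_left (by positivity) (by positivity) h2
    have h4 : (0 : ℝ) ≤ (t : ℝ) ^ 2 / Real.sqrt (2 ^ n) := by positivity
    rw [mul_div_assoc]
    linarith
  -- More than N queries may exhaust the free outputs, but then the bound is trivial.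
  · have h1 := one_le_four_mul_sq_div_sqrt (n := n) (t := t) (by omega)
    have h2 : ‖(W * 𝒜.haarState).trace‖ ≤ 1 := by
      rw [trace_mul_haarState]
      have := norm_integral_le_of_norm_le_const (μ := (haar n).prod (haar n)) (C := 1)
        (f := fun C => (W * reducedState (𝒜.unitaryView ![C.1, C.2])).trace)
        (Filter.Eventually.of_forall fun C => by
          refine (norm_trace_mul_reducedState_le hW _).trans ?_
          rw [l2_unitaryView, one_pow])
      rwa [probReal_univ, mul_one] at this
    have h3 := norm_trace_mul_reducedState_le hW (𝒜.recView (prWeight n))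
    have h4 := l2_recView_le 𝒜 _ fun j g => sum_prWeight_sq_le g j
    have h5 := l2_nonneg (𝒜.recView (prWeight n))
    have h6 := norm_sub_le (W * 𝒜.haarState).trace
      (W * reducedState (𝒜.recView (prWeight n))).trace
    nlinarith

lemma recState_prOracle {t : ℕ} (𝒜 : Adversary n m t) :
    𝒜.recState (prOracle n) = reducedState (𝒜.recView (prWeight n)) :=
  recState_eq 𝒜 prOracle_mulVec

lemma recState_cfprOracle {t : ℕ} (ℓ lam : ℕ) (𝒜 : Adversary n m t) :
    𝒜.recState (cfprOracle n ℓ lam) = reducedState (𝒜.recView (cfWeight n ℓ lam)) :=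
  recState_eq 𝒜 (cfprOracle_mulVec ℓ lam)

lemma traceDist_cf_pr_le {ℓ lam t : ℕ} (hl : lam ≤ n) (hℓ : 1 ≤ ℓ) (𝒜 : Adversary n m t) :
    traceDist (𝒜.recState (cfprOracle n ℓ lam)) (𝒜.recState (prOracle n)) ≤
      4 * cfError ℓ lam t := by
  rw [recState_prOracle, recState_cfprOracle]
  exact traceDist_le (isHermitian_reducedState _) (isHermitian_reducedState _) fun W hW =>
    norm_trace_cf_sub_pr_le hl hℓ 𝒜 hW

/-- Triangle inequality through independent path recording. The Haar error fits into the
collision-free error because λ ≤ n and ℓ ≥ 1, whence 4 + 4 = 8. -/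
lemma traceDist_cf_haar_le {ℓ lam t : ℕ} (hl : lam ≤ n) (hℓ : 1 ≤ ℓ) (𝒜 : Adversary n m t) :
    traceDist (𝒜.recState (cfprOracle n ℓ lam)) 𝒜.haarState ≤ 8 * cfError ℓ lam t := by
  rw [recState_cfprOracle]
  refine traceDist_le (isHermitian_reducedState _) (isHermitian_haarState 𝒜) fun W hW => ?_
  have h1 := norm_trace_cf_sub_pr_le hl hℓ 𝒜 hW
  have h2 := norm_trace_haar_sub_pr_le 𝒜 hW
  have h3 := sq_div_sqrt_le_cfError t hl hℓ
  rw [norm_sub_rev] at h2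
  have h4 := norm_sub_le_norm_sub_add_norm_sub
    (W * reducedState (𝒜.recView (cfWeight n ℓ lam))).trace
    (W * reducedState (𝒜.recView (prWeight n))).trace (W * 𝒜.haarState).trace
  linarith

end

end

end PathRec

/-! ### Assembly of the bounds -/

theorem mainTheorem8 :
    (∃ C : ℝ, 0 < C ∧ ∀ n lam ℓ m t : ℕ, lam ≤ n → 1 ≤ ℓ →
      ∀ 𝒜 : PathRec.Adversary n m t,
        PathRec.traceDist (𝒜.recState (PathRec.cfprOracle n ℓ lam))
            (𝒜.recState (PathRec.prOracle n)) ≤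
          C * (Real.sqrt ℓ * (t : ℝ) ^ (ℓ + 1) / (2 : ℝ) ^ ((lam : ℝ) / 2))) ∧
    (∃ C : ℝ, 0 < C ∧ ∀ n lam ℓ m t : ℕ, lam ≤ n → 1 ≤ ℓ →
      ∀ 𝒜 : PathRec.Adversary n m t,
        PathRec.traceDist (𝒜.recState (PathRec.cfprOracle n ℓ lam)) 𝒜.haarState ≤
          C * (Real.sqrt ℓ * (t : ℝ) ^ (ℓ + 1) / (2 : ℝ) ^ ((lam : ℝ) / 2)) +
            4 * (t : ℝ) * ((t : ℝ) - 1) / ((2 : ℝ) ^ n + 1)) ∧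
    (∀ (n : ℕ) (j : Fin 2), PathRec.sharedPrOracle n j = PathRec.cfprOracle n 1 n j) ∧
    (∃ C : ℝ, 0 < C ∧ ∀ n m t : ℕ, ∀ 𝒜 : PathRec.Adversary n m t,
      PathRec.traceDist (𝒜.recState (PathRec.sharedPrOracle n)) 𝒜.haarState ≤
        C * ((t : ℝ) ^ 2 / Real.sqrt ((2 : ℝ) ^ n))) := by
  refine ⟨⟨4, by norm_num, fun n lam ℓ m t hl hℓ 𝒜 => PathRec.traceDist_cf_pr_le hl hℓ 𝒜⟩,
    ⟨8, by norm_num, fun n lam ℓ m t hl hℓ 𝒜 => ?_⟩, PathRec.sharedPrOracle_eq,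
    ⟨8, by norm_num, fun n m t 𝒜 => ?_⟩⟩
  -- The first summand already suffices; the second is nonnegative since t is a natural number.
  · refine (PathRec.traceDist_cf_haar_le hl hℓ 𝒜).trans (le_add_of_nonneg_right ?_)
    have h : (0 : ℝ) ≤ t * (t - 1) := by
      rcases Nat.eq_zero_or_pos t with rfl | h0
      · simp
      · have : (1 : ℝ) ≤ t := by exact_mod_cast h0
        nlinarith
    rw [mul_assoc]
    positivity
  · have h := PathRec.traceDist_cf_haar_le (le_refl n) (le_refl 1) 𝒜
    rw [show PathRec.sharedPrOracle n = PathRec.cfprOracle n 1 n from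
      funext (PathRec.sharedPrOracle_eq n)]
    refine h.trans (le_of_eq ?_)
    -- At ℓ = 1 and λ = n the error is exactly t²/√N.
    rw [PathRec.cfError, PathRec.two_rpow_half]
    norm_num
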